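/- **Setting.** Let $f:[a,b]\to[a,b]$ be a quasi-quadratic map: $f$ is $C^3$, $f(\{a,b\})\subset\{a,b\}$, $f$ has a unique critical point $c\in(a,b)$ in $(a,b)$, $f''(c)\neq 0$, and $f$ has negative Schwarzian derivative on $(a,b)\setminus\{c\}$. Assume that $c$ is recurrent ($c\in\omega(c)$). Let $I^0=(p,q)\ni c$, $a<p<q<b$, be an open interval such that $f(p)=f(q)$ and $f^t(p)\notin I^0$ for all $t\ge1$ (for example the interval bounded by an orientation-reversing fixed point $\alpha\in(a,b)$ and the other preimage $\alpha'$ of $\alpha$). The principal nest $I^0\supset I^1\supset\dots$ is defined inductively: $I^{n}$ is the component containing $c$ of the domain of the first return map $g_n$ to $I^{n-1}$. The intervals of level $n\ge 1$, denoted $I^n_j$, are the components of the domain of $g_n$ that meet $\mathrm{orb}(c)=\{f^t(c):t\ge 0\}$; $I^n_0=I^n$. Assume that there are no central returns: $g_n(c)\notin I^n$ for all $n\ge1$. Let $\mu_n=|I^n|/|I^{n-1}|$ ($n\ge 1$) be the scaling factors. For an interval $G$ compactly contained in an interval $L$, with $U,V$ the components of $L\setminus G$, let $P(G|L)=\log(1+|G|/|U|)+\log(1+|G|/|V|)$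 be the Poincaré length. The central interval $I^n$ has rank $0$. A non-central interval $I^n_j$ has rank $k\ge1$ if $\mathrm{orb}(c)$ first passes through $I^n_j$ before its first return to $I^{n+k-1}$ but not before its first return to $I^{n+k-2}$. **Lemma 4.6.** (1) If the scaling factors stay away from $0$, i.e. $\inf_{n\ge1}\mu_n>0$, then the ranks of all intervals $I^n_j$ are uniformly bounded: there is an $N$ such that every $I^n_j$, $n\ge1$, has a rank, and this rank is at most $N$. (2) Let $\bar\lambda$ be any number such that $P(I^n|I^{n-1})\le\bar\lambda$ for all $n\ge1$, and put $\bar\sigma=e^{\bar\lambda}/(1+e^{\bar\lambda})<1$. Then there is a constant $C$ such that for every interval $I^n_j$, $n\ge 1$, of rank $k\ge2$ the following hold. There are an open interval $K'\subset I^{n+k-2}\setminus I^{n+k-1}$ which is mapped diffeomorphically onto $I^n_j$ by some iterate of $f$, and an interval $I^{n+k-1}_i$ of level $n+k-1$ whose closure is contained in $K'$, with $$P(I^{n+k-1}_i\,|\,I^{n+k-2})\le P(I^{n+k-1}_i\,|\,K')\le C\bar\sigma^{\,k-1};$$ moreover $\mu_{n+k}\le C\bar\sigma^{(k-1)/2}$.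 -/

import Mathlib

open Set Filter

noncomputable section

namespace PrincipalNest

/-- The Schwarzian derivative `f'''/f' - (3/2) (f''/f')²`. -/
def schwarzian (f : ℝ → ℝ) (x : ℝ) : ℝ :=
  iteratedDeriv 3 f x / deriv f x - 3 / 2 * (iteratedDeriv 2 f x / deriv f x) ^ 2

/-- A quasi-quadratic map of `[a, b]`: a `C³` unimodal map of `[a, b]` into itself that preserves
the boundary, has negative Schwarzian derivative off its unique critical point `c`, and whose
critical point is non-degenerate. -/
structure IsQuasiQuadratic (f : ℝ → ℝ) (a b c : ℝ) : Prop where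
  crit_mem : c ∈ Ioo a b
  mapsTo : MapsTo f (Icc a b) (Icc a b)
  boundary : MapsTo f {a, b} {a, b}
  contDiffOn : ContDiffOn ℝ 3 f (Icc a b)
  deriv_crit : deriv f c = 0
  nondegenerate : iteratedDeriv 2 f c ≠ 0
  deriv_ne : ∀ x ∈ Ioo a b, x ≠ c → deriv f x ≠ 0
  schwarzian_neg : ∀ x ∈ Ioo a b, x ≠ c → schwarzian f x < 0

/-- An initial interval `(p, q) ∋ c`: its endpoints have the same image, and their forward orbits
never enter `(p, q)`. -/
structure IsInitialInterval (f : ℝ → ℝ) (a b c p q : ℝ) : Prop where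
  left_mem : p ∈ Ioo a c
  right_mem : q ∈ Ioo c b
  symmetric : f p = f q
  nice : ∀ t : ℕ, 1 ≤ t → f^[t] p ∉ Ioo p q

/-- The critical point is recurrent: `c ∈ ω(c)`. -/
def IsRecurrent (f : ℝ → ℝ) (c : ℝ) : Prop :=
  MapClusterPt c atTop (fun t : ℕ => f^[t] c)

/-- The points of `T` whose orbits return to `T`: the domain of the first return map to `T`. -/
def returnDomain (f : ℝ → ℝ) (T : Set ℝ) : Set ℝ :=
  {x | x ∈ T ∧ ∃ t : ℕ, 1 ≤ t ∧ f^[t] x ∈ T}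

/-- The principal nest `I⁰ ⊃ I¹ ⊃ …`: `I^{n+1}` is the component around `c` of the domain of the
first return map to `I^n`. -/
def nest (f : ℝ → ℝ) (c : ℝ) (J : Set ℝ) : ℕ → Set ℝ
  | 0 => J
  | n + 1 => connectedComponentIn (returnDomain f (nest f c J n)) c

/-- The intervals `I^n_j` of level `n ≥ 1`: the components of the domain of the first return map to
`I^{n-1}` that meet the orbit of `c`. -/
def levelIntervals (f : ℝ → ℝ) (c : ℝ) (J : Set ℝ) (n : ℕ) : Set (Set ℝ) :=
  {K | ∃ t : ℕ, f^[t] c ∈ returnDomain f (nest f c J (n - 1)) ∧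
    K = connectedComponentIn (returnDomain f (nest f c J (n - 1))) (f^[t] c)}

/-- `t ≥ 1` is the first positive time at which the orbit of `c` is in `A`. -/
def IsFirstPassage (f : ℝ → ℝ) (c : ℝ) (A : Set ℝ) (t : ℕ) : Prop :=
  1 ≤ t ∧ f^[t] c ∈ A ∧ ∀ s : ℕ, 1 ≤ s → s < t → f^[s] c ∉ A

/-- There are no central returns: for every `n ≥ 1` the first return of `c` to `I^{n-1}` does not
lie in `I^n`. -/
def NoCentralReturns (f : ℝ → ℝ) (c : ℝ) (J : Set ℝ) : Prop :=
  ∀ n : ℕ, 1 ≤ n → ∀ t : ℕ,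
    IsFirstPassage f c (nest f c J (n - 1)) t → f^[t] c ∉ nest f c J n

/-- The interval `K` of level `n ≥ 1` has rank `k`. A critical interval has rank `0`; otherwise
`k ≥ 1`, and the orbit of `c` first passes through `K` before its first return to `I^{n+k-1}` but
not before its first return to `I^{n+k-2}`. -/
def HasRank (f : ℝ → ℝ) (c : ℝ) (J : Set ℝ) (n : ℕ) (K : Set ℝ) (k : ℕ) : Prop :=
  (c ∈ K ∧ k = 0) ∨
  (c ∉ K ∧ 1 ≤ k ∧ ∃ l r r' : ℕ, IsFirstPassage f c K l ∧
    IsFirstPassage f c (nest f c J (n + k - 2)) r ∧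
    IsFirstPassage f c (nest f c J (n + k - 1)) r' ∧ r ≤ l ∧ l < r')

/-- The length of a bounded interval. -/
def len (K : Set ℝ) : ℝ := sSup K - sInf K

/-- The scaling factor `μ_n = |I^n| / |I^{n-1}|`, `n ≥ 1`. -/
def scalingFactor (f : ℝ → ℝ) (c : ℝ) (J : Set ℝ) (n : ℕ) : ℝ :=
  len (nest f c J n) / len (nest f c J (n - 1))

/-- The Poincaré length `P(G | L) = log (1 + |G|/|U|) + log (1 + |G|/|V|)` of an interval `G`
compactly contained in an interval `L`, where `U` and `V` are the components of `L \ G`. -/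
def poincareLength (G L : Set ℝ) : ℝ :=
  Real.log (1 + len G / (sInf G - sInf L)) + Real.log (1 + len G / (sSup L - sSup G))

/-- `K'` is a monotone pull-back of `K`: an open interval that `f^m` maps diffeomorphically
onto `K`. -/
def IsMonotonePullback (f : ℝ → ℝ) (m : ℕ) (K' K : Set ℝ) : Prop :=
  IsOpen K' ∧ K'.OrdConnected ∧ BijOn f^[m] K' K ∧ ∀ x ∈ K', deriv f^[m] x ≠ 0

/-- `σ̄ = e^λ̄ / (1 + e^λ̄)`. -/
def sigmaBar (lam : ℝ) : ℝ := Real.exp lam / (1 + Real.exp lam)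

end PrincipalNest

end

/-!
Negative Schwarzian derivative means that pulling a pair of intervals back along a monotone branch
of an iterate of `f` does not increase its Poincaré length.

Let `I^n_j` have rank `k ≥ 2`, and let `K'` be its pull-back along the orbit of `c` from the last
visit to `I^{n+k-2}` before the first passage through `I^n_j`. From `I^n_j` the orbit returns to
`I^{n-1}` and then lands in `I^n`, …, `I^{n+k-2}` one after the other. Each landing branch has
Poincaré length at most `λ̄` in its extension to the preceding interval of the nest, and this
extension is contained in the preceding landing branch; so every step multiplies the relative length
by at most `σ̄`. Pulling the last landing branch back into `K'` gives the interval of level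
`n + k - 1`. Pulling it back further to the critical value bounds `μ_{n+k}`, the square root coming
from the quadratic critical point.

The Poincaré lengths `P(I^n | I^{n-1})` are always bounded: the gap between `I^n` and `I^{n+1}`
relative to `I^n` either does not decrease in the next step or is bounded below one or two steps
later. So the above applies with some `λ̄`, and intervals of large rank force small scaling factors.
-/

namespace PrincipalNest

section Schwarzian

lemma hasDerivAt_iteratedDeriv {f : ℝ → ℝ} {x : ℝ} {N : WithTop ℕ∞} (hf : ContDiffAt ℝ N f x)
    {n : ℕ} (hn : ((n + 1 : ℕ) : WithTop ℕ∞) ≤ N) :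
    HasDerivAt (iteratedDeriv n f) (iteratedDeriv (n + 1) f x) x := by
  have hdiff : DifferentiableAt ℝ (iteratedFDeriv ℝ n f) x :=
    ((hf.of_le hn).iteratedFDeriv_right (m := 1) (by push_cast; rw [add_comm])).differentiableAt
      one_ne_zero
  rw [iteratedDeriv_succ, hasDerivAt_deriv_iff, iteratedDeriv_eq_equiv_comp]
  exact (LinearIsometryEquiv.differentiableAt _).comp x hdiff

lemma hasDerivAt_deriv {f : ℝ → ℝ} {x : ℝ} {N : WithTop ℕ∞} (hf : ContDiffAt ℝ N f x)
    (hN : 2 ≤ N) : HasDerivAt (deriv f) (iteratedDeriv 2 f x) x :=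
  iteratedDeriv_one (f := f) ▸ hasDerivAt_iteratedDeriv hf (n := 1) hN

variable {f : ℝ → ℝ}

lemma hasDerivAt_sqrt_deriv {w : ℝ} (hf : ContDiffAt ℝ 3 f w) (hpos : 0 < deriv f w) :
    HasDerivAt (fun w => √(deriv f w)) (iteratedDeriv 2 f w / (2 * √(deriv f w))) w :=
  (hasDerivAt_deriv hf (by norm_num)).sqrt hpos.ne'

lemma hasDerivAt_affine_comp_div_sqrt_deriv {w : ℝ} (hf : ContDiffAt ℝ 3 f w)
    (hpos : 0 < deriv f w) (A B : ℝ) :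
    HasDerivAt (fun w => (A + B * f w) / √(deriv f w))
      (B * √(deriv f w) - (A + B * f w) * iteratedDeriv 2 f w / (2 * deriv f w * √(deriv f w)))
      w := by
  have hf₁ : HasDerivAt f (deriv f w) w := (hf.differentiableAt (by norm_num)).hasDerivAt
  refine (((hf₁.const_mul B).const_add A).div (hasDerivAt_sqrt_deriv hf hpos)
    (Real.sqrt_pos.2 hpos).ne').congr_deriv ?_
  have hs := Real.sqrt_pos.2 hpos
  have hsq := Real.sq_sqrt hpos.le
  set s := √(deriv f w)
  rw [← hsq]
  field_simp

/-- The identity `ψ'' = -ψ · S f / 2` for `ψ = (A + B f) / √f'`. -/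
lemma hasDerivAt_deriv_affine_comp_div_sqrt_deriv {w : ℝ} (hf : ContDiffAt ℝ 3 f w)
    (hpos : 0 < deriv f w) (A B : ℝ) :
    HasDerivAt
      (fun w => B * √(deriv f w) -
        (A + B * f w) * iteratedDeriv 2 f w / (2 * deriv f w * √(deriv f w)))
      ((A + B * f w) / √(deriv f w) * (-1 / 2 * schwarzian f w)) w := by
  have hf₁ : HasDerivAt f (deriv f w) w := (hf.differentiableAt (by norm_num)).hasDerivAt
  have hf₂ := hasDerivAt_deriv hf (by norm_num)
  have hf₃ := hasDerivAt_iteratedDeriv hf (n := 2) le_rfl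
  have hs := Real.sqrt_pos.2 hpos
  refine (((hasDerivAt_sqrt_deriv hf hpos).const_mul B).sub
    ((((hf₁.const_mul B).const_add A).mul hf₃).div
      ((hf₂.const_mul 2).mul (hasDerivAt_sqrt_deriv hf hpos))
      (mul_pos (mul_pos two_pos hpos) hs).ne')).congr_deriv ?_
  have hsq := Real.sq_sqrt hpos.le
  simp only [Pi.mul_apply, schwarzian]
  set s := √(deriv f w)
  rw [← hsq]
  field_simp
  ring

lemma convexOn_affine_comp_div_sqrt_deriv {s : Set ℝ} (hs : IsOpen s) (hconv : Convex ℝ s)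
    (hf : ContDiffOn ℝ 3 f s) (hpos : ∀ w ∈ s, 0 < deriv f w) (hS : ∀ w ∈ s, schwarzian f w < 0)
    {A B : ℝ} (hAB : ∀ w ∈ s, 0 < A + B * f w) :
    ConvexOn ℝ s fun w => (A + B * f w) / √(deriv f w) := by
  have hfat : ∀ w ∈ s, ContDiffAt ℝ 3 f w := fun w hw => hf.contDiffAt (hs.mem_nhds hw)
  have hderiv := fun w (hw : w ∈ s) =>
    hasDerivAt_affine_comp_div_sqrt_deriv (hfat w hw) (hpos w hw) A B
  refine convexOn_of_hasDerivWithinAt2_nonneg hconv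
    (fun w hw => (hderiv w hw).continuousAt.continuousWithinAt)
    (fun w hw => (hderiv w (interior_subset hw)).hasDerivWithinAt)
    (fun w hw => (hasDerivAt_deriv_affine_comp_div_sqrt_deriv (hfat w (interior_subset hw))
      (hpos w (interior_subset hw)) A B).hasDerivWithinAt) fun w hw => ?_
  have hw' := interior_subset hw
  have hψ : 0 ≤ (A + B * f w) / √(deriv f w) := div_nonneg (hAB w hw').le (Real.sqrt_nonneg _)
  exact mul_nonneg hψ (by linarith [hS w hw'])

/-- The slopes of `g` over the three intervals would be `1`, less than `1` and more than `1` if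
`g w₂ < w₂`, so that `ψ` would have an interior maximum. -/
lemma le_apply_of_hasDerivAt_div_sq {g ψ : ℝ → ℝ} {C w₀ w₁ w₂ w₃ : ℝ}
    (hg : ContinuousOn g (Icc w₀ w₃)) (hg' : ∀ w ∈ Ioo w₀ w₃, HasDerivAt g (C / ψ w ^ 2) w)
    (hψ : ConvexOn ℝ (Ioo w₀ w₃) ψ) (hψ_pos : ∀ w ∈ Ioo w₀ w₃, 0 < ψ w)
    (h01 : w₀ < w₁) (h12 : w₁ < w₂) (h23 : w₂ < w₃)
    (hg₀ : g w₀ = w₀) (hg₁ : g w₁ = w₁) (hg₃ : g w₃ = w₃) : w₂ ≤ g w₂ := by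
  by_contra! hlt
  have exists_slope : ∀ {s t : ℝ}, w₀ ≤ s → s < t → t ≤ w₃ →
      ∃ x ∈ Ioo s t, x ∈ Ioo w₀ w₃ ∧ C / ψ x ^ 2 = (g t - g s) / (t - s) := by
    intro s t hs hst ht
    obtain ⟨x, hx, e⟩ := exists_hasDerivAt_eq_slope g _ hst (hg.mono (Icc_subset_Icc hs ht))
      fun w hw => hg' w (Ioo_subset_Ioo hs ht hw)
    exact ⟨x, hx, Ioo_subset_Ioo hs ht hx, e⟩
  obtain ⟨x₁, hx₁, hx₁', e₁⟩ := exists_slope le_rfl h01 (h12.trans h23).le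
  obtain ⟨x₂, hx₂, hx₂', e₂⟩ := exists_slope h01.le h12 h23.le
  obtain ⟨x₃, hx₃, hx₃', e₃⟩ := exists_slope (h01.trans h12).le h23 le_rfl
  have pos₁ := hψ_pos x₁ hx₁'
  have pos₂ := hψ_pos x₂ hx₂'
  have pos₃ := hψ_pos x₃ hx₃'
  have slope₁ : C / ψ x₁ ^ 2 = 1 := by rw [e₁, hg₁, hg₀, div_self (by linarith)]
  have slope₂ : C / ψ x₂ ^ 2 < 1 := by rw [e₂, hg₁, div_lt_one (by linarith)]; linarith
  have slope₃ : 1 < C / ψ x₃ ^ 2 := by rw [e₃, hg₃, one_lt_div (by linarith)]; linarith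
  rw [div_eq_one_iff_eq (by positivity)] at slope₁
  rw [div_lt_one (by positivity)] at slope₂
  rw [one_lt_div (by positivity)] at slope₃
  have lt₁ : ψ x₁ < ψ x₂ := lt_of_pow_lt_pow_left₀ 2 pos₂.le (by linarith)
  have lt₃ : ψ x₃ < ψ x₂ := lt_of_pow_lt_pow_left₀ 2 pos₂.le (by linarith)
  have := hψ.le_max_of_mem_Icc hx₁' hx₃' (z := x₂)
    ⟨(hx₁.2.trans hx₂.1).le, (hx₂.2.trans hx₃.1).le⟩
  exact this.not_gt (max_lt lt₁ lt₃)

end Schwarzian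

section CrossRatio

/-- The cross-ratio of four points, normalised as the exponential of the Poincaré length of the
interval between `w₁` and `w₂` in the one between `w₀` and `w₃`; the absolute values make it
independent of the orientation. -/
noncomputable def crossRatio (w₀ w₁ w₂ w₃ : ℝ) : ℝ :=
  (1 + |w₂ - w₁| / |w₁ - w₀|) * (1 + |w₂ - w₁| / |w₃ - w₂|)

/-- Four points in increasing or in decreasing order: a configuration that monotone maps
preserve. -/
def Ordered (w₀ w₁ w₂ w₃ : ℝ) : Prop :=
  (w₀ < w₁ ∧ w₁ < w₂ ∧ w₂ < w₃) ∨ (w₃ < w₂ ∧ w₂ < w₁ ∧ w₁ < w₀)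

/-- The Möbius transformation `y ↦ (x₀ (y₃ - y) + κ x₃ (y - y₀)) / ((y₃ - y) + κ (y - y₀))`, which
sends `y₀` to `x₀` and `y₃` to `x₃`; the weight `κ` prescribes the image of a third point. The
denominator is written as an affine function of `y`. -/
noncomputable def moebius (κ x₀ x₃ y₀ y₃ y : ℝ) : ℝ :=
  (x₀ * (y₃ - y) + κ * x₃ * (y - y₀)) / ((y₃ - κ * y₀) + (κ - 1) * y)

lemma moebius_denom_pos {κ y₀ y₃ y : ℝ} (hκ : 0 < κ) (h03 : y₀ < y₃) (hy : y ∈ Icc y₀ y₃) :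
    0 < (y₃ - κ * y₀) + (κ - 1) * y := by
  have e : (y₃ - κ * y₀) + (κ - 1) * y = (y₃ - y) + κ * (y - y₀) := by ring
  rw [e]
  rcases hy.2.lt_or_eq with h | rfl
  · linarith [mul_nonneg hκ.le (sub_nonneg.2 hy.1)]
  · linarith [mul_pos hκ (sub_pos.2 h03)]

lemma hasDerivAt_moebius {κ x₀ x₃ y₀ y₃ y : ℝ} (hy : (y₃ - κ * y₀) + (κ - 1) * y ≠ 0) :
    HasDerivAt (moebius κ x₀ x₃ y₀ y₃)
      (κ * (x₃ - x₀) * (y₃ - y₀) / ((y₃ - κ * y₀) + (κ - 1) * y) ^ 2) y := by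
  have hid := hasDerivAt_id' y
  refine ((((hid.const_sub y₃).const_mul x₀).add ((hid.sub_const y₀).const_mul (κ * x₃))).div
    ((hid.const_mul (κ - 1)).const_add (y₃ - κ * y₀)) hy).congr_deriv ?_
  simp only [Pi.add_apply]
  congr 1
  ring

lemma moebius_left {κ x₀ x₃ y₀ y₃ : ℝ} (h : y₃ ≠ y₀) : moebius κ x₀ x₃ y₀ y₃ y₀ = x₀ := by
  have e : (y₃ - κ * y₀) + (κ - 1) * y₀ = y₃ - y₀ := by ring
  rw [moebius, e, div_eq_iff (sub_ne_zero.2 h)]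
  ring

lemma moebius_right {κ x₀ x₃ y₀ y₃ : ℝ} (hκ : κ ≠ 0) (h : y₃ ≠ y₀) :
    moebius κ x₀ x₃ y₀ y₃ y₃ = x₃ := by
  have e : (y₃ - κ * y₀) + (κ - 1) * y₃ = κ * (y₃ - y₀) := by ring
  rw [moebius, e, div_eq_iff (mul_ne_zero hκ (sub_ne_zero.2 h))]
  ring

lemma le_moebius_iff {κ x₀ x₃ y₀ y₃ x y : ℝ} (hy : 0 < (y₃ - κ * y₀) + (κ - 1) * y) :
    x ≤ moebius κ x₀ x₃ y₀ y₃ y ↔ (x - x₀) * (y₃ - y) ≤ κ * ((x₃ - x) * (y - y₀)) := by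
  rw [moebius, le_div_iff₀ hy]
  constructor <;> intro h <;> linarith

lemma moebius_eq_iff {κ x₀ x₃ y₀ y₃ x y : ℝ} (hy : (y₃ - κ * y₀) + (κ - 1) * y ≠ 0) :
    moebius κ x₀ x₃ y₀ y₃ y = x ↔ κ * ((x₃ - x) * (y - y₀)) = (x - x₀) * (y₃ - y) := by
  rw [moebius, div_eq_iff hy]
  constructor <;> intro h <;> linarith

lemma crossRatio_of_lt {w₀ w₁ w₂ w₃ : ℝ} (h01 : w₀ < w₁) (h12 : w₁ < w₂) (h23 : w₂ < w₃) :
    crossRatio w₀ w₁ w₂ w₃ = (w₂ - w₀) * (w₃ - w₁) / ((w₁ - w₀) * (w₃ - w₂)) := by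
  have pos₁ := sub_pos.2 h01
  have pos₃ := sub_pos.2 h23
  rw [crossRatio, abs_of_pos pos₁, abs_of_pos pos₃, abs_of_pos (sub_pos.2 h12)]
  field_simp
  ring

lemma crossRatio_reverse (w₀ w₁ w₂ w₃ : ℝ) :
    crossRatio w₃ w₂ w₁ w₀ = crossRatio w₀ w₁ w₂ w₃ := by
  rw [crossRatio, crossRatio, mul_comm, abs_sub_comm w₁ w₂, abs_sub_comm w₀ w₁, abs_sub_comm w₂ w₃]

lemma crossRatio_neg (w₀ w₁ w₂ w₃ : ℝ) :
    crossRatio (-w₀) (-w₁) (-w₂) (-w₃) = crossRatio w₀ w₁ w₂ w₃ := by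
  simp only [crossRatio, neg_sub_neg, abs_sub_comm]

lemma one_le_crossRatio (w₀ w₁ w₂ w₃ : ℝ) : 1 ≤ crossRatio w₀ w₁ w₂ w₃ := by
  refine one_le_mul_of_one_le_of_one_le ?_ ?_ <;>
  · rw [le_add_iff_nonneg_right]
    positivity

lemma crossRatio_pos (w₀ w₁ w₂ w₃ : ℝ) : 0 < crossRatio w₀ w₁ w₂ w₃ :=
  one_pos.trans_le (one_le_crossRatio _ _ _ _)

lemma Ordered.reverse {w₀ w₁ w₂ w₃ : ℝ} (h : Ordered w₀ w₁ w₂ w₃) : Ordered w₃ w₂ w₁ w₀ := by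
  rcases h with ⟨h01, h12, h23⟩ | ⟨h32, h21, h10⟩
  · exact Or.inr ⟨h01, h12, h23⟩
  · exact Or.inl ⟨h32, h21, h10⟩

lemma exists_moebius_eq {x₀ x₁ x₃ y₀ y₁ y₃ : ℝ} (hx01 : x₀ < x₁) (hx13 : x₁ < x₃)
    (hy01 : y₀ < y₁) (hy13 : y₁ < y₃) : ∃ κ > 0, moebius κ x₀ x₃ y₀ y₃ y₁ = x₁ := by
  have hnum : 0 < (x₁ - x₀) * (y₃ - y₁) := mul_pos (sub_pos.2 hx01) (sub_pos.2 hy13)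
  have hden : 0 < (x₃ - x₁) * (y₁ - y₀) := mul_pos (sub_pos.2 hx13) (sub_pos.2 hy01)
  refine ⟨(x₁ - x₀) * (y₃ - y₁) / ((x₃ - x₁) * (y₁ - y₀)), div_pos hnum hden, ?_⟩
  exact (moebius_eq_iff (moebius_denom_pos (div_pos hnum hden) (hy01.trans hy13)
    ⟨hy01.le, hy13.le⟩).ne').2 (div_mul_cancel₀ _ hden.ne')

lemma strictMonoOn_Icc_of_deriv_pos {f : ℝ → ℝ} {x y : ℝ} (hc : ContinuousOn f (Icc x y))
    (hpos : ∀ w ∈ Ioo x y, 0 < deriv f w) : StrictMonoOn f (Icc x y) :=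
  strictMonoOn_of_deriv_pos (convex_Icc _ _) hc (by rwa [interior_Icc])

lemma le_moebius_comp {f : ℝ → ℝ} {κ w₀ w₁ w₂ w₃ : ℝ} (hκ : 0 < κ)
    (hc : ContinuousOn f (Icc w₀ w₃)) (hf : ContDiffOn ℝ 3 f (Ioo w₀ w₃))
    (hpos : ∀ w ∈ Ioo w₀ w₃, 0 < deriv f w) (hS : ∀ w ∈ Ioo w₀ w₃, schwarzian f w < 0)
    (h01 : w₀ < w₁) (h12 : w₁ < w₂) (h23 : w₂ < w₃)
    (hκ₁ : moebius κ w₀ w₃ (f w₀) (f w₃) (f w₁) = w₁) :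
    w₂ ≤ moebius κ w₀ w₃ (f w₀) (f w₃) (f w₂) := by
  have hmono := strictMonoOn_Icc_of_deriv_pos hc hpos
  have hw₀ : w₀ ∈ Icc w₀ w₃ := ⟨le_rfl, by linarith⟩
  have hw₃ : w₃ ∈ Icc w₀ w₃ := ⟨by linarith, le_rfl⟩
  have lt03 : f w₀ < f w₃ := hmono hw₀ hw₃ (by linarith)
  have hden : ∀ w ∈ Icc w₀ w₃, 0 < (f w₃ - κ * f w₀) + (κ - 1) * f w := fun w hw =>
    moebius_denom_pos hκ lt03
      ⟨hmono.monotoneOn hw₀ hw hw.1, hmono.monotoneOn hw hw₃ hw.2⟩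
  refine le_apply_of_hasDerivAt_div_sq (g := fun w => moebius κ w₀ w₃ (f w₀) (f w₃) (f w))
    (ψ := fun w => ((f w₃ - κ * f w₀) + (κ - 1) * f w) / √(deriv f w))
    (C := κ * (w₃ - w₀) * (f w₃ - f w₀)) (fun w hw =>
      (hasDerivAt_moebius (hden w hw).ne').continuousAt.comp_continuousWithinAt (hc w hw))
    (fun w hw => ?_)
    (convexOn_affine_comp_div_sqrt_deriv isOpen_Ioo (convex_Ioo _ _) hf hpos hS
      fun w hw => hden w (Ioo_subset_Icc_self hw))
    (fun w hw => div_pos (hden w (Ioo_subset_Icc_self hw)) (Real.sqrt_pos.2 (hpos w hw)))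
    h01 h12 h23 (moebius_left lt03.ne') hκ₁ (moebius_right hκ.ne' lt03.ne')
  refine ((hasDerivAt_moebius (hden w (Ioo_subset_Icc_self hw)).ne').comp w
    (differentiableAt_of_deriv_ne_zero (hpos w hw).ne').hasDerivAt).congr_deriv ?_
  rw [div_pow, Real.sq_sqrt (hpos w hw).le, div_div_eq_mul_div, div_mul_eq_mul_div]

/-- After composing `f` with the Möbius transformation that makes `w₀`, `w₁`, `w₃` fixed points,
the inequality of cross-ratios is an inequality for the image of `w₂`. -/
lemma crossRatio_le_of_deriv_pos {f : ℝ → ℝ} {w₀ w₁ w₂ w₃ : ℝ} (hc : ContinuousOn f (Icc w₀ w₃))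
    (hf : ContDiffOn ℝ 3 f (Ioo w₀ w₃)) (hpos : ∀ w ∈ Ioo w₀ w₃, 0 < deriv f w)
    (hS : ∀ w ∈ Ioo w₀ w₃, schwarzian f w < 0)
    (h01 : w₀ < w₁) (h12 : w₁ < w₂) (h23 : w₂ < w₃) :
    crossRatio w₀ w₁ w₂ w₃ ≤ crossRatio (f w₀) (f w₁) (f w₂) (f w₃) := by
  have hmono := strictMonoOn_Icc_of_deriv_pos hc hpos
  have lt01 : f w₀ < f w₁ := hmono ⟨le_rfl, by linarith⟩ ⟨by linarith, by linarith⟩ h01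
  have lt12 : f w₁ < f w₂ := hmono ⟨by linarith, by linarith⟩ ⟨by linarith, by linarith⟩ h12
  have lt23 : f w₂ < f w₃ := hmono ⟨by linarith, by linarith⟩ ⟨by linarith, le_rfl⟩ h23
  obtain ⟨κ, hκ, hfix⟩ := exists_moebius_eq h01 (h12.trans h23) lt01 (lt12.trans lt23)
  have hle := le_moebius_comp hκ hc hf hpos hS h01 h12 h23 hfix
  rw [le_moebius_iff (moebius_denom_pos hκ (lt01.trans (lt12.trans lt23))
    ⟨(lt01.trans lt12).le, lt23.le⟩)] at hle
  rw [moebius_eq_iff (moebius_denom_pos hκ (lt01.trans (lt12.trans lt23))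
    ⟨lt01.le, (lt12.trans lt23).le⟩).ne'] at hfix
  rw [crossRatio_of_lt h01 h12 h23, crossRatio_of_lt lt01 lt12 lt23,
    div_le_div_iff₀ (mul_pos (by linarith) (by linarith)) (mul_pos (by linarith) (by linarith))]
  have hmul := mul_le_mul_of_nonneg_right hle
    (mul_pos (sub_pos.2 (h12.trans h23)) (sub_pos.2 lt01)).le
  linear_combination hmul + (w₃ - w₂) * (f w₂ - f w₀) * hfix

lemma schwarzian_neg (f : ℝ → ℝ) (x : ℝ) : schwarzian (-f) x = schwarzian f x := by
  simp only [schwarzian, iteratedDeriv_neg, deriv.neg, neg_div_neg_eq]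

lemma crossRatio_le_of_deriv_neg {f : ℝ → ℝ} {w₀ w₁ w₂ w₃ : ℝ} (hc : ContinuousOn f (Icc w₀ w₃))
    (hf : ContDiffOn ℝ 3 f (Ioo w₀ w₃)) (hneg : ∀ w ∈ Ioo w₀ w₃, deriv f w < 0)
    (hS : ∀ w ∈ Ioo w₀ w₃, schwarzian f w < 0)
    (h01 : w₀ < w₁) (h12 : w₁ < w₂) (h23 : w₂ < w₃) :
    crossRatio w₀ w₁ w₂ w₃ ≤ crossRatio (f w₀) (f w₁) (f w₂) (f w₃) := by
  rw [← crossRatio_neg (f w₀)]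
  refine crossRatio_le_of_deriv_pos hc.neg hf.neg (fun w hw => ?_) (fun w hw => ?_) h01 h12 h23
  · rw [deriv.neg, neg_pos]
    exact hneg w hw
  · rw [schwarzian_neg]
    exact hS w hw

end CrossRatio

section UnimodalMaps

section RealFunctions

lemma half_mul_sq_sub_sq_le {F D : ℝ → ℝ} {c x y m : ℝ}
    (hF : ∀ w ∈ uIcc c x, HasDerivAt F ((w - c) * D w) w) (hD : ∀ w ∈ uIcc c x, m ≤ D w)
    (hy : y ∈ uIcc c x) : m / 2 * ((x - c) ^ 2 - (y - c) ^ 2) ≤ F x - F y := by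
  set G : ℝ → ℝ := fun w => F w - m / 2 * (w - c) ^ 2
  have hG : ∀ w ∈ uIcc c x, HasDerivAt G ((w - c) * (D w - m)) w := by
    intro w hw
    refine ((hF w hw).sub
      ((((hasDerivAt_id w).sub_const c).pow 2).const_mul (m / 2))).congr_deriv ?_
    simp only [id_eq, Nat.cast_ofNat]
    ring
  have hcont : ContinuousOn G (uIcc c x) := HasDerivAt.continuousOn hG
  have hGle : G y ≤ G x := by
    rcases le_total c x with h | h
    · rw [uIcc_of_le h] at *
      refine monotoneOn_of_hasDerivWithinAt_nonneg (convex_Icc _ _) hcont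
        (fun w hw => (hG w (interior_subset hw)).hasDerivWithinAt) (fun w hw => ?_)
        hy (right_mem_Icc.2 h) hy.2
      have hw := interior_subset hw
      exact mul_nonneg (sub_nonneg.2 hw.1) (sub_nonneg.2 (hD w hw))
    · rw [uIcc_of_ge h] at *
      refine antitoneOn_of_hasDerivWithinAt_nonpos (convex_Icc _ _) hcont
        (fun w hw => (hG w (interior_subset hw)).hasDerivWithinAt) (fun w hw => ?_)
        (left_mem_Icc.2 h) hy hy.1
      have hw := interior_subset hw
      exact mul_nonpos_of_nonpos_of_nonneg (sub_nonpos.2 hw.2) (sub_nonneg.2 (hD w hw))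
  simp only [G] at hGle
  linarith

lemma sub_le_half_mul_sq_sub_sq {F D : ℝ → ℝ} {c x y M : ℝ}
    (hF : ∀ w ∈ uIcc c x, HasDerivAt F ((w - c) * D w) w) (hD : ∀ w ∈ uIcc c x, D w ≤ M)
    (hy : y ∈ uIcc c x) : F x - F y ≤ M / 2 * ((x - c) ^ 2 - (y - c) ^ 2) := by
  have hneg := half_mul_sq_sub_sq_le (F := -F) (D := -D) (m := -M)
    (fun w hw => (hF w hw).neg.congr_deriv (mul_neg _ _).symm) (fun w hw => neg_le_neg (hD w hw)) hy
  simp only [Pi.neg_apply] at hneg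
  linarith

variable {g : ℝ → ℝ} {A B C α β v z : ℝ}

lemma exists_Ioo_of_strictMonoOn (hcont : ContinuousOn g (Icc A B))
    (hmono : StrictMonoOn g (Icc A B)) (hz : z ∈ Icc A B) (hgz : g z ∈ Ioo α β)
    (hA : g A ∉ Ioo α β) (hB : g B ∉ Ioo α β) :
    ∃ x ∈ Icc A B, ∃ y ∈ Icc A B, z ∈ Ioo x y ∧ g x = α ∧ g y = β := by
  have hAB := hz.1.trans hz.2
  have hAz := hmono.monotoneOn (left_mem_Icc.2 hAB) hz hz.1
  have hzB := hmono.monotoneOn hz (right_mem_Icc.2 hAB) hz.2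
  have hAα : g A ≤ α := le_of_not_gt fun h => hA ⟨h, hAz.trans_lt hgz.2⟩
  have hβB : β ≤ g B := le_of_not_gt fun h => hB ⟨hgz.1.trans_le hzB, h⟩
  obtain ⟨x, hx, rfl⟩ := intermediate_value_Icc hAB hcont ⟨hAα, hgz.1.le.trans hzB⟩
  obtain ⟨y, hy, rfl⟩ := intermediate_value_Icc hAB hcont ⟨hAz.trans hgz.2.le, hβB⟩
  exact ⟨x, hx, y, hy, ⟨(hmono.lt_iff_lt hx hz).1 hgz.1, (hmono.lt_iff_lt hz hy).1 hgz.2⟩,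
    rfl, rfl⟩

lemma exists_Ioo_of_strictMonoOn_or_strictAntiOn (hcont : ContinuousOn g (Icc A B))
    (hmono : StrictMonoOn g (Icc A B) ∨ StrictAntiOn g (Icc A B)) (hz : z ∈ Icc A B)
    (hgz : g z ∈ Ioo α β) (hA : g A ∉ Ioo α β) (hB : g B ∉ Ioo α β) :
    ∃ x ∈ Icc A B, ∃ y ∈ Icc A B,
      z ∈ Ioo x y ∧ ((g x = α ∧ g y = β) ∨ (g x = β ∧ g y = α)) := by
  have hneg : ∀ w, (-g) w ∈ Ioo (-β) (-α) ↔ g w ∈ Ioo α β := fun w => by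
    simp only [Pi.neg_apply, mem_Ioo, neg_lt_neg_iff, and_comm]
  rcases hmono with h | h
  · obtain ⟨x, hx, y, hy, hzxy, hxy⟩ := exists_Ioo_of_strictMonoOn hcont h hz hgz hA hB
    exact ⟨x, hx, y, hy, hzxy, .inl hxy⟩
  · obtain ⟨x, hx, y, hy, hzxy, hxy⟩ := exists_Ioo_of_strictMonoOn hcont.neg h.neg hz
      ((hneg z).2 hgz) (mt (hneg A).1 hA) (mt (hneg B).1 hB)
    exact ⟨x, hx, y, hy, hzxy, .inr ⟨neg_injective hxy.1, neg_injective hxy.2⟩⟩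

lemma exists_Ioo_of_strictAntiOn_of_strictMonoOn (hcont : ContinuousOn g (Icc A B))
    (hC : C ∈ Icc A B) (hanti : StrictAntiOn g (Icc A C)) (hmono : StrictMonoOn g (Icc C B))
    (hv : g C < v) (hvA : v < g A) (hvB : v < g B) :
    ∃ l ∈ Ioo A C, ∃ u ∈ Ioo C B, g l = v ∧ g u = v ∧ ∀ z ∈ Ioo l u, g z ∈ Ico (g C) v := by
  obtain ⟨l, hl, hgl⟩ := intermediate_value_Ioo' hC.1
    (hcont.mono (Icc_subset_Icc_right hC.2)) ⟨hv, hvA⟩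
  obtain ⟨u, hu, hgu⟩ := intermediate_value_Ioo hC.2
    (hcont.mono (Icc_subset_Icc_left hC.1)) ⟨hv, hvB⟩
  refine ⟨l, hl, u, hu, hgl, hgu, fun z hz => ?_⟩
  rcases le_total z C with h | h
  · have hzmem : z ∈ Icc A C := ⟨(hl.1.trans hz.1).le, h⟩
    exact ⟨hanti.antitoneOn hzmem (right_mem_Icc.2 hC.1) h,
      hgl ▸ hanti (Ioo_subset_Icc_self hl) hzmem hz.1⟩
  · have hzmem : z ∈ Icc C B := ⟨h, (hz.2.trans hu.2).le⟩
    exact ⟨hmono.monotoneOn (left_mem_Icc.2 hC.2) hzmem h,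
      hgu ▸ hmono hzmem (Ioo_subset_Icc_self hu) hz.2⟩

end RealFunctions

variable {f : ℝ → ℝ} {a b c p q : ℝ}

namespace IsQuasiQuadratic

lemma contDiffAt (hf : IsQuasiQuadratic f a b c) {x : ℝ} (hx : x ∈ Ioo a b) :
    ContDiffAt ℝ 3 f x :=
  hf.contDiffOn.contDiffAt (Icc_mem_nhds hx.1 hx.2)

lemma hasDerivAt (hf : IsQuasiQuadratic f a b c) {x : ℝ} (hx : x ∈ Ioo a b) :
    HasDerivAt f (deriv f x) x :=
  ((hf.contDiffAt hx).differentiableAt (by norm_num)).hasDerivAt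

lemma continuousOn (hf : IsQuasiQuadratic f a b c) : ContinuousOn f (Icc a b) :=
  hf.contDiffOn.continuousOn

lemma hasDerivAt_deriv (hf : IsQuasiQuadratic f a b c) {x : ℝ} (hx : x ∈ Ioo a b) :
    HasDerivAt (deriv f) (iteratedDeriv 2 f x) x :=
  PrincipalNest.hasDerivAt_deriv (hf.contDiffAt hx) (by norm_num)

lemma continuousOn_dslope (hf : IsQuasiQuadratic f a b c) :
    ContinuousOn (dslope (deriv f) c) (Ioo a b) :=
  (_root_.continuousOn_dslope (isOpen_Ioo.mem_nhds hf.crit_mem)).2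
    ⟨HasDerivAt.continuousOn fun _ hx => hf.hasDerivAt_deriv hx,
      (hf.hasDerivAt_deriv hf.crit_mem).differentiableAt⟩

lemma deriv_eq (hf : IsQuasiQuadratic f a b c) (x : ℝ) :
    deriv f x = (x - c) * dslope (deriv f) c x := by
  rw [← smul_eq_mul, sub_smul_dslope, hf.deriv_crit, sub_zero]

lemma dslope_ne_zero (hf : IsQuasiQuadratic f a b c) {x : ℝ} (hx : x ∈ Ioo a b) :
    dslope (deriv f) c x ≠ 0 := by
  rcases eq_or_ne x c with rfl | hxc
  · rw [dslope_same, (hf.hasDerivAt_deriv hx).deriv]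
    exact hf.nondegenerate
  · exact right_ne_zero_of_mul (hf.deriv_eq x ▸ hf.deriv_ne x hx hxc)

lemma exists_sign (hf : IsQuasiQuadratic f a b c) :
    ∃ s : ℝ, (s = 1 ∨ s = -1) ∧ ∀ x ∈ Ioo a b, 0 < s * dslope (deriv f) c x := by
  rcases (hf.dslope_ne_zero hf.crit_mem).lt_or_gt with hneg | hpos
  · refine ⟨-1, .inr rfl, fun x hx => ?_⟩
    by_contra! h
    obtain ⟨w, hw, hzero⟩ := isPreconnected_Ioo.intermediate_value hf.crit_mem hx
      hf.continuousOn_dslope ⟨hneg.le, by linarith⟩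
    exact hf.dslope_ne_zero hw hzero
  · refine ⟨1, .inl rfl, fun x hx => ?_⟩
    by_contra! h
    obtain ⟨w, hw, hzero⟩ := isPreconnected_Ioo.intermediate_value hx hf.crit_mem
      hf.continuousOn_dslope ⟨by linarith, hpos.le⟩
    exact hf.dslope_ne_zero hw hzero

lemma exists_sign_strictAntiOn_strictMonoOn (hf : IsQuasiQuadratic f a b c) :
    ∃ s : ℝ, (s = 1 ∨ s = -1) ∧ StrictAntiOn (fun x => s * f x) (Icc a c) ∧
      StrictMonoOn (fun x => s * f x) (Icc c b) := by
  obtain ⟨s, hs, hD⟩ := hf.exists_sign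
  have hc := hf.crit_mem
  have hcont : ContinuousOn (fun x => s * f x) (Icc a b) := hf.continuousOn.const_mul s
  have hderiv : ∀ x ∈ Ioo a b,
      deriv (fun x => s * f x) x = (x - c) * (s * dslope (deriv f) c x) := fun x hx => by
    rw [((hf.hasDerivAt hx).const_mul s).deriv, hf.deriv_eq]
    ring
  refine ⟨s, hs, strictAntiOn_of_deriv_neg (convex_Icc _ _)
      (hcont.mono (Icc_subset_Icc_right hc.2.le)) fun x hx => ?_,
    strictMonoOn_of_deriv_pos (convex_Icc _ _)
      (hcont.mono (Icc_subset_Icc_left hc.1.le)) fun x hx => ?_⟩ <;>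
    rw [interior_Icc] at hx
  · have hx' : x ∈ Ioo a b := ⟨hx.1, hx.2.trans hc.2⟩
    exact hderiv x hx' ▸ mul_neg_of_neg_of_pos (sub_neg.2 hx.2) (hD x hx')
  · have hx' : x ∈ Ioo a b := ⟨hc.1.trans hx.1, hx.2⟩
    exact hderiv x hx' ▸ mul_pos (sub_pos.2 hx.1) (hD x hx')

lemma unimodal (hf : IsQuasiQuadratic f a b c) :
    (StrictMonoOn f (Icc a c) ∧ StrictAntiOn f (Icc c b) ∧ f a = a ∧ f b = a) ∨
    (StrictAntiOn f (Icc a c) ∧ StrictMonoOn f (Icc c b) ∧ f a = b ∧ f b = b) := by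
  obtain ⟨s, hs, hleft, hright⟩ := hf.exists_sign_strictAntiOn_strictMonoOn
  have hc := hf.crit_mem
  have hfc := hf.mapsTo (Ioo_subset_Icc_self hc)
  have hfa : f a = a ∨ f a = b := hf.boundary (mem_insert a {b})
  have hfb : f b = a ∨ f b = b := hf.boundary (mem_insert_of_mem a rfl)
  have hac := hleft (left_mem_Icc.2 hc.1.le) (right_mem_Icc.2 hc.1.le) hc.1
  have hcb := hright (left_mem_Icc.2 hc.2.le) (right_mem_Icc.2 hc.2.le) hc.2
  rcases hs with rfl | rfl
  · simp only [one_mul] at hleft hright hac hcb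
    exact .inr ⟨hleft, hright, hfa.resolve_left (hfc.1.trans_lt hac).ne',
      hfb.resolve_left (hfc.1.trans_lt hcb).ne'⟩
  · simp only [neg_mul, one_mul, neg_lt_neg_iff] at hleft hright hac hcb
    exact .inl ⟨by simpa only [neg_neg] using hleft.neg, by simpa only [neg_neg] using hright.neg,
      hfa.resolve_right (hac.trans_le hfc.2).ne, hfb.resolve_right (hcb.trans_le hfc.2).ne⟩

lemma exists_quadratic_bounds (hf : IsQuasiQuadratic f a b c) (hp : p ∈ Ioo a c)
    (hq : q ∈ Ioo c b) :
    ∃ m M : ℝ, 0 < m ∧ 0 < M ∧ ∀ x ∈ Icc p q, ∀ y ∈ uIcc c x,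
      m * ((x - c) ^ 2 - (y - c) ^ 2) ≤ |f x - f c| - |f y - f c| ∧
      |f x - f c| - |f y - f c| ≤ M * ((x - c) ^ 2 - (y - c) ^ 2) := by
  obtain ⟨s, hs, hD⟩ := hf.exists_sign
  set D : ℝ → ℝ := fun x => s * dslope (deriv f) c x
  set F : ℝ → ℝ := fun x => s * (f x - f c) with hFdef
  have hsub : Icc p q ⊆ Ioo a b := Icc_subset_Ioo hp.1 hq.2
  have hcpq : c ∈ Icc p q := ⟨hp.2.le, hq.1.le⟩
  have hDcont : ContinuousOn D (Icc p q) := (hf.continuousOn_dslope.mono hsub).const_mul s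
  obtain ⟨x₀, hx₀, hmin⟩ := isCompact_Icc.exists_isMinOn ⟨c, hcpq⟩ hDcont
  obtain ⟨x₁, hx₁, hmax⟩ := isCompact_Icc.exists_isMaxOn ⟨c, hcpq⟩ hDcont
  have hF : ∀ x ∈ Icc p q, HasDerivAt F ((x - c) * D x) x := fun x hx => by
    refine (((hf.hasDerivAt (hsub hx)).sub_const (f c)).const_mul s).congr_deriv ?_
    rw [hf.deriv_eq]
    ring
  have huIcc : ∀ x ∈ Icc p q, uIcc c x ⊆ Icc p q := fun x hx => uIcc_subset_Icc hcpq hx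
  have hlower : ∀ x ∈ Icc p q, ∀ y ∈ uIcc c x,
      D x₀ / 2 * ((x - c) ^ 2 - (y - c) ^ 2) ≤ F x - F y := fun x hx y hy =>
    half_mul_sq_sub_sq_le (fun w hw => hF w (huIcc x hx hw)) (fun w hw => hmin (huIcc x hx hw)) hy
  have hupper : ∀ x ∈ Icc p q, ∀ y ∈ uIcc c x,
      F x - F y ≤ D x₁ / 2 * ((x - c) ^ 2 - (y - c) ^ 2) := fun x hx y hy =>
    sub_le_half_mul_sq_sub_sq (fun w hw => hF w (huIcc x hx hw)) (fun w hw => hmax (huIcc x hx hw))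
      hy
  have hm : 0 < D x₀ / 2 := half_pos (hD _ (hsub hx₀))
  have habs : ∀ x ∈ Icc p q, |f x - f c| = F x := fun x hx => by
    have hF0 : 0 ≤ F x := by
      have hlow := hlower x hx c left_mem_uIcc
      have hsq := mul_nonneg hm.le (sq_nonneg (x - c))
      simp only [hFdef, sub_self, mul_zero] at hlow ⊢
      linarith
    rw [← abs_of_nonneg hF0, hFdef, abs_mul]
    rcases hs with rfl | rfl <;> simp only [abs_neg, abs_one, one_mul]
  refine ⟨D x₀ / 2, D x₁ / 2, hm, half_pos (hD _ (hsub hx₁)), fun x hx y hy => ?_⟩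
  rw [habs x hx, habs y (huIcc x hx hy)]
  exact ⟨hlower x hx y hy, hupper x hx y hy⟩

lemma crossRatio_le (hf : IsQuasiQuadratic f a b c) {w₀ w₁ w₂ w₃ : ℝ} (ho : Ordered w₀ w₁ w₂ w₃)
    (hside : uIcc w₀ w₃ ⊆ Icc a c ∨ uIcc w₀ w₃ ⊆ Icc c b) :
    crossRatio w₀ w₁ w₂ w₃ ≤ crossRatio (f w₀) (f w₁) (f w₂) (f w₃) := by
  wlog hlt : w₀ < w₁ ∧ w₁ < w₂ ∧ w₂ < w₃ generalizing w₀ w₁ w₂ w₃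
  · rw [← crossRatio_reverse, ← crossRatio_reverse (f w₀)]
    exact this ho.reverse (by rwa [uIcc_comm]) (ho.resolve_left hlt)
  obtain ⟨h01, h12, h23⟩ := hlt
  rw [uIcc_of_le ((h01.trans h12).trans h23).le] at hside
  have hc := hf.crit_mem
  have hmem : ∀ w ∈ Ioo w₀ w₃, w ∈ Ioo a b ∧ w ≠ c := by
    intro w hw
    rw [← interior_Icc] at hw
    rcases hside with h | h <;> have hw' := interior_mono h hw <;> rw [interior_Icc] at hw'
    · exact ⟨⟨hw'.1, hw'.2.trans hc.2⟩, hw'.2.ne⟩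
    · exact ⟨⟨hc.1.trans hw'.1, hw'.2⟩, hw'.1.ne'⟩
  have hcont : ContinuousOn f (Icc w₀ w₃) := hf.continuousOn.mono <| hside.elim
    (·.trans (Icc_subset_Icc_right hc.2.le)) (·.trans (Icc_subset_Icc_left hc.1.le))
  have hcd : ContDiffOn ℝ 3 f (Ioo w₀ w₃) := fun w hw =>
    (hf.contDiffAt (hmem w hw).1).contDiffWithinAt
  have hS : ∀ w ∈ Ioo w₀ w₃, schwarzian f w < 0 := fun w hw =>
    hf.schwarzian_neg w (hmem w hw).1 (hmem w hw).2
  rcases hasDerivWithinAt_forall_lt_or_forall_gt_of_forall_ne (convex_Ioo w₀ w₃)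
    (fun w hw => (hf.hasDerivAt (hmem w hw).1).hasDerivWithinAt)
    (fun w hw => hf.deriv_ne w (hmem w hw).1 (hmem w hw).2) with hneg | hpos
  · exact crossRatio_le_of_deriv_neg hcont hcd hneg hS h01 h12 h23
  · exact crossRatio_le_of_deriv_pos hcont hcd hpos hS h01 h12 h23

lemma iterate_mem (hf : IsQuasiQuadratic f a b c) (t : ℕ) {x : ℝ} (hx : x ∈ Icc a b) :
    f^[t] x ∈ Icc a b := hf.mapsTo.iterate t hx

lemma continuousOn_iterate (hf : IsQuasiQuadratic f a b c) (t : ℕ) :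
    ContinuousOn f^[t] (Icc a b) := hf.continuousOn.iterate hf.mapsTo t

lemma monotoneOn_or_antitoneOn_uIcc (hf : IsQuasiQuadratic f a b c) {z : ℝ} (hz : z ∈ Icc a b) :
    MonotoneOn f (uIcc c z) ∨ AntitoneOn f (uIcc c z) := by
  rcases le_total c z with h | h
  · rw [uIcc_of_le h]
    have hsub : Icc c z ⊆ Icc c b := Icc_subset_Icc_right hz.2
    exact hf.unimodal.symm.imp (·.2.1.monotoneOn.mono hsub) (·.2.1.antitoneOn.mono hsub)
  · rw [uIcc_of_ge h]
    have hsub : Icc z c ⊆ Icc a c := Icc_subset_Icc_left hz.1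
    exact hf.unimodal.imp (·.1.monotoneOn.mono hsub) (·.1.antitoneOn.mono hsub)

lemma apply_mem_uIcc (hf : IsQuasiQuadratic f a b c) {z e : ℝ} (hz : z ∈ Icc a b)
    (he : e ∈ uIcc c z) : f e ∈ uIcc (f c) (f z) :=
  (hf.monotoneOn_or_antitoneOn_uIcc hz).elim (·.mapsTo_uIcc he) (·.mapsTo_uIcc he)

lemma apply_boundary_notMem (hf : IsQuasiQuadratic f a b c) {J : Set ℝ} (hJ : J ⊆ Ioo a b) :
    f a ∉ J ∧ f b ∉ J := by
  have ha : a ∉ J := fun h => (hJ h).1.false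
  have hb : b ∉ J := fun h => (hJ h).2.false
  rcases hf.unimodal with ⟨-, -, hfa, hfb⟩ | ⟨-, -, hfa, hfb⟩ <;> rw [hfa, hfb]
  exacts [⟨ha, ha⟩, ⟨hb, hb⟩]

lemma exists_pullback (hf : IsQuasiQuadratic f a b c) {z α β : ℝ} (hz : z ∈ Icc a b)
    (hfz : f z ∈ Ioo α β) (hαβ : Icc α β ⊆ Ioo a b) (hfc : f c ∉ Ioo α β) :
    ∃ x y, z ∈ Ioo x y ∧ Icc x y ⊆ Ioo a b ∧ c ∉ Ioo x y ∧
      ((f x = α ∧ f y = β) ∨ (f x = β ∧ f y = α)) := by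
  have hc := hf.crit_mem
  have hlt : α < β := hfz.1.trans hfz.2
  obtain ⟨hfa, hfb⟩ := hf.apply_boundary_notMem hαβ
  have hout := hf.apply_boundary_notMem (Ioo_subset_Icc_self.trans hαβ)
  have hsubset : ∀ {x y : ℝ}, a ≤ x → y ≤ b →
      ((f x = α ∧ f y = β) ∨ (f x = β ∧ f y = α)) → Icc x y ⊆ Ioo a b := by
    intro x y hx hy hxy
    have hfx : f x ∈ Icc α β := by
      rcases hxy with ⟨e, -⟩ | ⟨e, -⟩ <;> rw [e]
      exacts [left_mem_Icc.2 hlt.le, right_mem_Icc.2 hlt.le]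
    have hfy : f y ∈ Icc α β := by
      rcases hxy with ⟨-, e⟩ | ⟨-, e⟩ <;> rw [e]
      exacts [right_mem_Icc.2 hlt.le, left_mem_Icc.2 hlt.le]
    exact Icc_subset_Ioo (hx.lt_of_ne fun e => hfa (e ▸ hfx)) (hy.lt_of_ne fun e => hfb (e ▸ hfy))
  rcases le_total z c with h | h
  · obtain ⟨x, hx, y, hy, hzxy, hxy⟩ := exists_Ioo_of_strictMonoOn_or_strictAntiOn
      (hf.continuousOn.mono (Icc_subset_Icc_right hc.2.le)) (hf.unimodal.imp (·.1) (·.1))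
      ⟨hz.1, h⟩ hfz hout.1 hfc
    exact ⟨x, y, hzxy, hsubset hx.1 (hy.2.trans hc.2.le) hxy, fun hc' => hc'.2.not_ge hy.2, hxy⟩
  · obtain ⟨x, hx, y, hy, hzxy, hxy⟩ := exists_Ioo_of_strictMonoOn_or_strictAntiOn
      (hf.continuousOn.mono (Icc_subset_Icc_left hc.1.le))
      (hf.unimodal.symm.imp (·.2.1) (·.2.1)) ⟨h, hz.2⟩ hfz hfc hout.2
    exact ⟨x, y, hzxy, hsubset (hc.1.le.trans hx.1) hy.2 hxy, fun hc' => hc'.1.not_ge hx.1, hxy⟩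

lemma exists_critical_pullback (hf : IsQuasiQuadratic f a b c) {α β : ℝ}
    (hαβ : Icc α β ⊆ Ioo a b) (hfc : f c ∈ Ioo α β) :
    ∃ l ∈ Ioo a c, ∃ u ∈ Ioo c b, f l = f u ∧ (f l = α ∨ f l = β) ∧
      ∀ z ∈ Ioo l u, f z ∈ Ioo α β := by
  have hlt : α < β := hfc.1.trans hfc.2
  have haα := (hαβ (left_mem_Icc.2 hlt.le)).1
  have hβb := (hαβ (right_mem_Icc.2 hlt.le)).2
  have hc := Ioo_subset_Icc_self hf.crit_mem
  rcases hf.unimodal with ⟨hleft, hright, hfa, hfb⟩ | ⟨hleft, hright, hfa, hfb⟩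
  · obtain ⟨l, hl, u, hu, hfl, hfu, hmem⟩ := exists_Ioo_of_strictAntiOn_of_strictMonoOn
      hf.continuousOn.neg hc hleft.neg hright.neg (neg_lt_neg hfc.1)
      (neg_lt_neg (by rwa [hfa])) (neg_lt_neg (by rwa [hfb]))
    simp only [Pi.neg_apply, neg_inj] at hfl hfu
    exact ⟨l, hl, u, hu, hfl.trans hfu.symm, .inl hfl, fun z hz =>
      ⟨neg_lt_neg_iff.1 (hmem z hz).2, (neg_le_neg_iff.1 (hmem z hz).1).trans_lt hfc.2⟩⟩
  · obtain ⟨l, hl, u, hu, hfl, hfu, hmem⟩ := exists_Ioo_of_strictAntiOn_of_strictMonoOn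
      hf.continuousOn hc hleft hright hfc.2 (by rwa [hfa]) (by rwa [hfb])
    exact ⟨l, hl, u, hu, hfl.trans hfu.symm, .inr hfl, fun z hz =>
      ⟨hfc.1.trans_le (hmem z hz).1, (hmem z hz).2⟩⟩

end IsQuasiQuadratic

end UnimodalMaps

section Branches

section RealFunctions

lemma mapsTo_Iic_or_Ici_of_ne {g : ℝ → ℝ} {x y v : ℝ} (hxy : x < y)
    (hcont : ContinuousOn g (Icc x y)) (hne : ∀ w ∈ Ioo x y, g w ≠ v) :
    MapsTo g (Icc x y) (Iic v) ∨ MapsTo g (Icc x y) (Ici v) := by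
  have hpre := (isPreconnected_Ioo.image _ (hcont.mono Ioo_subset_Icc_self)).ordConnected
  have hIoo : MapsTo g (Ioo x y) (Iic v) ∨ MapsTo g (Ioo x y) (Ici v) := by
    by_contra! h
    simp only [MapsTo, mem_Iic, mem_Ici, not_forall, not_le] at h
    obtain ⟨⟨w, hw, hvw⟩, w', hw', hwv⟩ := h
    obtain ⟨u, hu, hgu⟩ :=
      hpre.out (mem_image_of_mem _ hw') (mem_image_of_mem _ hw) ⟨hwv.le, hvw.le⟩
    exact hne u hu hgu
  rw [← closure_Ioo hxy.ne] at hcont ⊢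
  exact hIoo.imp
    (fun h => (h.closure_of_continuousOn hcont).mono_right isClosed_Iic.closure_eq.subset)
    (fun h => (h.closure_of_continuousOn hcont).mono_right isClosed_Ici.closure_eq.subset)

lemma strictMonoOn_or_strictAntiOn_comp {g h : ℝ → ℝ} {s t : Set ℝ}
    (hg : StrictMonoOn g t ∨ StrictAntiOn g t) (hh : StrictMonoOn h s ∨ StrictAntiOn h s)
    (hst : MapsTo h s t) : StrictMonoOn (g ∘ h) s ∨ StrictAntiOn (g ∘ h) s := by
  rcases hg with hg | hg <;> rcases hh with hh | hh
  exacts [.inl (hg.comp hh hst), .inr (hg.comp_strictAntiOn hh hst),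
    .inr (hg.comp_strictMonoOn hh hst), .inl (hg.comp hh hst)]

lemma Ordered.mem_uIcc {w₀ w₁ w₂ w₃ : ℝ} (ho : Ordered w₀ w₁ w₂ w₃) :
    w₁ ∈ uIcc w₀ w₃ ∧ w₂ ∈ uIcc w₀ w₃ := by
  rcases ho with ⟨h01, h12, h23⟩ | ⟨h32, h21, h10⟩
  · exact ⟨Set.mem_uIcc.2 (.inl ⟨h01.le, (h12.trans h23).le⟩),
      Set.mem_uIcc.2 (.inl ⟨(h01.trans h12).le, h23.le⟩)⟩
  · exact ⟨Set.mem_uIcc.2 (.inr ⟨(h32.trans h21).le, h10.le⟩),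
      Set.mem_uIcc.2 (.inr ⟨h32.le, (h21.trans h10).le⟩)⟩

lemma Ordered.map {g : ℝ → ℝ} {s : Set ℝ} {w₀ w₁ w₂ w₃ : ℝ} (ho : Ordered w₀ w₁ w₂ w₃)
    (hg : StrictMonoOn g s ∨ StrictAntiOn g s) (hs : s.OrdConnected) (h₀ : w₀ ∈ s) (h₃ : w₃ ∈ s) :
    Ordered (g w₀) (g w₁) (g w₂) (g w₃) := by
  have h₁ := hs.uIcc_subset h₀ h₃ ho.mem_uIcc.1
  have h₂ := hs.uIcc_subset h₀ h₃ ho.mem_uIcc.2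
  rcases hg with m | m <;> rcases ho with ⟨h, h', h''⟩ | ⟨h, h', h''⟩
  exacts [.inl ⟨m h₀ h₁ h, m h₁ h₂ h', m h₂ h₃ h''⟩, .inr ⟨m h₃ h₂ h, m h₂ h₁ h', m h₁ h₀ h''⟩,
    .inr ⟨m h₂ h₃ h'', m h₁ h₂ h', m h₀ h₁ h⟩, .inl ⟨m h₁ h₀ h'', m h₂ h₁ h', m h₃ h₂ h⟩]

end RealFunctions

variable {f : ℝ → ℝ} {a b c p q : ℝ}

lemma IsQuasiQuadratic.mem_Ioo_of_iterate_mem (hf : IsQuasiQuadratic f a b c) {x : ℝ} {t : ℕ}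
    (hx : x ∈ Icc a b) (hxt : f^[t] x ∈ Ioo a b) : x ∈ Ioo a b := by
  have hends : ∀ {w : ℝ}, w ∈ Ioo a b → w ∉ ({a, b} : Set ℝ) := by
    rintro w hw (rfl | rfl)
    exacts [hw.1.false, hw.2.false]
  by_contra hcon
  refine hends hxt (hf.boundary.iterate t ?_)
  rcases eq_endpoints_or_mem_Ioo_of_mem_Icc hx with rfl | rfl | h
  exacts [mem_insert _ _, mem_insert_of_mem _ rfl, absurd h hcon]

/-- A branch of `f^t`: a compact interval `[x, y]` of `(a, b)` whose endpoints `f^t` maps to the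
endpoints of `[α, β]`, in either order, and whose interior contains no critical point of `f^t`;
then `f^t` maps `(x, y)` diffeomorphically onto `(α, β)`. -/
structure IsBranch (f : ℝ → ℝ) (a b c : ℝ) (t : ℕ) (x y α β : ℝ) : Prop where
  lt : x < y
  lt_image : α < β
  subset : Icc x y ⊆ Ioo a b
  noncritical : ∀ i < t, ∀ w ∈ Ioo x y, f^[i] w ≠ c
  ends : (f^[t] x = α ∧ f^[t] y = β) ∨ (f^[t] x = β ∧ f^[t] y = α)

namespace IsBranch

variable {t : ℕ} {x y α β : ℝ}

lemma subset_Icc (h : IsBranch f a b c t x y α β) : Icc x y ⊆ Icc a b :=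
  h.subset.trans Ioo_subset_Icc_self

lemma continuousOn_iterate (h : IsBranch f a b c t x y α β) (hf : IsQuasiQuadratic f a b c)
    (i : ℕ) : ContinuousOn f^[i] (Icc x y) :=
  (hf.continuousOn_iterate i).mono h.subset_Icc

lemma mapsTo_left_or_right (h : IsBranch f a b c t x y α β) (hf : IsQuasiQuadratic f a b c)
    {i : ℕ} (hi : i < t) :
    MapsTo f^[i] (Icc x y) (Icc a c) ∨ MapsTo f^[i] (Icc x y) (Icc c b) :=
  (mapsTo_Iic_or_Ici_of_ne h.lt (h.continuousOn_iterate hf i) (h.noncritical i hi)).imp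
    (fun hle _ hw => ⟨(hf.iterate_mem i (h.subset_Icc hw)).1, hle hw⟩)
    (fun hge _ hw => ⟨hge hw, (hf.iterate_mem i (h.subset_Icc hw)).2⟩)

lemma strictMonoOn_or_strictAntiOn_iterate (h : IsBranch f a b c t x y α β)
    (hf : IsQuasiQuadratic f a b c) {i : ℕ} (hi : i ≤ t) :
    StrictMonoOn f^[i] (Icc x y) ∨ StrictAntiOn f^[i] (Icc x y) := by
  induction i with
  | zero => exact .inl (strictMono_id.strictMonoOn _)
  | succ i ih =>
    have hi' := ih (Nat.le_of_succ_le hi)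
    rw [Function.iterate_succ']
    rcases h.mapsTo_left_or_right hf (Nat.lt_of_succ_le hi) with hleft | hright
    · exact strictMonoOn_or_strictAntiOn_comp (hf.unimodal.imp (·.1) (·.1)) hi' hleft
    · exact strictMonoOn_or_strictAntiOn_comp (hf.unimodal.symm.imp (·.2.1) (·.2.1)) hi' hright

lemma strictMonoOn_or_strictAntiOn (h : IsBranch f a b c t x y α β)
    (hf : IsQuasiQuadratic f a b c) :
    (StrictMonoOn f^[t] (Icc x y) ∧ f^[t] x = α ∧ f^[t] y = β) ∨
    (StrictAntiOn f^[t] (Icc x y) ∧ f^[t] x = β ∧ f^[t] y = α) := by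
  have hx := left_mem_Icc.2 h.lt.le
  have hy := right_mem_Icc.2 h.lt.le
  rcases h.strictMonoOn_or_strictAntiOn_iterate hf le_rfl with m | m
  · exact .inl ⟨m, h.ends.resolve_right fun e =>
      (e.1 ▸ e.2 ▸ m hx hy h.lt).not_gt h.lt_image⟩
  · exact .inr ⟨m, h.ends.resolve_left fun e =>
      (e.1 ▸ e.2 ▸ m hx hy h.lt).not_gt h.lt_image⟩

lemma mapsTo (h : IsBranch f a b c t x y α β) (hf : IsQuasiQuadratic f a b c) :
    MapsTo f^[t] (Ioo x y) (Ioo α β) := by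
  rcases h.strictMonoOn_or_strictAntiOn hf with ⟨m, rfl, rfl⟩ | ⟨m, rfl, rfl⟩
  exacts [m.mapsTo_Ioo, m.mapsTo_Ioo]

lemma mapsTo_Icc (h : IsBranch f a b c t x y α β) (hf : IsQuasiQuadratic f a b c) :
    MapsTo f^[t] (Icc x y) (Icc α β) := by
  rcases h.strictMonoOn_or_strictAntiOn hf with ⟨m, rfl, rfl⟩ | ⟨m, rfl, rfl⟩
  exacts [m.monotoneOn.mapsTo_Icc, m.antitoneOn.mapsTo_Icc]

lemma bijOn (h : IsBranch f a b c t x y α β) (hf : IsQuasiQuadratic f a b c) :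
    BijOn f^[t] (Ioo x y) (Ioo α β) := by
  have hcont := h.continuousOn_iterate hf t
  refine ⟨h.mapsTo hf, ?_, ?_⟩
  · exact ((h.strictMonoOn_or_strictAntiOn_iterate hf le_rfl).elim (·.injOn) (·.injOn)).mono
      Ioo_subset_Icc_self
  · rcases h.ends with ⟨rfl, rfl⟩ | ⟨rfl, rfl⟩
    exacts [intermediate_value_Ioo h.lt.le hcont, intermediate_value_Ioo' h.lt.le hcont]

lemma deriv_ne_zero (h : IsBranch f a b c t x y α β) (hf : IsQuasiQuadratic f a b c) {w : ℝ}
    (hw : w ∈ Ioo x y) (hαβ : Icc α β ⊆ Ioo a b) : deriv f^[t] w ≠ 0 := by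
  have hinterior : ∀ i ≤ t, f^[i] w ∈ Ioo a b := fun i hi => by
    refine hf.mem_Ioo_of_iterate_mem (t := t - i)
      (hf.iterate_mem i (h.subset_Icc (Ioo_subset_Icc_self hw))) ?_
    rw [← Function.iterate_add_apply, Nat.sub_add_cancel hi]
    exact hαβ (Ioo_subset_Icc_self (h.mapsTo hf hw))
  have hchain : ∀ i ≤ t, ∃ d ≠ 0, HasDerivAt f^[i] d w := by
    intro i
    induction i with
    | zero => exact fun _ => ⟨1, one_ne_zero, hasDerivAt_id w⟩
    | succ i ih =>
      intro hi
      obtain ⟨d, hd, hderiv⟩ := ih (Nat.le_of_succ_le hi)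
      have hwi := hinterior i (Nat.le_of_succ_le hi)
      rw [Function.iterate_succ']
      exact ⟨_, mul_ne_zero (hf.deriv_ne _ hwi (h.noncritical i (Nat.lt_of_succ_le hi) w hw)) hd,
        (hf.hasDerivAt hwi).comp w hderiv⟩
  obtain ⟨d, hd, hderiv⟩ := hchain t le_rfl
  rwa [hderiv.deriv]

lemma crossRatio_le (h : IsBranch f a b c t x y α β) (hf : IsQuasiQuadratic f a b c)
    {w₀ w₁ w₂ w₃ : ℝ} (ho : Ordered w₀ w₁ w₂ w₃) (h₀ : w₀ ∈ Icc x y) (h₃ : w₃ ∈ Icc x y) :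
    crossRatio w₀ w₁ w₂ w₃ ≤ crossRatio (f^[t] w₀) (f^[t] w₁) (f^[t] w₂) (f^[t] w₃) := by
  suffices ∀ i ≤ t, crossRatio w₀ w₁ w₂ w₃ ≤
      crossRatio (f^[i] w₀) (f^[i] w₁) (f^[i] w₂) (f^[i] w₃) from this t le_rfl
  intro i
  induction i with
  | zero => exact fun _ => le_rfl
  | succ i ih =>
    intro hi
    have hi' := Nat.le_of_succ_le hi
    refine (ih hi').trans ?_
    simp only [Function.iterate_succ', Function.comp_apply]
    exact hf.crossRatio_le
      (ho.map (h.strictMonoOn_or_strictAntiOn_iterate hf hi') ordConnected_Icc h₀ h₃)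
      ((h.mapsTo_left_or_right hf (Nat.lt_of_succ_le hi)).imp
        (fun hm => uIcc_subset_Icc (hm h₀) (hm h₃)) (fun hm => uIcc_subset_Icc (hm h₀) (hm h₃)))

lemma comp {t' : ℕ} {α' β' : ℝ} (h : IsBranch f a b c t x y α β)
    (h' : IsBranch f a b c t' α β α' β') (hf : IsQuasiQuadratic f a b c) :
    IsBranch f a b c (t + t') x y α' β' := by
  refine ⟨h.lt, h'.lt_image, h.subset, fun i hi w hw => ?_, ?_⟩
  · rcases lt_or_ge i t with hit | hit
    · exact h.noncritical i hit w hw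
    · have hne := h'.noncritical (i - t) (by lia) _ (h.mapsTo hf hw)
      rwa [← Function.iterate_add_apply, Nat.sub_add_cancel hit] at hne
  · rw [add_comm, Function.iterate_add_apply, Function.iterate_add_apply]
    rcases h.ends with ⟨ex, ey⟩ | ⟨ex, ey⟩ <;> rw [ex, ey]
    exacts [h'.ends, h'.ends.symm.imp And.symm And.symm]

lemma restrict {v w α' β' : ℝ} (h : IsBranch f a b c t x y α β) (hv : x ≤ v) (hvw : v < w)
    (hw : w ≤ y) (hαβ : α' < β')
    (hends : (f^[t] v = α' ∧ f^[t] w = β') ∨ (f^[t] v = β' ∧ f^[t] w = α')) :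
    IsBranch f a b c t v w α' β' :=
  ⟨hvw, hαβ, (Icc_subset_Icc hv hw).trans h.subset,
    fun i hi z hz => h.noncritical i hi z (Ioo_subset_Ioo hv hw hz), hends⟩

lemma exists_restrict {α' β' : ℝ} (h : IsBranch f a b c t x y α β)
    (hf : IsQuasiQuadratic f a b c) (hα : α < α') (hαβ : α' < β') (hβ : β' < β) :
    ∃ x' y', x < x' ∧ x' < y' ∧ y' < y ∧ IsBranch f a b c t x' y' α' β' ∧
      crossRatio x x' y' y ≤ crossRatio α α' β' β ∧
      ∀ z ∈ Ioo x y, f^[t] z ∈ Ioo α' β' → z ∈ Ioo x' y' := by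
  obtain ⟨v, hv, rfl⟩ := (h.bijOn hf).surjOn ⟨hα, hαβ.trans hβ⟩
  obtain ⟨w, hw, rfl⟩ := (h.bijOn hf).surjOn ⟨hα.trans hαβ, hβ⟩
  have hv' := Ioo_subset_Icc_self hv
  have hw' := Ioo_subset_Icc_self hw
  have hx := left_mem_Icc.2 h.lt.le
  have hy := right_mem_Icc.2 h.lt.le
  rcases h.strictMonoOn_or_strictAntiOn hf with ⟨m, ex, ey⟩ | ⟨m, ex, ey⟩
  · have hvw : v < w := (m.lt_iff_lt hv' hw').1 hαβ
    have hcross := h.crossRatio_le hf (.inl ⟨hv.1, hvw, hw.2⟩) hx hy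
    rw [ex, ey] at hcross
    exact ⟨v, w, hv.1, hvw, hw.2, h.restrict hv'.1 hvw hw'.2 hαβ (.inl ⟨rfl, rfl⟩), hcross,
      fun z hz hzt => ⟨(m.lt_iff_lt hv' (Ioo_subset_Icc_self hz)).1 hzt.1,
        (m.lt_iff_lt (Ioo_subset_Icc_self hz) hw').1 hzt.2⟩⟩
  · have hwv : w < v := (m.lt_iff_gt hv' hw').1 hαβ
    have hcross := h.crossRatio_le hf (.inl ⟨hw.1, hwv, hv.2⟩) hx hy
    rw [ex, ey, crossRatio_reverse α] at hcross
    exact ⟨w, v, hw.1, hwv, hv.2, h.restrict hw'.1 hwv hv'.2 hαβ (.inr ⟨rfl, rfl⟩), hcross,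
      fun z hz hzt => ⟨(m.lt_iff_gt (Ioo_subset_Icc_self hz) hw').1 hzt.2,
        (m.lt_iff_gt hv' (Ioo_subset_Icc_self hz)).1 hzt.1⟩⟩

lemma iterate_sub_mem (h : IsBranch f a b c t x y α β) (hf : IsQuasiQuadratic f a b c) {j : ℕ}
    (hj : j ≤ t) {z w e : ℝ} (hz : z ∈ Ioo x y) (hw : w ∈ Ioo x y)
    (he : e ∈ uIcc (f^[j] z) (f^[j] w)) : f^[t - j] e ∈ Ioo α β := by
  have hsub : uIcc z w ⊆ Ioo x y := ordConnected_Ioo.uIcc_subset hz hw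
  obtain ⟨v, hv, rfl⟩ := intermediate_value_uIcc
    ((h.continuousOn_iterate hf j).mono (hsub.trans Ioo_subset_Icc_self)) he
  rw [← Function.iterate_add_apply, Nat.sub_add_cancel hj]
  exact h.mapsTo hf (hsub hv)

lemma iterate_notMem_Ioo (h : IsBranch f a b c t x y α β) (hf : IsQuasiQuadratic f a b c) {j : ℕ}
    (hj : j ≤ t) {z l u : ℝ} (hz : z ∈ Ioo x y) (hzj : f^[j] z ∉ Ioo l u)
    (hl : f^[t - j] l ∉ Ioo α β) (hu : f^[t - j] u ∉ Ioo α β) {w : ℝ} (hw : w ∈ Icc x y) :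
    f^[j] w ∉ Ioo l u := by
  have hinterior : MapsTo f^[j] (Ioo x y) (Ioo l u)ᶜ := by
    intro v hv hmem
    rcases le_or_gt (f^[j] z) l with hzl | hlz
    · exact hl (h.iterate_sub_mem hf hj hz hv (mem_uIcc.2 (.inl ⟨hzl, hmem.1.le⟩)))
    · have huz : u ≤ f^[j] z := le_of_not_gt fun hzu => hzj ⟨hlz, hzu⟩
      exact hu (h.iterate_sub_mem hf hj hz hv (mem_uIcc.2 (.inr ⟨hmem.2.le, huz⟩)))
  have hcont := h.continuousOn_iterate hf j
  rw [← closure_Ioo h.lt.ne] at hw hcont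
  exact isOpen_Ioo.isClosed_compl.closure_eq.subset
    (hinterior.closure_of_continuousOn hcont hw)

lemma ends_mem_Icc (h : IsBranch f a b c t x y α β) (hf : IsQuasiQuadratic f a b c) {z l u : ℝ}
    (hz : z ∈ Ioo x y) (hz' : z ∈ Ioo l u) (hl : f^[t] l ∉ Ioo α β) (hu : f^[t] u ∉ Ioo α β) :
    l ≤ x ∧ y ≤ u :=
  ⟨le_of_not_gt fun hxl => hl (h.mapsTo hf ⟨hxl, hz'.1.trans hz.2⟩),
    le_of_not_gt fun huy => hu (h.mapsTo hf ⟨hz.1.trans hz'.2, huy⟩)⟩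

end IsBranch

/-- The pull-backs of `(α, β)` along the orbit of `z` stay monotone as long as each of them is
separated from `c` by a point `e` whose orbit misses `(α, β)`. -/
lemma exists_isBranch (hf : IsQuasiQuadratic f a b c) {α β : ℝ} (hαβ : Icc α β ⊆ Ioo a b)
    {t : ℕ} {z : ℝ} (hz : z ∈ Icc a b) (hzt : f^[t] z ∈ Ioo α β)
    (hsep : ∀ i < t, ∃ e ∈ uIcc c (f^[i] z), f^[t - i] e ∉ Ioo α β) :
    ∃ x y, z ∈ Ioo x y ∧ IsBranch f a b c t x y α β := by
  induction t generalizing z with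
  | zero =>
    have hlt := hzt.1.trans hzt.2
    exact ⟨α, β, hzt, hlt, hlt, hαβ, fun i hi => absurd hi (Nat.not_lt_zero i), .inl ⟨rfl, rfl⟩⟩
  | succ t ih =>
    obtain ⟨x, y, hfz, hbranch⟩ := ih (hf.mapsTo hz) hzt fun i hi => by
      have hsep' := hsep (i + 1) (by lia)
      rwa [Nat.add_sub_add_right, Function.iterate_succ_apply] at hsep'
    have hfc : f c ∉ Ioo x y := fun hfc => by
      obtain ⟨e, he, hne⟩ := hsep 0 (by lia)
      exact hne (hbranch.mapsTo hf
        (ordConnected_Ioo.uIcc_subset hfc hfz (hf.apply_mem_uIcc hz he)))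
    obtain ⟨x', y', hz', hsub, hcxy, hends⟩ := hf.exists_pullback hz hfz hbranch.subset hfc
    have hfirst : IsBranch f a b c 1 x' y' x y :=
      ⟨hz'.1.trans hz'.2, hbranch.lt, hsub, fun i hi w hw => by
        obtain rfl : i = 0 := by lia
        exact ne_of_mem_of_not_mem hw hcxy, hends⟩
    exact ⟨x', y', hz', add_comm t 1 ▸ hfirst.comp hbranch hf⟩

section Intervals

lemma connectedComponentIn_eq_Ioo {S : Set ℝ} {x y z : ℝ} (hz : z ∈ Ioo x y) (hS : Ioo x y ⊆ S)
    (hx : x ∉ S) (hy : y ∉ S) : connectedComponentIn S z = Ioo x y := by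
  refine Subset.antisymm (fun w hw => ?_) (isPreconnected_Ioo.subset_connectedComponentIn hz hS)
  have hoc := (isPreconnected_connectedComponentIn (F := S) (x := z)).ordConnected
  have hzmem : z ∈ connectedComponentIn S z := mem_connectedComponentIn (hS hz)
  have hsub := connectedComponentIn_subset S z
  exact ⟨lt_of_not_ge fun h => hx (hsub (hoc.out hw hzmem ⟨h, hz.1.le⟩)),
    lt_of_not_ge fun h => hy (hsub (hoc.out hzmem hw ⟨hz.2.le, h⟩))⟩

lemma Ioo_inj {x y x' y' : ℝ} (h : x < y) (h' : x' < y') (e : Ioo x y = Ioo x' y') :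
    x = x' ∧ y = y' :=
  ⟨csInf_Ioo h ▸ csInf_Ioo h' ▸ congrArg sInf e, csSup_Ioo h ▸ csSup_Ioo h' ▸ congrArg sSup e⟩

lemma exists_end_mem_uIcc {l u c w : ℝ} (hc : c ∈ Ioo l u) (hw : w ∉ Ioo l u) :
    ∃ e ∈ ({l, u} : Set ℝ), e ∈ uIcc c w := by
  rcases le_or_gt w l with hwl | hlw
  · exact ⟨l, mem_insert _ _, mem_uIcc.2 (.inr ⟨hwl, hc.1.le⟩)⟩
  · exact ⟨u, mem_insert_of_mem _ rfl,
      mem_uIcc.2 (.inl ⟨hc.2.le, le_of_not_gt fun hwu => hw ⟨hlw, hwu⟩⟩)⟩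

end Intervals

lemma IsRecurrent.exists_ge (h : IsRecurrent f c) {U : Set ℝ} (hU : IsOpen U) (hc : c ∈ U)
    (N : ℕ) : ∃ t ≥ N, f^[t] c ∈ U :=
  frequently_atTop.1 (mapClusterPt_iff_frequently.1 h U (hU.mem_nhds hc)) N

lemma exists_isFirstPassage {A : Set ℝ} (h : ∃ t, 1 ≤ t ∧ f^[t] c ∈ A) :
    ∃ t, IsFirstPassage f c A t := by
  classical
  exact ⟨Nat.find h, (Nat.find_spec h).1, (Nat.find_spec h).2,
    fun s hs hlt hA => Nat.find_min h hlt ⟨hs, hA⟩⟩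

end Branches

section NiceIntervals

variable {f : ℝ → ℝ} {a b c p q : ℝ}

lemma iterate_eq_of_apply_eq {x y : ℝ} (h : f x = f y) {t : ℕ} (ht : 1 ≤ t) :
    f^[t] x = f^[t] y := by
  obtain ⟨s, rfl⟩ := Nat.exists_eq_add_of_le' ht
  rw [Function.iterate_succ_apply, Function.iterate_succ_apply, h]

lemma iterate_pred_apply {r : ℕ} (hr : 1 ≤ r) (z : ℝ) : f^[r - 1] (f z) = f^[r] z := by
  rw [← Function.iterate_succ_apply, Nat.succ_eq_add_one, Nat.sub_add_cancel hr]

namespace IsQuasiQuadratic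

lemma injOn_left (hf : IsQuasiQuadratic f a b c) : InjOn f (Icc a c) :=
  hf.unimodal.elim (fun h => h.1.injOn) fun h => h.1.injOn

lemma injOn_right (hf : IsQuasiQuadratic f a b c) : InjOn f (Icc c b) :=
  hf.unimodal.elim (fun h => h.2.1.injOn) fun h => h.2.1.injOn

lemma critical_value_extremal (hf : IsQuasiQuadratic f a b c) :
    (∀ w ∈ Icc a b, w ≠ c → f w < f c) ∨ (∀ w ∈ Icc a b, w ≠ c → f c < f w) := by
  have hcl := right_mem_Icc.2 hf.crit_mem.1.le
  have hcr := left_mem_Icc.2 hf.crit_mem.2.le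
  refine hf.unimodal.imp (fun h w hw hne => ?_) (fun h w hw hne => ?_) <;>
    rcases lt_or_gt_of_ne hne with hwc | hcw
  exacts [h.1 ⟨hw.1, hwc.le⟩ hcl hwc, h.2.1 hcr ⟨hcw.le, hw.2⟩ hcw,
    h.1 ⟨hw.1, hwc.le⟩ hcl hwc, h.2.1 hcr ⟨hcw.le, hw.2⟩ hcw]

end IsQuasiQuadratic

/-- A nice interval: an interval `(α, β)` around `c` whose endpoints have the same image and never
return to it. -/
structure IsNice (f : ℝ → ℝ) (a b c α β : ℝ) : Prop where
  left_mem : α ∈ Ioo a c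
  right_mem : β ∈ Ioo c b
  symm : f α = f β
  nice : ∀ t : ℕ, 1 ≤ t → f^[t] α ∉ Ioo α β

/-- `(l, u)` is the pull-back of `(α, β)` along the orbit of `c` of length `r`: it is folded by `f`
into a branch `(x, y)` of `f^(r-1)` around the critical value, its endpoints going to one of `x`
and `y`, and the orbits of its endpoints never enter `(α, β)`. -/
structure IsCentralPullback (f : ℝ → ℝ) (a b c : ℝ) (r : ℕ) (α β l u : ℝ) : Prop where
  left_le : α ≤ l
  le_right : u ≤ β
  left_notMem : ∀ t, 1 ≤ t → f^[t] l ∉ Ioo α β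
  exists_branch : ∃ x y, f c ∈ Ioo x y ∧ IsBranch f a b c (r - 1) x y α β ∧
    (f l = x ∨ f l = y) ∧ MapsTo f (Ioo l u) (Ioo x y)

namespace IsCentralPullback

variable {r : ℕ} {α β l u : ℝ}

lemma mapsTo (h : IsCentralPullback f a b c r α β l u) (hf : IsQuasiQuadratic f a b c)
    (hr : 1 ≤ r) : MapsTo f^[r] (Ioo l u) (Ioo α β) := by
  obtain ⟨x, y, -, hB, -, hmap⟩ := h.exists_branch
  intro z hz
  rw [← iterate_pred_apply hr]
  exact hB.mapsTo hf (hmap hz)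

lemma iterate_left_mem (h : IsCentralPullback f a b c r α β l u) (hr : 1 ≤ r) :
    f^[r] l ∈ ({α, β} : Set ℝ) := by
  obtain ⟨x, y, -, hB, he, -⟩ := h.exists_branch
  rw [← iterate_pred_apply hr, mem_insert_iff, mem_singleton_iff]
  rcases hB.ends with ⟨hx, hy⟩ | ⟨hx, hy⟩ <;> rcases he with h | h <;>
    simp only [h, hx, hy, or_true, true_or]

lemma connectedComponentIn_eq (h : IsCentralPullback f a b c r α β l u)
    (hf : IsQuasiQuadratic f a b c) (hr : 1 ≤ r) (hlu : IsNice f a b c l u) :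
    connectedComponentIn (returnDomain f (Ioo α β)) c = Ioo l u := by
  refine connectedComponentIn_eq_Ioo ⟨hlu.left_mem.2, hlu.right_mem.1⟩
    (fun w hw => ⟨Ioo_subset_Ioo h.left_le h.le_right hw, r, hr, h.mapsTo hf hr hw⟩) ?_ ?_ <;>
    rintro ⟨-, s, hs, hmem⟩
  · exact h.left_notMem s hs hmem
  · exact h.left_notMem s hs (iterate_eq_of_apply_eq hlu.symm hs ▸ hmem)

end IsCentralPullback

namespace IsNice

variable {α β : ℝ}

lemma nice_ends (h : IsNice f a b c α β) (t : ℕ) {e : ℝ} (he : e ∈ ({α, β} : Set ℝ)) :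
    f^[t] e ∉ Ioo α β := by
  rcases t.eq_zero_or_pos with rfl | ht <;> rcases he with rfl | rfl
  · exact left_notMem_Ioo
  · exact right_notMem_Ioo
  · exact h.nice t ht
  · exact iterate_eq_of_apply_eq h.symm ht ▸ h.nice t ht

lemma crit_mem (h : IsNice f a b c α β) : c ∈ Ioo α β := ⟨h.left_mem.2, h.right_mem.1⟩

lemma lt (h : IsNice f a b c α β) : α < β := h.left_mem.2.trans h.right_mem.1

lemma subset (h : IsNice f a b c α β) : Icc α β ⊆ Ioo a b :=
  Icc_subset_Ioo h.left_mem.1 h.right_mem.2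

lemma lt_and_lt_of_not_subset {α' β' : ℝ} (h : IsNice f a b c α β)
    (hf : IsQuasiQuadratic f a b c) (h' : IsNice f a b c α' β') (hα : α ≤ α') (hβ : β' ≤ β)
    (hnot : ¬ Ioo α β ⊆ Ioo α' β') : α < α' ∧ β' < β := by
  refine ⟨hα.lt_of_ne ?_, hβ.lt_of_ne ?_⟩
  · rintro rfl
    exact hnot (hf.injOn_right (Ioo_subset_Icc_self h.right_mem) (Ioo_subset_Icc_self h'.right_mem)
      (h.symm.symm.trans h'.symm) ▸ Subset.rfl)
  · rintro rfl
    exact hnot (hf.injOn_left (Ioo_subset_Icc_self h.left_mem) (Ioo_subset_Icc_self h'.left_mem)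
      (h.symm.trans h'.symm.symm) ▸ Subset.rfl)

lemma exists_isFirstPassage (h : IsNice f a b c α β) (hrec : IsRecurrent f c) :
    ∃ r, IsFirstPassage f c (Ioo α β) r :=
  PrincipalNest.exists_isFirstPassage (hrec.exists_ge isOpen_Ioo h.crit_mem 1)

lemma branch_ends_notMem (h : IsNice f a b c α β) (hf : IsQuasiQuadratic f a b c) {t i₀ : ℕ}
    {x y z : ℝ} (hB : IsBranch f a b c t x y α β) (hz : z ∈ Ioo x y)
    (hret : ∀ i, i₀ ≤ i → i < t → f^[i] z ∉ Ioo α β) {i : ℕ} (hi : i₀ ≤ i) {e : ℝ}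
    (he : e ∈ ({x, y} : Set ℝ)) : f^[i] e ∉ Ioo α β := by
  rcases lt_or_ge i t with hit | hti
  · have heIcc : e ∈ Icc x y := by
      rcases he with rfl | rfl
      exacts [left_mem_Icc.2 hB.lt.le, right_mem_Icc.2 hB.lt.le]
    exact hB.iterate_notMem_Ioo hf hit.le hz (hret i hi hit)
      (h.nice_ends _ (mem_insert _ _))
      (h.nice_ends _ (mem_insert_of_mem _ rfl)) heIcc
  · have hte : f^[t] e ∈ ({α, β} : Set ℝ) := by
      simp only [mem_insert_iff, mem_singleton_iff] at he ⊢
      rcases hB.ends with ⟨hx, hy⟩ | ⟨hx, hy⟩ <;> rcases he with rfl | rfl <;> tauto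
    rw [← Nat.sub_add_cancel hti, Function.iterate_add_apply]
    exact h.nice_ends _ hte

lemma connectedComponentIn_eq (h : IsNice f a b c α β) (hf : IsQuasiQuadratic f a b c) {t : ℕ}
    {x y z : ℝ} (hB : IsBranch f a b c t x y α β) (hz : z ∈ Ioo x y) (ht : 1 ≤ t)
    (hzT : z ∈ Ioo α β) (hret : ∀ i, 1 ≤ i → i < t → f^[i] z ∉ Ioo α β) :
    connectedComponentIn (returnDomain f (Ioo α β)) z = Ioo x y := by
  have hsub := hB.ends_mem_Icc hf hz hzT (h.nice_ends t (mem_insert _ _))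
    (h.nice_ends t (mem_insert_of_mem _ rfl))
  refine connectedComponentIn_eq_Ioo hz (fun w hw => ⟨Ioo_subset_Ioo hsub.1 hsub.2 hw, t, ht,
    hB.mapsTo hf hw⟩) ?_ ?_ <;> rintro ⟨-, s, hs, hmem⟩
  · exact h.branch_ends_notMem hf hB hz hret hs (mem_insert _ _) hmem
  · exact h.branch_ends_notMem hf hB hz hret hs (mem_insert_of_mem _ rfl) hmem

lemma exists_critical_value_branch (h : IsNice f a b c α β) (hf : IsQuasiQuadratic f a b c) {r : ℕ}
    (hr : IsFirstPassage f c (Ioo α β) r) :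
    ∃ x y, f c ∈ Ioo x y ∧ IsBranch f a b c (r - 1) x y α β ∧
      ∀ e ∈ ({x, y} : Set ℝ), ∀ t, f^[t] e ∉ Ioo α β := by
  have hret : ∀ i, 0 ≤ i → i < r - 1 → f^[i] (f c) ∉ Ioo α β := fun i _ hi => by
    rw [← Function.iterate_succ_apply]
    exact hr.2.2 _ (by omega) (by omega)
  obtain ⟨x, y, hcxy, hB⟩ := exists_isBranch hf h.subset (t := r - 1)
    (hf.mapsTo (Ioo_subset_Icc_self hf.crit_mem)) (by rw [iterate_pred_apply hr.1]; exact hr.2.1)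
    fun i hi => by
      obtain ⟨e, he, hec⟩ := exists_end_mem_uIcc h.crit_mem (hret i i.zero_le hi)
      exact ⟨e, hec, h.nice_ends _ he⟩
  exact ⟨x, y, hcxy, hB, fun e he t => h.branch_ends_notMem hf hB hcxy hret t.zero_le he⟩

lemma exists_isCentralPullback (h : IsNice f a b c α β) (hf : IsQuasiQuadratic f a b c) {r : ℕ}
    (hr : IsFirstPassage f c (Ioo α β) r) :
    ∃ l u, IsNice f a b c l u ∧ IsCentralPullback f a b c r α β l u := by
  obtain ⟨x, y, hcxy, hB, hends⟩ := h.exists_critical_value_branch hf hr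
  obtain ⟨l, hl, u, hu, hlu, hle, hmap⟩ := hf.exists_critical_pullback hB.subset hcxy
  have hl_notMem : ∀ t, 1 ≤ t → f^[t] l ∉ Ioo α β := fun t ht => by
    rw [← iterate_pred_apply ht]
    exact hends (f l) hle _
  have hmaps : ∀ z ∈ Ioo l u, f^[r] z ∈ Ioo α β := fun z hz => by
    rw [← iterate_pred_apply hr.1]
    exact hB.mapsTo hf (hmap z hz)
  have hαl : α ≤ l := by
    by_contra! hlα
    exact h.nice_ends r (mem_insert _ _) (hmaps α ⟨hlα, h.left_mem.2.trans hu.1⟩)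
  have huβ : u ≤ β := by
    by_contra! hβu
    exact h.nice_ends r (mem_insert_of_mem _ rfl) (hmaps β ⟨hl.2.trans h.right_mem.1, hβu⟩)
  exact ⟨l, u, ⟨hl, hu, hlu, fun t ht hmem => hl_notMem t ht (Ioo_subset_Ioo hαl huβ hmem)⟩,
    hαl, huβ, hl_notMem, x, y, hcxy, hB, hle, hmap⟩

end IsNice

lemma IsInitialInterval.exists_isNice_nest_eq (hI : IsInitialInterval f a b c p q)
    (hf : IsQuasiQuadratic f a b c) (hrec : IsRecurrent f c) (n : ℕ) :
    ∃ α β, nest f c (Ioo p q) n = Ioo α β ∧ IsNice f a b c α β := by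
  induction n with
  | zero => exact ⟨p, q, rfl, hI.left_mem, hI.right_mem, hI.symmetric, hI.nice⟩
  | succ n ih =>
    obtain ⟨α, β, hnest, h⟩ := ih
    obtain ⟨r, hr⟩ := h.exists_isFirstPassage hrec
    obtain ⟨l, u, hlu, hpull⟩ := h.exists_isCentralPullback hf hr
    exact ⟨l, u, by rw [nest, hnest, hpull.connectedComponentIn_eq hf hr.1 hlu], hlu⟩

/-- The principal nest `I^n = (l n, u n)` together with the first return times `r n` of `c`
to `I^n`, in the absence of central returns. -/
structure NestData (f : ℝ → ℝ) (a b c : ℝ) (J : Set ℝ) (l u : ℕ → ℝ) (r : ℕ → ℕ) : Prop where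
  nest_eq : ∀ n, nest f c J n = Ioo (l n) (u n)
  isNice : ∀ n, IsNice f a b c (l n) (u n)
  lt_left : ∀ n, l n < l (n + 1)
  lt_right : ∀ n, u (n + 1) < u n
  first : ∀ n, IsFirstPassage f c (Ioo (l n) (u n)) (r n)
  return_notMem : ∀ n, f^[r n] c ∉ Ioo (l (n + 1)) (u (n + 1))
  central : ∀ n, IsCentralPullback f a b c (r n) (l n) (u n) (l (n + 1)) (u (n + 1))

lemma exists_nestData (hf : IsQuasiQuadratic f a b c) (hI : IsInitialInterval f a b c p q)
    (hrec : IsRecurrent f c) (hnc : NoCentralReturns f c (Ioo p q)) :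
    ∃ l u r, NestData f a b c (Ioo p q) l u r := by
  choose l u hnest hnice using hI.exists_isNice_nest_eq hf hrec
  choose r hr using fun n => (hnice n).exists_isFirstPassage hrec
  have hcentral : ∀ n, IsCentralPullback f a b c (r n) (l n) (u n) (l (n + 1)) (u (n + 1)) := by
    intro n
    obtain ⟨l', u', hlu', hpull⟩ := (hnice n).exists_isCentralPullback hf (hr n)
    have hsucc := hnest (n + 1)
    rw [nest, hnest n, hpull.connectedComponentIn_eq hf (hr n).1 hlu'] at hsucc
    obtain ⟨rfl, rfl⟩ := Ioo_inj hlu'.lt (hnice (n + 1)).lt hsucc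
    exact hpull
  have hreturn : ∀ n, f^[r n] c ∉ Ioo (l (n + 1)) (u (n + 1)) := fun n => by
    rw [← hnest]
    exact hnc (n + 1) n.succ_pos _ (by rw [Nat.add_sub_cancel, hnest]; exact hr n)
  have hstrict := fun n => (hnice n).lt_and_lt_of_not_subset hf (hnice (n + 1))
    (hcentral n).left_le (hcentral n).le_right fun hsub => hreturn n (hsub (hr n).2.1)
  exact ⟨l, u, r, hnest, hnice, fun n => (hstrict n).1, fun n => (hstrict n).2, hr, hreturn,
    hcentral⟩

namespace NestData

variable {J : Set ℝ} {l u : ℕ → ℝ} {r : ℕ → ℕ}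

lemma lt (D : NestData f a b c J l u r) (n : ℕ) : l n < u n := (D.isNice n).lt

lemma crit_mem (D : NestData f a b c J l u r) (n : ℕ) : c ∈ Ioo (l n) (u n) :=
  (D.isNice n).crit_mem

lemma monotone_l (D : NestData f a b c J l u r) : Monotone l :=
  monotone_nat_of_le_succ fun n => (D.lt_left n).le

lemma antitone_u (D : NestData f a b c J l u r) : Antitone u :=
  antitone_nat_of_succ_le fun n => (D.lt_right n).le

lemma Ioo_subset (D : NestData f a b c J l u r) {m n : ℕ} (h : m ≤ n) :
    Ioo (l n) (u n) ⊆ Ioo (l m) (u m) := Ioo_subset_Ioo (D.monotone_l h) (D.antitone_u h)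

lemma one_le_r (D : NestData f a b c J l u r) (n : ℕ) : 1 ≤ r n := (D.first n).1

lemma notMem_of_lt (D : NestData f a b c J l u r) {n t : ℕ} (h1 : 1 ≤ t) (ht : t < r n) :
    f^[t] c ∉ Ioo (l n) (u n) := (D.first n).2.2 t h1 ht

lemma r_lt (D : NestData f a b c J l u r) (n : ℕ) : r n < r (n + 1) := by
  have hmem := (D.first (n + 1)).2.1
  refine lt_of_le_of_ne ?_ fun heq => D.return_notMem n (heq ▸ hmem)
  by_contra! hlt
  exact D.notMem_of_lt (D.one_le_r (n + 1)) hlt (D.Ioo_subset n.le_succ hmem)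

lemma strictMono_r (D : NestData f a b c J l u r) : StrictMono r := strictMono_nat_of_lt_succ D.r_lt

lemma ends_notMem (D : NestData f a b c J l u r) (n : ℕ) {t : ℕ} (ht : 1 ≤ t) {e : ℝ}
    (he : e ∈ ({l (n + 1), u (n + 1)} : Set ℝ)) : f^[t] e ∉ Ioo (l n) (u n) := by
  rcases he with rfl | rfl
  · exact (D.central n).left_notMem t ht
  · exact iterate_eq_of_apply_eq (D.isNice _).symm ht ▸ (D.central n).left_notMem t ht

lemma exists_branch_of_notMem (D : NestData f a b c J l u r) (hf : IsQuasiQuadratic f a b c)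
    {n t : ℕ} {z : ℝ} (hz : z ∈ Icc a b) (hzt : f^[t] z ∈ Ioo (l n) (u n))
    (h : ∀ i < t, f^[i] z ∉ Ioo (l (n + 1)) (u (n + 1))) :
    ∃ x y, z ∈ Ioo x y ∧ IsBranch f a b c t x y (l n) (u n) :=
  exists_isBranch hf (D.isNice n).subset hz hzt fun i hi => by
    obtain ⟨e, he, hec⟩ := exists_end_mem_uIcc (D.crit_mem (n + 1)) (h i hi)
    exact ⟨e, hec, D.ends_notMem n (by omega) he⟩

lemma mapsTo_iterate (D : NestData f a b c J l u r) (hf : IsQuasiQuadratic f a b c) (n : ℕ) :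
    MapsTo f^[r n] (Ioo (l (n + 1)) (u (n + 1))) (Ioo (l n) (u n)) :=
  (D.central n).mapsTo hf (D.one_le_r n)

end NestData

end NiceIntervals

section QuadraticCriticalPoint

section CrossRatio

lemma crossRatio_le_of_le {w₀ w₁ w₂ w₃ g U V : ℝ} (hU : 0 < U) (hV : 0 < V) (hg : |w₂ - w₁| ≤ g)
    (hU' : U ≤ |w₁ - w₀|) (hV' : V ≤ |w₃ - w₂|) :
    crossRatio w₀ w₁ w₂ w₃ ≤ (1 + g / U) * (1 + g / V) := by
  have hg_nonneg : 0 ≤ g := (abs_nonneg _).trans hg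
  unfold crossRatio
  gcongr

lemma add_le_mul_crossRatio {w₀ w₁ w₂ w₃ t : ℝ} (h : w₁ ≠ w₀) (ht : |w₁ - w₀| ≤ t) :
    |w₂ - w₁| + t ≤ t * crossRatio w₀ w₁ w₂ w₃ := by
  have hpos : 0 < |w₁ - w₀| := abs_pos.2 (sub_ne_zero.2 h)
  have ht_pos : 0 < t := hpos.trans_le ht
  have hgap : |w₂ - w₁| ≤ t * (|w₂ - w₁| / |w₁ - w₀|) := by
    rw [mul_div_left_comm]
    exact le_mul_of_one_le_right (abs_nonneg _) ((one_le_div hpos).2 ht)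
  calc |w₂ - w₁| + t ≤ t * (1 + |w₂ - w₁| / |w₁ - w₀|) := by linarith
    _ ≤ t * crossRatio w₀ w₁ w₂ w₃ := by
      gcongr
      exact le_mul_of_one_le_right (by positivity) (le_add_of_nonneg_right (by positivity))

lemma len_Ioo {l u : ℝ} (h : l < u) : len (Ioo l u) = u - l := by
  rw [len, csSup_Ioo h, csInf_Ioo h]

lemma poincareLength_Ioo {l l' u' u : ℝ} (hl : l < l') (hmid : l' < u') (hu : u' < u) :
    poincareLength (Ioo l' u') (Ioo l u) = Real.log (crossRatio l l' u' u) := by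
  have h : l < u := hl.trans (hmid.trans hu)
  have hl_pos := sub_pos.2 hl
  have hmid_pos := sub_pos.2 hmid
  have hu_pos := sub_pos.2 hu
  rw [poincareLength, len_Ioo hmid, csInf_Ioo hmid, csSup_Ioo hmid, csInf_Ioo h, csSup_Ioo h,
    crossRatio, abs_of_pos hl_pos, abs_of_pos hmid_pos, abs_of_pos hu_pos,
    Real.log_mul (by positivity) (by positivity)]

end CrossRatio

section QuadraticComparison

lemma sub_le_cube_mul_sub {κ X Y ρ ρ' : ℝ} (hXY : 0 < X + Y) (hρρ' : ρ' ≤ ρ)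
    (h : X ^ 2 - Y ^ 2 ≤ κ ^ 2 * (ρ ^ 2 - ρ' ^ 2)) (hρ : ρ ≤ κ * X) (hρ' : ρ' ≤ κ * Y) :
    X - Y ≤ κ ^ 3 * (ρ - ρ') := by
  refine le_of_mul_le_mul_right ?_ hXY
  calc (X - Y) * (X + Y) = X ^ 2 - Y ^ 2 := by ring
    _ ≤ κ ^ 2 * (ρ ^ 2 - ρ' ^ 2) := h
    _ = κ ^ 2 * (ρ - ρ') * (ρ + ρ') := by ring
    _ ≤ κ ^ 2 * (ρ - ρ') * (κ * X + κ * Y) :=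
      mul_le_mul_of_nonneg_left (add_le_add hρ hρ') (mul_nonneg (sq_nonneg κ) (sub_nonneg.2 hρρ'))
    _ = κ ^ 3 * (ρ - ρ') * (X + Y) := by ring

lemma IsQuasiQuadratic.exists_quadratic_comparison {f : ℝ → ℝ} {a b c p q : ℝ}
    (hf : IsQuasiQuadratic f a b c) (hp : p ∈ Ioo a c) (hq : q ∈ Ioo c b) :
    ∃ κ ≥ 1, ∀ x ∈ Icc p q, ∀ y ∈ uIcc c x,
      (x - c) ^ 2 - (y - c) ^ 2 ≤ κ ^ 2 * (|f x - f c| - |f y - f c|) ∧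
      |f x - f c| - |f y - f c| ≤ κ ^ 2 * ((x - c) ^ 2 - (y - c) ^ 2) := by
  obtain ⟨m, M, hm, hM, hbounds⟩ := hf.exists_quadratic_bounds hp hq
  have hm_inv : 0 < m⁻¹ := inv_pos.2 hm
  set κ := 1 + M + m⁻¹
  have hκ_sq : κ ≤ κ ^ 2 := le_self_pow₀ (by linarith) two_ne_zero
  refine ⟨κ, by linarith, fun x hx y hy => ?_⟩
  have hsq : 0 ≤ (x - c) ^ 2 - (y - c) ^ 2 := by
    rw [sub_nonneg, sq_le_sq]
    exact abs_sub_left_of_mem_uIcc hy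
  obtain ⟨hlower, hupper⟩ := hbounds x hx y hy
  refine ⟨?_, hupper.trans (by gcongr; linarith)⟩
  calc (x - c) ^ 2 - (y - c) ^ 2 = m⁻¹ * (m * ((x - c) ^ 2 - (y - c) ^ 2)) := by
        rw [inv_mul_cancel_left₀ hm.ne']
    _ ≤ m⁻¹ * (|f x - f c| - |f y - f c|) := by gcongr
    _ ≤ κ ^ 2 * (|f x - f c| - |f y - f c|) := by
      have := (mul_nonneg hm.le hsq).trans hlower
      gcongr
      linarith

end QuadraticComparison

/-- The radius of `I^n` in a coordinate around `c` in which `f` is exactly quadratic. -/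
noncomputable def radius (f : ℝ → ℝ) (c : ℝ) (l : ℕ → ℝ) (n : ℕ) : ℝ := √|f (l n) - f c|

/-- Two sequences of lengths are comparable with constant `A`, and so are their consecutive
differences. -/
structure ComparableGaps (A : ℝ) (d ρ : ℕ → ℝ) : Prop where
  le : ∀ n, d n ≤ A * ρ n
  ge : ∀ n, ρ n ≤ A * d n
  gap_le : ∀ n, d n - d (n + 1) ≤ A * (ρ n - ρ (n + 1))
  gap_ge : ∀ n, ρ n - ρ (n + 1) ≤ A * (d n - d (n + 1))

lemma ComparableGaps.of_sq {κ : ℝ} {d ρ : ℕ → ℝ} (hκ : 1 ≤ κ) (hd : ∀ n, 0 < d n)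
    (hd_lt : ∀ n, d (n + 1) < d n) (hρ : ∀ n, 0 < ρ n) (hρ_lt : ∀ n, ρ (n + 1) < ρ n)
    (hsq : ∀ n, d n ^ 2 ≤ κ ^ 2 * ρ n ^ 2 ∧ ρ n ^ 2 ≤ κ ^ 2 * d n ^ 2)
    (hgap : ∀ n, d n ^ 2 - d (n + 1) ^ 2 ≤ κ ^ 2 * (ρ n ^ 2 - ρ (n + 1) ^ 2) ∧
      ρ n ^ 2 - ρ (n + 1) ^ 2 ≤ κ ^ 2 * (d n ^ 2 - d (n + 1) ^ 2)) :
    ComparableGaps (κ ^ 3) d ρ := by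
  have hκ_nonneg : 0 ≤ κ := zero_le_one.trans hκ
  have hcube : κ ≤ κ ^ 3 := le_self_pow₀ hκ three_ne_zero
  simp only [← mul_pow] at hsq
  have hle := fun n => le_of_sq_le_sq (hsq n).1 (mul_nonneg hκ_nonneg (hρ n).le)
  have hge := fun n => le_of_sq_le_sq (hsq n).2 (mul_nonneg hκ_nonneg (hd n).le)
  exact ⟨fun n => (hle n).trans (mul_le_mul_of_nonneg_right hcube (hρ n).le),
    fun n => (hge n).trans (mul_le_mul_of_nonneg_right hcube (hd n).le),
    fun n => sub_le_cube_mul_sub (add_pos (hd _) (hd _)) (hρ_lt n).le (hgap n).1 (hge _) (hge _),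
    fun n => sub_le_cube_mul_sub (add_pos (hρ _) (hρ _)) (hd_lt n).le (hgap n).2 (hle _) (hle _)⟩

/-- The lengths in the principal nest are comparable with the radii. -/
structure Comparable (f : ℝ → ℝ) (c : ℝ) (l u : ℕ → ℝ) (A : ℝ) : Prop where
  one_le : 1 ≤ A
  left : ComparableGaps A (fun n => c - l n) (radius f c l)
  right : ComparableGaps A (fun n => u n - c) (radius f c l)

variable {f : ℝ → ℝ} {a b c : ℝ} {J : Set ℝ} {l u : ℕ → ℝ} {r : ℕ → ℕ}

lemma sq_radius (n : ℕ) : radius f c l n ^ 2 = |f (l n) - f c| := Real.sq_sqrt (abs_nonneg _)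

lemma IsQuasiQuadratic.abs_apply_sub_lt (hf : IsQuasiQuadratic f a b c) {x y : ℝ} (hx : a ≤ x)
    (hxy : x < y) (hy : y ≤ c) : |f y - f c| < |f x - f c| := by
  have hxI : x ∈ Icc a c := ⟨hx, hxy.le.trans hy⟩
  have hyI : y ∈ Icc a c := ⟨hx.trans hxy.le, hy⟩
  have hcI : c ∈ Icc a c := right_mem_Icc.2 hf.crit_mem.1.le
  rcases hf.unimodal with ⟨hmono, -⟩ | ⟨hanti, -⟩
  · have hyc := hmono.monotoneOn hyI hcI hy
    have hxy' := hmono hxI hyI hxy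
    rw [abs_of_nonpos (sub_nonpos.2 hyc), abs_of_neg (sub_neg.2 (hxy'.trans_le hyc))]
    linarith
  · have hyc := hanti.antitoneOn hyI hcI hy
    have hxy' := hanti hxI hyI hxy
    rw [abs_of_nonneg (sub_nonneg.2 hyc), abs_of_pos (sub_pos.2 (hyc.trans_lt hxy'))]
    linarith

namespace NestData

lemma left_mem_Icc (D : NestData f a b c J l u r) (n : ℕ) : l n ∈ Icc a b :=
  Ioo_subset_Icc_self ((D.isNice n).subset (Set.left_mem_Icc.2 (D.lt n).le))

lemma radius_lt (D : NestData f a b c J l u r) (hf : IsQuasiQuadratic f a b c) (n : ℕ) :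
    radius f c l (n + 1) < radius f c l n :=
  Real.sqrt_lt_sqrt (abs_nonneg _)
    (hf.abs_apply_sub_lt (D.left_mem_Icc n).1 (D.lt_left n) (D.crit_mem _).1.le)

lemma radius_pos (D : NestData f a b c J l u r) (hf : IsQuasiQuadratic f a b c) (n : ℕ) :
    0 < radius f c l n :=
  (Real.sqrt_nonneg _).trans_lt (D.radius_lt hf n)

lemma exists_comparable (D : NestData f a b c J l u r) (hf : IsQuasiQuadratic f a b c) :
    ∃ A, Comparable f c l u A := by
  obtain ⟨κ, hκ, hquad⟩ := hf.exists_quadratic_comparison (D.isNice 0).left_mem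
    (D.isNice 0).right_mem
  have hl : ∀ n, l n ∈ Icc (l 0) (u 0) := fun n =>
    ⟨D.monotone_l n.zero_le, (D.lt n).le.trans (D.antitone_u n.zero_le)⟩
  have hu : ∀ n, u n ∈ Icc (l 0) (u 0) := fun n =>
    ⟨(D.monotone_l n.zero_le).trans (D.lt n).le, D.antitone_u n.zero_le⟩
  refine ⟨κ ^ 3, one_le_pow₀ hκ,
    .of_sq hκ (fun n => sub_pos.2 (D.crit_mem n).1) (fun n => sub_lt_sub_left (D.lt_left n) c)
      (D.radius_pos hf) (D.radius_lt hf) (fun n => ?_) (fun n => ?_),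
    .of_sq hκ (fun n => sub_pos.2 (D.crit_mem n).2) (fun n => sub_lt_sub_right (D.lt_right n) c)
      (D.radius_pos hf) (D.radius_lt hf) (fun n => ?_) (fun n => ?_)⟩ <;>
    simp only [sq_radius, sub_sq_comm c]
  · simpa only [sub_self, abs_zero, ne_eq, OfNat.ofNat_ne_zero, not_false_eq_true, zero_pow,
      sub_zero] using hquad (l n) (hl n) c left_mem_uIcc
  · exact hquad (l n) (hl n) _ (mem_uIcc.2 (.inr ⟨(D.lt_left n).le, (D.crit_mem _).1.le⟩))
  · simpa only [(D.isNice n).symm, sub_self, abs_zero, ne_eq, OfNat.ofNat_ne_zero,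
      not_false_eq_true, zero_pow, sub_zero] using hquad (u n) (hu n) c left_mem_uIcc
  · simp only [(D.isNice _).symm]
    exact hquad (u n) (hu n) _ (mem_uIcc.2 (.inl ⟨(D.crit_mem _).2.le, (D.lt_right n).le⟩))

lemma sq_radius_lt (D : NestData f a b c J l u r) (hf : IsQuasiQuadratic f a b c) (n : ℕ) :
    radius f c l (n + 1) ^ 2 < radius f c l n ^ 2 :=
  pow_lt_pow_left₀ (D.radius_lt hf n) (D.radius_pos hf _).le two_ne_zero

lemma branch_ends_notMem (D : NestData f a b c J l u r) (hf : IsQuasiQuadratic f a b c) {n : ℕ}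
    {x y : ℝ} (hB : IsBranch f a b c (r n - 1) x y (l n) (u n)) (hc : f c ∈ Ioo x y) (i : ℕ)
    {e : ℝ} (he : e ∈ ({x, y} : Set ℝ)) : f^[i] e ∉ Ioo (l n) (u n) := by
  refine (D.isNice n).branch_ends_notMem hf hB hc (i₀ := 0) (fun i _ hi => ?_) i.zero_le he
  rw [← Function.iterate_succ_apply]
  exact D.notMem_of_lt (by omega) (by omega)

lemma exists_ordered_branch_ends (D : NestData f a b c J l u r) (hf : IsQuasiQuadratic f a b c)
    {n : ℕ} {lam₁ lam₂ ξ₁ ξ₂ : ℝ} (hξ₁ : ξ₁ < lam₁) (hlam : f c ∈ Ioo lam₁ lam₂) (hξ₂ : lam₂ < ξ₂)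
    (hends : ∀ e ∈ ({lam₁, lam₂} : Set ℝ), f^[r (n + 1) - 1] e ∉ Ioo (l (n + 1)) (u (n + 1)))
    {s : ℕ} (hB : IsBranch f a b c s ξ₁ ξ₂ (l n) (u n)) :
    (f (l (n + 1)) ≤ ξ₁ ∧ lam₁ ≤ f (l (n + 2)) ∧ f (l (n + 2)) < f c) ∨
      (f c < f (l (n + 2)) ∧ f (l (n + 2)) ≤ lam₂ ∧ ξ₂ ≤ f (l (n + 1))) := by
  obtain ⟨x, y, hcx, hJ, he, -⟩ := (D.central n).exists_branch
  obtain ⟨x', y', hcx', hJ', he', -⟩ := (D.central (n + 1)).exists_branch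
  have hξ := hB.ends_mem_Icc hf ⟨hξ₁.trans hlam.1, hlam.2.trans hξ₂⟩ hcx
    (D.branch_ends_notMem hf hJ hcx s (mem_insert _ _))
    (D.branch_ends_notMem hf hJ hcx s (mem_insert_of_mem _ rfl))
  have hlam' := hJ'.ends_mem_Icc hf hcx' hlam (hends _ (mem_insert _ _))
    (hends _ (mem_insert_of_mem _ rfl))
  have hne : ∀ k, l k ≠ c := fun k => (D.crit_mem k).1.ne
  rcases hf.critical_value_extremal with h | h
  · have hlt := fun k => h _ (D.left_mem_Icc k) (hne k)
    rw [he.resolve_right fun h => (hlt (n + 1)).not_gt (h ▸ hcx.2),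
      he'.resolve_right fun h => (hlt (n + 2)).not_gt (h ▸ hcx'.2)]
    exact .inl ⟨hξ.1, hlam'.1, hcx'.1⟩
  · have hlt := fun k => h _ (D.left_mem_Icc k) (hne k)
    rw [he.resolve_left fun h => (hlt (n + 1)).not_gt (h ▸ hcx.1),
      he'.resolve_left fun h => (hlt (n + 2)).not_gt (h ▸ hcx'.1)]
    exact .inr ⟨hcx'.2, hlam'.2, hξ.2⟩

/-- The hypotheses say that `f c ∈ J(n+1) ⊆ (lam₁, lam₂) ⊆ (ξ₁, ξ₂) ⊆ J(n)`, where `J(k)` is the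
pull-back of `I^k` around the critical value along its first return. -/
lemma sq_radius_le (D : NestData f a b c J l u r) (hf : IsQuasiQuadratic f a b c) {n : ℕ}
    {lam₁ lam₂ ξ₁ ξ₂ : ℝ} (hξ₁ : ξ₁ < lam₁) (hlam : f c ∈ Ioo lam₁ lam₂) (hξ₂ : lam₂ < ξ₂)
    (hends : ∀ e ∈ ({lam₁, lam₂} : Set ℝ), f^[r (n + 1) - 1] e ∉ Ioo (l (n + 1)) (u (n + 1)))
    {s : ℕ} (hB : IsBranch f a b c s ξ₁ ξ₂ (l n) (u n)) :
    radius f c l (n + 1) ^ 2 ≤ (radius f c l (n + 1) ^ 2 - radius f c l (n + 2) ^ 2) *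
      crossRatio ξ₁ lam₁ lam₂ ξ₂ := by
  rw [sq_radius, sq_radius]
  rcases D.exists_ordered_branch_ends hf hξ₁ hlam hξ₂ hends hB with ⟨hx, hx', hc⟩ | ⟨hc, hy', hy⟩
  · have key := add_le_mul_crossRatio (w₂ := lam₂) (w₃ := ξ₂) hξ₁.ne'
      (show |lam₁ - ξ₁| ≤ f (l (n + 2)) - f (l (n + 1)) by
        rw [abs_of_pos (sub_pos.2 hξ₁)]; linarith)
    rw [abs_of_pos (sub_pos.2 (hlam.1.trans hlam.2))] at key
    rw [abs_of_neg (by linarith [hlam.1]), abs_of_neg (sub_neg.2 hc)]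
    linarith [hlam.2]
  · have key := add_le_mul_crossRatio (w₂ := lam₁) (w₃ := ξ₁) hξ₂.ne
      (show |lam₂ - ξ₂| ≤ f (l (n + 1)) - f (l (n + 2)) by
        rw [abs_of_neg (sub_neg.2 hξ₂)]; linarith)
    rw [abs_of_neg (sub_neg.2 (hlam.1.trans hlam.2)), crossRatio_reverse] at key
    rw [abs_of_pos (by linarith [hlam.2]), abs_of_pos (sub_pos.2 hc)]
    linarith [hlam.1]

lemma exists_extended_branch (D : NestData f a b c J l u r) (hf : IsQuasiQuadratic f a b c)
    (n : ℕ) : ∃ x y, f c ∈ Ioo x y ∧ IsBranch f a b c (r (n + 1) - 1) x y (l n) (u n) := by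
  refine D.exists_branch_of_notMem hf (hf.mapsTo (Ioo_subset_Icc_self hf.crit_mem)) ?_
    fun i hi => ?_
  · rw [iterate_pred_apply (D.one_le_r _)]
    exact D.Ioo_subset n.le_succ (D.first (n + 1)).2.1
  · rw [← Function.iterate_succ_apply]
    exact D.notMem_of_lt (by omega) (by omega)

lemma sq_radius_le_crossRatio (D : NestData f a b c J l u r) (hf : IsQuasiQuadratic f a b c)
    (n : ℕ) :
    radius f c l (n + 1) ^ 2 ≤ (radius f c l (n + 1) ^ 2 - radius f c l (n + 2) ^ 2) *
      crossRatio (l n) (l (n + 1)) (u (n + 1)) (u n) := by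
  obtain ⟨ξ₁, ξ₂, hc, hB⟩ := D.exists_extended_branch hf n
  obtain ⟨x, y, hx, -, hy, hB', hcross, hmem⟩ := hB.exists_restrict hf (D.lt_left n)
    (D.lt (n + 1)) (D.lt_right n)
  have hc' : f c ∈ Ioo x y :=
    hmem _ hc (by rw [iterate_pred_apply (D.one_le_r _)]; exact (D.first (n + 1)).2.1)
  calc radius f c l (n + 1) ^ 2
      ≤ (radius f c l (n + 1) ^ 2 - radius f c l (n + 2) ^ 2) * crossRatio ξ₁ x y ξ₂ :=
        D.sq_radius_le hf hx hc' hy (fun e he => D.branch_ends_notMem hf hB' hc' _ he) hB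
    _ ≤ _ := mul_le_mul_of_nonneg_left hcross (sub_nonneg.2 (D.sq_radius_lt hf (n + 1)).le)

end NestData

end QuadraticCriticalPoint

section RealBounds

lemma exists_pos_le_of_dichotomy {e : ℕ → ℝ} {κ : ℝ} (hκ : 0 < κ) (h0 : 0 < e 0)
    (hstep : ∀ θ > 0, ∃ η > 0, ∀ n, θ ≤ e n → η ≤ e (n + 1))
    (hdich : ∀ n, e n ≤ e (n + 1) ∨ κ ≤ e (n + 1) ∨ κ ≤ e (n + 2)) :
    ∃ δ > 0, ∀ n, δ ≤ e n := by
  set θ := min κ (e 0)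
  have hθ : 0 < θ := lt_min hκ h0
  have hκθ : θ ≤ κ := min_le_left _ _
  obtain ⟨η, hη, hη_le⟩ := hstep θ hθ
  have hlarge : ∀ n, θ ≤ e n ∨ θ ≤ e (n + 1) := by
    intro n
    induction n with
    | zero => exact .inl (min_le_right _ _)
    | succ n ih =>
      rcases ih with hn | hn
      · exact (hdich n).elim (fun h => .inl (hn.trans h)) (.imp hκθ.trans hκθ.trans)
      · exact .inl hn
  refine ⟨min θ η, lt_min hθ hη, fun n => ?_⟩
  cases n with
  | zero => exact (min_le_left _ _).trans (min_le_right _ _)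
  | succ n =>
    exact (hlarge n).elim (fun h => (min_le_right _ _).trans (hη_le n h)) (min_le_left _ _).trans

variable {f : ℝ → ℝ} {a b c A : ℝ} {J : Set ℝ} {l u : ℕ → ℝ} {r : ℕ → ℕ} {n : ℕ} {ξ ξ' : ℝ}

lemma IsBranch.ends_of_lt {t : ℕ} {x y x' y' α β α' β' z : ℝ}
    (h : IsBranch f a b c t x y α β) (h' : IsBranch f a b c t x' y' α' β')
    (hf : IsQuasiQuadratic f a b c) (hz : z ∈ Ioo x y) (hz' : z ∈ Ioo x' y') (hα : α < α')
    (hβ : β' < β) :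
    x < x' ∧ y' < y ∧
      ((f^[t] x = α ∧ f^[t] x' = α' ∧ f^[t] y' = β' ∧ f^[t] y = β) ∨
        (f^[t] x = β ∧ f^[t] x' = β' ∧ f^[t] y' = α' ∧ f^[t] y = α)) := by
  have hout : ∀ e, f^[t] e = α ∨ f^[t] e = β → f^[t] e ∉ Ioo α' β' := by
    rintro e (he | he) ⟨h₁, h₂⟩ <;> linarith
  obtain ⟨hx, hy⟩ := h'.ends_mem_Icc hf hz' hz (hout x (h.ends.imp And.left And.left))
    (hout y (h.ends.symm.imp And.right And.right))
  have hαβ' := h'.lt_image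
  have hxI := left_mem_Icc.2 h.lt.le
  have hyI := right_mem_Icc.2 h.lt.le
  have hxI' : x' ∈ Icc x y := ⟨hx, h'.lt.le.trans hy⟩
  have hyI' : y' ∈ Icc x y := ⟨hx.trans h'.lt.le, hy⟩
  rcases h.strictMonoOn_or_strictAntiOn hf with ⟨m, ex, ey⟩ | ⟨m, ex, ey⟩
  · obtain ⟨ex', ey'⟩ := h'.ends.resolve_right fun e => by linarith [m hxI' hyI' h'.lt]
    exact ⟨(m.lt_iff_lt hxI hxI').1 (by linarith), (m.lt_iff_lt hyI' hyI).1 (by linarith),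
      .inl ⟨ex, ex', ey', ey⟩⟩
  · obtain ⟨ex', ey'⟩ := h'.ends.resolve_left fun e => by linarith [m hxI' hyI' h'.lt]
    exact ⟨(m.lt_iff_gt hxI' hxI).1 (by linarith), (m.lt_iff_gt hyI hyI').1 (by linarith),
      .inr ⟨ex, ex', ey', ey⟩⟩

/-- `ξ` and `ξ'` bound the pull-back of `I^n` along the first return of the critical value to
`I^{n+1}`, with `ξ` on the side of the points `f (l k)`; it lies inside the pull-back of `I^n` along
the first return to `I^n`, which `f (l (n + 1))` bounds. -/
structure IsReturnFrame (f : ℝ → ℝ) (a b c : ℝ) (l u : ℕ → ℝ) (r : ℕ → ℕ) (n : ℕ) (ξ ξ' : ℝ) :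
    Prop where
  branch : IsBranch f a b c (r (n + 1) - 1) (ξ ⊓ ξ') (ξ ⊔ ξ') (l n) (u n)
  ordered : Ordered ξ (f (l (n + 2))) (f c) ξ'
  ordered' : Ordered (f (l (n + 2))) (f (l (n + 3))) (f c) ξ'
  abs_sub_le : |f (l (n + 2)) - ξ| ≤ |f (l (n + 1)) - f c| - |f (l (n + 2)) - f c|
  images : (f^[r (n + 1) - 1] ξ = l n ∧ f^[r (n + 1) - 1] (f (l (n + 2))) = l (n + 1) ∧
      f^[r (n + 1) - 1] ξ' = u n) ∨
    (f^[r (n + 1) - 1] ξ = u n ∧ f^[r (n + 1) - 1] (f (l (n + 2))) = u (n + 1) ∧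
      f^[r (n + 1) - 1] ξ' = l n)

lemma Ordered.abs_sub_eq {w₀ w₁ w₂ w₃ : ℝ} (h : Ordered w₀ w₁ w₂ w₃) :
    |w₁ - w₀| = |w₀ - w₂| - |w₁ - w₂| := by
  rcases h with ⟨h₁, h₂, -⟩ | ⟨-, h₂, h₁⟩
  · rw [abs_of_pos (sub_pos.2 h₁), abs_of_neg (sub_neg.2 (h₁.trans h₂)),
      abs_of_neg (sub_neg.2 h₂)]
    ring
  · rw [abs_of_neg (sub_neg.2 h₁), abs_of_pos (sub_pos.2 (h₂.trans h₁)),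
      abs_of_pos (sub_pos.2 h₂)]
    ring

lemma sq_radius_le_mul_crossRatio {k : ℕ} {w w' : ℝ} (ho : Ordered w (f (l (k + 1))) (f c) w')
    (h : |f (l (k + 1)) - w| ≤ |f (l k) - f c| - |f (l (k + 1)) - f c|) :
    radius f c l k ^ 2 ≤ (radius f c l k ^ 2 - radius f c l (k + 1) ^ 2) *
      crossRatio w (f (l (k + 1))) (f c) w' := by
  have key := add_le_mul_crossRatio (w₂ := f c) (w₃ := w')
    (by rcases ho with ho | ho; exacts [ho.1.ne', ho.2.2.ne]) h
  rw [abs_sub_comm (f c)] at key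
  rw [sq_radius, sq_radius]
  linarith

lemma IsBranch.sq_radius_le {t k : ℕ} {x y α β w w' d : ℝ} (hB : IsBranch f a b c t x y α β)
    (hf : IsQuasiQuadratic f a b c) (ho : Ordered w (f (l (k + 1))) (f c) w') (hw : w ∈ Icc x y)
    (hw' : w' ∈ Icc x y)
    (hle : |f (l (k + 1)) - w| ≤ |f (l k) - f c| - |f (l (k + 1)) - f c|)
    (hlt : radius f c l (k + 1) ^ 2 ≤ radius f c l k ^ 2) (hA : 0 < A) (hd : 0 < d)
    (hmid : |f^[t] (f c) - f^[t] (f (l (k + 1)))| ≤ A * d)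
    (hleft : d / A ≤ |f^[t] (f (l (k + 1))) - f^[t] w|)
    (hright : d / A ≤ |f^[t] w' - f^[t] (f c)|) :
    radius f c l k ^ 2 ≤ (radius f c l k ^ 2 - radius f c l (k + 1) ^ 2) * (1 + A ^ 2) ^ 2 := by
  refine (sq_radius_le_mul_crossRatio ho hle).trans
    (mul_le_mul_of_nonneg_left ?_ (sub_nonneg.2 hlt))
  refine ((hB.crossRatio_le hf ho hw hw').trans
    (crossRatio_le_of_le (div_pos hd hA) (div_pos hd hA) hmid hleft hright)).trans_eq ?_
  field_simp

namespace NestData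

lemma apply_left_lt_or_gt (D : NestData f a b c J l u r) (hf : IsQuasiQuadratic f a b c) :
    (∀ n, f (l n) < f (l (n + 1)) ∧ f (l n) < f c) ∨
      ∀ n, f (l (n + 1)) < f (l n) ∧ f c < f (l n) := by
  have hl : ∀ n, l n ∈ Icc a c := fun n => ⟨(D.left_mem_Icc n).1, (D.crit_mem n).1.le⟩
  have hc : c ∈ Icc a c := right_mem_Icc.2 hf.crit_mem.1.le
  refine hf.unimodal.imp (fun hm n => ?_) (fun hm n => ?_)
  exacts [⟨hm.1 (hl n) (hl _) (D.lt_left n), hm.1 (hl n) hc (D.crit_mem n).1⟩,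
    ⟨hm.1 (hl n) (hl _) (D.lt_left n), hm.1 (hl n) hc (D.crit_mem n).1⟩]

lemma exists_isReturnFrame (D : NestData f a b c J l u r) (hf : IsQuasiQuadratic f a b c)
    (n : ℕ) : ∃ ξ ξ', IsReturnFrame f a b c l u r n ξ ξ' := by
  obtain ⟨x₀, y₀, hc₀, hJ₀, he₀, -⟩ := (D.central n).exists_branch
  obtain ⟨x₁, y₁, hc₁, hJ₁, he₁, -⟩ := (D.central (n + 1)).exists_branch
  obtain ⟨ξ₁, ξ₂, hcξ, hB⟩ := D.exists_extended_branch hf n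
  obtain ⟨hx₀, hy₀⟩ := hB.ends_mem_Icc hf hcξ hc₀
    (D.branch_ends_notMem hf hJ₀ hc₀ _ (mem_insert _ _))
    (D.branch_ends_notMem hf hJ₀ hc₀ _ (mem_insert_of_mem _ rfl))
  obtain ⟨hx₁, hy₁, himages⟩ := hB.ends_of_lt hJ₁ hf hcξ hc₁ (D.lt_left n) (D.lt_right n)
  rcases D.apply_left_lt_or_gt hf with hl | hl
  · obtain rfl := he₀.resolve_right fun e => by linarith [(hl (n + 1)).2, hc₀.2]
    obtain rfl := he₁.resolve_right fun e => by linarith [(hl (n + 2)).2, hc₁.2]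
    refine ⟨ξ₁, ξ₂, ?_, .inl ⟨hx₁, hc₁.1, hcξ.2⟩, .inl ⟨(hl _).1, (hl _).2, hcξ.2⟩, ?_, ?_⟩
    · rwa [inf_of_le_left hB.lt.le, sup_of_le_right hB.lt.le]
    · rw [abs_of_pos (sub_pos.2 hx₁), abs_of_neg (sub_neg.2 (hl _).2),
        abs_of_neg (sub_neg.2 (hl _).2)]
      linarith
    · exact himages.imp (fun h => ⟨h.1, h.2.1, h.2.2.2⟩) fun h => ⟨h.1, h.2.1, h.2.2.2⟩
  · obtain rfl := he₀.resolve_left fun e => by linarith [(hl (n + 1)).2, hc₀.1]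
    obtain rfl := he₁.resolve_left fun e => by linarith [(hl (n + 2)).2, hc₁.1]
    refine ⟨ξ₂, ξ₁, ?_, .inr ⟨hcξ.1, hc₁.2, hy₁⟩, .inr ⟨hcξ.1, (hl _).2, (hl _).1⟩, ?_, ?_⟩
    · rwa [inf_of_le_right hB.lt.le, sup_of_le_left hB.lt.le]
    · rw [abs_of_neg (sub_neg.2 hy₁), abs_of_pos (sub_pos.2 (hl _).2),
        abs_of_pos (sub_pos.2 (hl _).2)]
      linarith
    · exact himages.symm.imp (fun h => ⟨h.2.2.2, h.2.2.1, h.1⟩) fun h => ⟨h.2.2.2, h.2.2.1, h.1⟩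

lemma mapsTo_gap (D : NestData f a b c J l u r) (hf : IsQuasiQuadratic f a b c) {x y : ℝ}
    (hB : IsBranch f a b c (r (n + 2) - 1) x y (l (n + 2)) (u (n + 2))) (hc : f c ∈ Ioo x y) :
    MapsTo f^[r (n + 1) - 1] (Icc x y) (Icc (l (n + 1)) (l (n + 2))) ∨
      MapsTo f^[r (n + 1) - 1] (Icc x y) (Icc (u (n + 2)) (u (n + 1))) := by
  have hr : r (n + 1) < r (n + 2) := D.r_lt (n + 1)
  have hr₁ := D.one_le_r (n + 1)
  obtain ⟨x₁, y₁, hc₁, hJ₁, -, -⟩ := (D.central (n + 1)).exists_branch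
  have hsub : Icc x y ⊆ Icc x₁ y₁ := by
    have hout : ∀ e ∈ ({x₁, y₁} : Set ℝ), f^[r (n + 2) - 1] e ∉ Ioo (l (n + 2)) (u (n + 2)) :=
      fun e he h => D.branch_ends_notMem hf hJ₁ hc₁ _ he (D.Ioo_subset (n + 1).le_succ h)
    obtain ⟨hx, hy⟩ := hB.ends_mem_Icc hf hc hc₁ (hout _ (mem_insert _ _))
      (hout _ (mem_insert_of_mem _ rfl))
    exact Icc_subset_Icc hx hy
  have hmem : MapsTo f^[r (n + 1) - 1] (Icc x y) (Icc (l (n + 1)) (u (n + 1))) :=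
    (hJ₁.mapsTo_Icc hf).mono_left hsub
  have hout : ∀ w ∈ Icc x y, f^[r (n + 1) - 1] w ∉ Ioo (l (n + 2)) (u (n + 2)) := fun w hw =>
    hB.iterate_notMem_Ioo hf (by omega) hc
      (by rw [iterate_pred_apply hr₁]; exact D.return_notMem (n + 1))
      ((D.isNice (n + 2)).nice_ends _ (mem_insert _ _))
      ((D.isNice (n + 2)).nice_ends _ (mem_insert_of_mem _ rfl)) hw
  obtain ⟨hlc, hcu⟩ := D.crit_mem (n + 2)
  refine (mapsTo_Iic_or_Ici_of_ne hB.lt (hB.continuousOn_iterate hf _) (v := c) fun w hw e =>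
    hout w (Ioo_subset_Icc_self hw) (e ▸ ⟨hlc, hcu⟩)).imp (fun hle w hw => ?_) fun hge w hw => ?_
  · exact ⟨(hmem hw).1, le_of_not_gt fun h => hout w hw ⟨h, (hle hw).trans_lt hcu⟩⟩
  · exact ⟨le_of_not_gt fun h => hout w hw ⟨hlc.trans_le (hge hw), h⟩, (hmem hw).2⟩

lemma iterate_mem_gap (D : NestData f a b c J l u r) (hf : IsQuasiQuadratic f a b c) (n : ℕ) :
    (f^[r (n + 1) - 1] (f c) ∈ Icc (l (n + 1)) (l (n + 2)) ∧
      f^[r (n + 1) - 1] (f (l (n + 3))) ∈ Icc (l (n + 1)) (l (n + 2))) ∨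
    (f^[r (n + 1) - 1] (f c) ∈ Icc (u (n + 2)) (u (n + 1)) ∧
      f^[r (n + 1) - 1] (f (l (n + 3))) ∈ Icc (u (n + 2)) (u (n + 1))) := by
  obtain ⟨x, y, hc, hB, he, -⟩ := (D.central (n + 2)).exists_branch
  have hcI := Ioo_subset_Icc_self hc
  have hl : f (l (n + 3)) ∈ Icc x y := by
    rcases he with he | he
    exacts [he.symm ▸ Set.left_mem_Icc.2 hB.lt.le, he.symm ▸ right_mem_Icc.2 hB.lt.le]
  exact (D.mapsTo_gap hf hB hc).imp (fun h => ⟨h hcI, h hl⟩) fun h => ⟨h hcI, h hl⟩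

/-- With `g` the branch of the first return to `I^{n+1}` on the frame, a low return, where `g (f c)`
lies on the side of `g (f (l (n + 2)))`, bounds the gap after `I^{n+1}` from below, and a high
return the one after `I^{n+2}`. -/
lemma sq_radius_le_of_gap_le (D : NestData f a b c J l u r) (hf : IsQuasiQuadratic f a b c)
    (hA : Comparable f c l u A)
    (hgap : radius f c l (n + 1) - radius f c l (n + 2) ≤ radius f c l n - radius f c l (n + 1))
    (hrad : radius f c l (n + 1) - radius f c l (n + 2) ≤ radius f c l (n + 2)) :
    ∃ k, (k = n + 1 ∨ k = n + 2) ∧ radius f c l k ^ 2 ≤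
      (radius f c l k ^ 2 - radius f c l (k + 1) ^ 2) * (1 + A ^ 2) ^ 2 := by
  obtain ⟨ξ, ξ', hframe⟩ := D.exists_isReturnFrame hf n
  set d := radius f c l (n + 1) - radius f c l (n + 2)
  have hA_pos : 0 < A := one_pos.trans_le hA.one_le
  have hd : 0 < d := sub_pos.2 (D.radius_lt hf (n + 1))
  have hlen : ∀ {v}, d ≤ A * v → d / A ≤ v := (div_le_iff₀' hA_pos).2
  have hl₀ : d / A ≤ l (n + 1) - l n := by linarith [hlen (hgap.trans (hA.left.gap_ge n))]
  have hu₀ : d / A ≤ u n - u (n + 1) := by linarith [hlen (hgap.trans (hA.right.gap_ge n))]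
  have hl₂ : d / A ≤ c - l (n + 2) := hlen (hrad.trans (hA.left.ge (n + 2)))
  have hu₂ : d / A ≤ u (n + 2) - c := hlen (hrad.trans (hA.right.ge (n + 2)))
  have hl₁ : l (n + 2) - l (n + 1) ≤ A * d := by linarith [hA.left.gap_le (n + 1)]
  have hu₁ : u (n + 1) - u (n + 2) ≤ A * d := by linarith [hA.right.gap_le (n + 1)]
  obtain ⟨hlc, hcu⟩ := D.crit_mem (n + 1)
  have hdA : 0 < d / A := div_pos hd hA_pos
  have hl := (D.lt_left (n + 1)).le
  have hu := (D.lt_right (n + 1)).le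
  have hlow := hframe.branch.sq_radius_le hf hframe.ordered left_mem_uIcc right_mem_uIcc
    hframe.abs_sub_le (D.sq_radius_lt hf (n + 1)).le hA_pos hd
  have hhigh := hframe.branch.sq_radius_le hf hframe.ordered' hframe.ordered.mem_uIcc.1
    right_mem_uIcc hframe.ordered'.abs_sub_eq.le (D.sq_radius_lt hf (n + 2)).le hA_pos hd
  rcases hframe.images with ⟨e₀, e₁, e₂⟩ | ⟨e₀, e₁, e₂⟩ <;> rw [e₀, e₁, e₂] at hlow <;>
    rw [e₁, e₂] at hhigh <;>
    rcases D.iterate_mem_gap hf n with ⟨hfc, hl₃⟩ | ⟨hfc, hl₃⟩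
  · exact ⟨n + 1, .inl rfl, hlow ((Real.dist_le_of_mem_Icc hfc (Set.left_mem_Icc.2 hl)).trans hl₁)
      (le_abs.2 (.inl hl₀)) (le_abs.2 (.inl (by linarith [hfc.2])))⟩
  · exact ⟨n + 2, .inr rfl, hhigh ((Real.dist_le_of_mem_Icc hfc hl₃).trans hu₁)
      (le_abs.2 (.inl (by linarith [hl₃.1]))) (le_abs.2 (.inl (by linarith [hfc.2])))⟩
  · exact ⟨n + 2, .inr rfl, hhigh ((Real.dist_le_of_mem_Icc hfc hl₃).trans hl₁)
      (le_abs.2 (.inr (by linarith [hl₃.2]))) (le_abs.2 (.inr (by linarith [hfc.1])))⟩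
  · exact ⟨n + 1, .inl rfl, hlow ((Real.dist_le_of_mem_Icc hfc (right_mem_Icc.2 hu)).trans hu₁)
      (le_abs.2 (.inr (by linarith))) (le_abs.2 (.inr (by linarith [hfc.1])))⟩

end NestData

/-- The length, measured by the radii, of the gap between `I^n` and `I^{n+1}` relative to `I^n`; it
is bounded away from `0` exactly if the scaling factors are bounded away from `1`. -/
noncomputable def relativeGap (f : ℝ → ℝ) (c : ℝ) (l : ℕ → ℝ) (n : ℕ) : ℝ :=
  (radius f c l n - radius f c l (n + 1)) / radius f c l n

namespace NestData

lemma relativeGap_pos (D : NestData f a b c J l u r) (hf : IsQuasiQuadratic f a b c) (n : ℕ) :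
    0 < relativeGap f c l n :=
  div_pos (sub_pos.2 (D.radius_lt hf n)) (D.radius_pos hf n)

lemma crossRatio_le_relativeGap (D : NestData f a b c J l u r) (hf : IsQuasiQuadratic f a b c)
    (hA : Comparable f c l u A) {θ : ℝ} (hθ : 0 < θ) (hle : θ ≤ relativeGap f c l n) :
    crossRatio (l n) (l (n + 1)) (u (n + 1)) (u n) ≤ (1 + 2 * A ^ 2 / θ) ^ 2 := by
  have hA_pos : 0 < A := one_pos.trans_le hA.one_le
  have hρ := D.radius_pos hf n
  have hρ_lt := D.radius_lt hf n
  have hgap : θ * radius f c l n ≤ radius f c l n - radius f c l (n + 1) :=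
    (le_div_iff₀ hρ).1 hle
  have hU : 0 < θ * radius f c l n / A := by positivity
  have hmid : |u (n + 1) - l (n + 1)| ≤ 2 * A * radius f c l n := by
    rw [abs_of_pos (sub_pos.2 (D.lt _))]
    have hl := hA.left.le (n + 1)
    have hu := hA.right.le (n + 1)
    nlinarith
  refine (crossRatio_le_of_le hU hU hmid ?_ ?_).trans_eq ?_
  · exact le_abs.2 (.inl ((div_le_iff₀' hA_pos).2 (by linarith [hA.left.gap_ge n])))
  · exact le_abs.2 (.inl ((div_le_iff₀' hA_pos).2 (by linarith [hA.right.gap_ge n])))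
  · field_simp

lemma le_relativeGap (D : NestData f a b c J l u r) (hf : IsQuasiQuadratic f a b c) {Q : ℝ}
    (hQ : 0 < Q)
    (h : radius f c l n ^ 2 ≤ (radius f c l n ^ 2 - radius f c l (n + 1) ^ 2) * Q) :
    (2 * Q)⁻¹ ≤ relativeGap f c l n := by
  have hρ := D.radius_pos hf n
  have hρ_lt := D.radius_lt hf n
  rw [relativeGap, inv_le_comm₀ (by positivity) (div_pos (sub_pos.2 hρ_lt) hρ), inv_div,
    div_le_iff₀ (sub_pos.2 hρ_lt)]
  refine le_of_mul_le_mul_left ?_ hρ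
  calc radius f c l n * radius f c l n
      ≤ (radius f c l n - radius f c l (n + 1)) * (radius f c l n + radius f c l (n + 1)) * Q := by
        linarith
    _ ≤ (radius f c l n - radius f c l (n + 1)) * (2 * radius f c l n) * Q := by
        gcongr
        linarith
    _ = radius f c l n * (2 * Q * (radius f c l n - radius f c l (n + 1))) := by ring

lemma relativeGap_le_or (D : NestData f a b c J l u r) (hf : IsQuasiQuadratic f a b c)
    (hA : Comparable f c l u A) (n : ℕ) :
    relativeGap f c l n ≤ relativeGap f c l (n + 1) ∨
      (2 * (1 + A ^ 2) ^ 2)⁻¹ ≤ relativeGap f c l (n + 1) ∨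
      (2 * (1 + A ^ 2) ^ 2)⁻¹ ≤ relativeGap f c l (n + 2) := by
  have hρ := D.radius_pos hf
  have hρ_lt := D.radius_lt hf
  have hQ : 1 ≤ (1 + A ^ 2) ^ 2 := one_le_pow₀ (by linarith [sq_nonneg A])
  rcases le_total (relativeGap f c l n) (relativeGap f c l (n + 1)) with hle | hle
  · exact .inl hle
  right
  have hgap :
      radius f c l (n + 1) - radius f c l (n + 2) ≤ radius f c l n - radius f c l (n + 1) :=
    ((div_le_iff₀ (hρ _)).1 hle).trans (((mul_le_mul_iff_right₀ (D.relativeGap_pos hf n)).2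
      (hρ_lt n).le).trans_eq (div_mul_cancel₀ _ (hρ n).ne'))
  rcases le_total (radius f c l (n + 1) - radius f c l (n + 2)) (radius f c l (n + 2)) with
    hrad | hrad
  · obtain ⟨k, rfl | rfl, hk⟩ := D.sq_radius_le_of_gap_le hf hA hgap hrad
    exacts [.inl (D.le_relativeGap hf (by positivity) hk),
      .inr (D.le_relativeGap hf (by positivity) hk)]
  · refine .inl ((inv_anti₀ two_pos (by linarith : (2 : ℝ) ≤ 2 * (1 + A ^ 2) ^ 2)).trans ?_)
    exact (le_div_iff₀ (hρ _)).2 (by linarith)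

theorem exists_crossRatio_le (D : NestData f a b c J l u r) (hf : IsQuasiQuadratic f a b c) :
    ∃ B, ∀ n, crossRatio (l n) (l (n + 1)) (u (n + 1)) (u n) ≤ B := by
  obtain ⟨A, hA⟩ := D.exists_comparable hf
  have hstep : ∀ θ > 0, ∃ η > 0, ∀ n, θ ≤ relativeGap f c l n → η ≤ relativeGap f c l (n + 1) := by
    refine fun θ hθ => ⟨(2 * (1 + 2 * A ^ 2 / θ) ^ 2)⁻¹, by positivity, fun n hn => ?_⟩
    refine D.le_relativeGap hf (by positivity) ((D.sq_radius_le_crossRatio hf n).trans ?_)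
    exact mul_le_mul_of_nonneg_left (D.crossRatio_le_relativeGap hf hA hθ hn)
      (sub_pos.2 (D.sq_radius_lt hf (n + 1))).le
  obtain ⟨δ, hδ, hδ_le⟩ := exists_pos_le_of_dichotomy (by positivity) (D.relativeGap_pos hf 0)
    hstep (D.relativeGap_le_or hf hA)
  exact ⟨_, fun n => D.crossRatio_le_relativeGap hf hA hδ (hδ_le n)⟩

end NestData

end RealBounds

section DeepPullbacks

/-- The interval `(x, y)` is `δ`-thin in `(l, u)`: it is at most `δ` times as long as either of the
two gaps around it. -/
structure IsThin (δ x y l u : ℝ) : Prop where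
  left : y - x ≤ δ * (x - l)
  right : y - x ≤ δ * (u - y)

namespace IsThin

variable {δ E x y x' y' l u : ℝ}

lemma of_crossRatio_le (hl : l < x) (hxy : x < y) (hu : y < u) (h : crossRatio l x y u ≤ E) :
    IsThin (E - 1) x y l u := by
  have hleft := add_le_mul_crossRatio (w₂ := y) (w₃ := u) hl.ne' le_rfl
  have hright := add_le_mul_crossRatio (w₂ := x) (w₃ := l) hu.ne le_rfl
  rw [abs_of_pos (sub_pos.2 hl), abs_of_pos (sub_pos.2 hxy)] at hleft
  rw [crossRatio_reverse, abs_of_neg (sub_neg.2 hu), abs_of_neg (sub_neg.2 hxy)] at hright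
  exact ⟨by linarith [mul_le_mul_of_nonneg_left h (sub_pos.2 hl).le],
    by linarith [mul_le_mul_of_nonneg_left h (sub_pos.2 hu).le]⟩

lemma mono (h : IsThin δ x y x' y') (hδ : 0 ≤ δ) (hl : l ≤ x') (hu : y' ≤ u) : IsThin δ x y l u :=
  ⟨h.left.trans (by gcongr), h.right.trans (by gcongr)⟩

lemma lt (h : IsThin δ x y l u) (hδ : 0 ≤ δ) (hxy : x < y) : l < x ∧ y < u :=
  ⟨sub_pos.1 (pos_of_mul_pos_right ((sub_pos.2 hxy).trans_le h.left) hδ),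
    sub_pos.1 (pos_of_mul_pos_right ((sub_pos.2 hxy).trans_le h.right) hδ)⟩

lemma trans (h : IsThin (E - 1) x y x' y') (hE : 1 ≤ E) (hxy : x < y) (h' : IsThin δ x' y' l u)
    (hδ : 0 ≤ δ) : IsThin (E / (1 + E) * δ) x y l u := by
  obtain ⟨hx, hy⟩ := h.lt (sub_nonneg.2 hE) hxy
  have hshrink : y - x ≤ E / (1 + E) * (y' - x') := by
    rw [div_mul_eq_mul_div, le_div_iff₀ (by linarith)]
    linarith [h.left, h.right]
  rw [mul_comm]
  constructor
  · calc y - x ≤ E / (1 + E) * (δ * (x' - l)) := hshrink.trans (by gcongr; exact h'.left)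
      _ ≤ E / (1 + E) * (δ * (x - l)) := by gcongr
      _ = _ := by ring
  · calc y - x ≤ E / (1 + E) * (δ * (u - y')) := hshrink.trans (by gcongr; exact h'.right)
      _ ≤ E / (1 + E) * (δ * (u - y)) := by gcongr
      _ = _ := by ring

lemma crossRatio_le (h : IsThin δ x y l u) (hδ : 0 ≤ δ) (hxy : x < y) :
    crossRatio l x y u ≤ (1 + δ) ^ 2 := by
  obtain ⟨hl, hu⟩ := h.lt hδ hxy
  rw [crossRatio, sq, abs_of_pos (sub_pos.2 hl), abs_of_pos (sub_pos.2 hxy),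
    abs_of_pos (sub_pos.2 hu)]
  have := sub_pos.2 hl
  have := sub_pos.2 hxy
  have := sub_pos.2 hu
  gcongr
  · exact (div_le_iff₀ (sub_pos.2 hl)).2 h.left
  · exact (div_le_iff₀ (sub_pos.2 hu)).2 h.right

end IsThin

lemma crossRatio_le_crossRatio_of_le {l x' x y y' u : ℝ} (hl : l ≤ x') (hx : x' < x) (hy : y < y')
    (hu : y' ≤ u) : crossRatio l x y u ≤ crossRatio x' x y y' := by
  refine crossRatio_le_of_le (abs_pos.2 (sub_pos.2 hx).ne') (abs_pos.2 (sub_pos.2 hy).ne') le_rfl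
    ?_ ?_
  · rw [abs_of_pos (sub_pos.2 hx), abs_of_pos (by linarith)]
    linarith
  · rw [abs_of_pos (sub_pos.2 hy), abs_of_pos (by linarith)]
    linarith

variable {f : ℝ → ℝ} {a b c : ℝ} {J : Set ℝ} {l u : ℕ → ℝ} {r : ℕ → ℕ} {N τ t : ℕ} {k₁ k₂ : ℝ}

lemma IsQuasiQuadratic.exists_iterate_eq_end (hf : IsQuasiQuadratic f a b c) {m : ℕ} {x y : ℝ}
    (hx : x ∈ Icc a b) (hy : y ∈ Icc a b) (hmx : f^[m] x ∈ Ioo k₁ k₂)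
    (hmy : f^[m] y ∉ Ioo k₁ k₂) : ∃ w ∈ uIcc x y, w ≠ x ∧ f^[m] w ∈ ({k₁, k₂} : Set ℝ) := by
  obtain ⟨k, hk, hk'⟩ := exists_end_mem_uIcc hmx hmy
  obtain ⟨w, hw, rfl⟩ := intermediate_value_uIcc
    ((hf.continuousOn_iterate m).mono (uIcc_subset_Icc hx hy)) hk'
  refine ⟨w, hw, ?_, hk⟩
  rintro rfl
  rcases hk with h | h <;> rw [h] at hmx
  exacts [left_notMem_Ioo hmx, right_notMem_Ioo hmx]

/-- A non-central component `(k₁, k₂)` of the domain of the first return map to `I^N`, with return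
time `τ`. -/
structure IsReturnBranch (f : ℝ → ℝ) (a b c : ℝ) (l u : ℕ → ℝ) (N τ : ℕ) (k₁ k₂ : ℝ) : Prop where
  one_le : 1 ≤ τ
  isBranch : IsBranch f a b c τ k₁ k₂ (l N) (u N)
  subset : Ioo k₁ k₂ ⊆ Ioo (l N) (u N)
  disjoint : Disjoint (Ioo k₁ k₂) (Ioo (l (N + 1)) (u (N + 1)))
  iterate_notMem : ∀ w ∈ Ioo k₁ k₂, ∀ i, 1 ≤ i → i < τ → f^[i] w ∉ Ioo (l N) (u N)
  ends_notMem : ∀ e ∈ ({k₁, k₂} : Set ℝ), ∀ i, 1 ≤ i → f^[i] e ∉ Ioo (l N) (u N)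

namespace NestData

lemma mem_Icc_of_mem (D : NestData f a b c J l u r) {n : ℕ} {z : ℝ} (hz : z ∈ Icc (l n) (u n)) :
    z ∈ Icc a b := Ioo_subset_Icc_self ((D.isNice n).subset hz)

lemma iterate_end_mem (D : NestData f a b c J l u r) (n : ℕ) {e : ℝ}
    (he : e ∈ ({l (n + 1), u (n + 1)} : Set ℝ)) : f^[r n] e ∈ ({l n, u n} : Set ℝ) := by
  have hl := (D.central n).iterate_left_mem (D.one_le_r n)
  rcases he with rfl | rfl
  · exact hl
  · exact iterate_eq_of_apply_eq (D.isNice (n + 1)).symm (D.one_le_r n) ▸ hl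

lemma exists_isReturnBranch (D : NestData f a b c J l u r) (hf : IsQuasiQuadratic f a b c)
    {K : Set ℝ} (hK : K ∈ levelIntervals f c J (N + 1)) (hc : c ∉ K) :
    ∃ k₁ k₂ τ, K = Ioo k₁ k₂ ∧ IsReturnBranch f a b c l u N τ k₁ k₂ := by
  obtain ⟨t₀, hz, rfl⟩ := hK
  have hcentral : connectedComponentIn (returnDomain f (nest f c J N)) c =
      Ioo (l (N + 1)) (u (N + 1)) := D.nest_eq (N + 1)
  rw [Nat.add_sub_cancel] at hz hc ⊢
  have hzc : f^[t₀] c ∉ Ioo (l (N + 1)) (u (N + 1)) := by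
    rw [← hcentral]
    intro hmem
    rw [← connectedComponentIn_eq hmem, hcentral] at hc
    exact hc (D.crit_mem _)
  rw [D.nest_eq] at hz ⊢
  set z := f^[t₀] c
  obtain ⟨τ, hone, hτ, hfirst⟩ := exists_isFirstPassage hz.2
  have hsep : ∀ i < τ, f^[i] z ∉ Ioo (l (N + 1)) (u (N + 1)) := fun i hi => by
    rcases i.eq_zero_or_pos with rfl | hpos
    · exact hzc
    · exact fun hmem => hfirst i hpos hi (D.Ioo_subset N.le_succ hmem)
  obtain ⟨k₁, k₂, hzk, hB⟩ := D.exists_branch_of_notMem hf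
    (D.mem_Icc_of_mem (Ioo_subset_Icc_self hz.1)) hτ hsep
  have hends := fun n => (D.isNice N).nice_ends n (mem_insert (l N) {u N})
  have hends' := fun n => (D.isNice N).nice_ends n (mem_insert_of_mem (l N) (mem_singleton (u N)))
  have hsub := hB.ends_mem_Icc hf hzk hz.1 (hends _) (hends' _)
  refine ⟨k₁, k₂, τ, (D.isNice N).connectedComponentIn_eq hf hB hzk hone hz.1 hfirst, hone, hB,
    Ioo_subset_Ioo hsub.1 hsub.2, disjoint_left.2 fun w hw => ?_, fun w hw i hi hiτ => ?_,
    fun e he i hi => (D.isNice N).branch_ends_notMem hf hB hzk hfirst hi he⟩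
  · exact hB.iterate_notMem_Ioo hf τ.zero_le hzk hzc
      (D.ends_notMem N hone (mem_insert _ _)) (D.ends_notMem N hone (mem_insert_of_mem _ rfl))
      (Ioo_subset_Icc_self hw)
  · exact hB.iterate_notMem_Ioo hf hiτ.le hzk (hfirst i hi hiτ) (hends _) (hends' _)
      (Ioo_subset_Icc_self hw)

/-- An endpoint of `I^{j+1}` that enters the interval at a time before `r j` would force a nearby
point of `I^{j+1}` onto the boundary of the interval, which never returns to `I^N`. -/
lemma iterate_ends_notMem (D : NestData f a b c J l u r) (hf : IsQuasiQuadratic f a b c)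
    (hK : IsReturnBranch f a b c l u N τ k₁ k₂) (ht : ∀ i < t, f^[i] c ∉ Ioo k₁ k₂) (d : ℕ)
    {m : ℕ} (hm : m < t) {e : ℝ} (he : e ∈ ({l (N + d), u (N + d)} : Set ℝ)) :
    f^[m] e ∉ Ioo k₁ k₂ := by
  induction d generalizing m e with
  | zero => exact fun h => (D.isNice N).nice_ends m he (hK.subset h)
  | succ d ih =>
    intro hmem
    obtain ⟨hlc, hcu⟩ := D.crit_mem (N + (d + 1))
    rcases lt_or_ge m (r (N + d)) with hlt | hge
    · have hcI : c ∈ Icc a b := Ioo_subset_Icc_self hf.crit_mem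
      have heI : e ∈ Icc a b := D.mem_Icc_of_mem (n := N + d + 1) (by
        rcases he with rfl | rfl
        exacts [Set.left_mem_Icc.2 (D.lt _).le, Set.right_mem_Icc.2 (D.lt _).le])
      obtain ⟨w, hw, hne, hwk⟩ := hf.exists_iterate_eq_end heI hcI hmem (ht m hm)
      have hwI : w ∈ Ioo (l (N + (d + 1))) (u (N + (d + 1))) := by
        rcases he with rfl | rfl
        · rw [uIcc_of_le hlc.le] at hw
          exact ⟨hw.1.lt_of_ne hne.symm, hw.2.trans_lt hcu⟩
        · rw [uIcc_of_ge hcu.le] at hw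
          exact ⟨hlc.trans_le hw.1, hw.2.lt_of_ne hne⟩
      have hreturn := hK.ends_notMem _ hwk (r (N + d) - m) (Nat.sub_pos_of_lt hlt)
      rw [← Function.iterate_add_apply, Nat.sub_add_cancel hlt.le] at hreturn
      exact hreturn (D.Ioo_subset (N.le_add_right d) (D.mapsTo_iterate hf _ hwI))
    · refine ih (m := m - r (N + d)) (by omega) (D.iterate_end_mem _ he) ?_
      rwa [← Function.iterate_add_apply, Nat.sub_add_cancel hge]

lemma exists_thin_branch (D : NestData f a b c J l u r) (hf : IsQuasiQuadratic f a b c) {E : ℝ}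
    {n : ℕ} (hE : crossRatio (l n) (l (n + 1)) (u (n + 1)) (u n) ≤ E) {z : ℝ} (hz : z ∈ Icc a b)
    (ht : f^[t] z ∈ Ioo (l (n + 1)) (u (n + 1)))
    (hfirst : ∀ i < t, f^[i] z ∉ Ioo (l (n + 1)) (u (n + 1))) :
    ∃ x' y' x y, z ∈ Ioo x y ∧ z ∈ Ioo x' y' ∧ IsBranch f a b c t x' y' (l n) (u n) ∧
      IsBranch f a b c t x y (l (n + 1)) (u (n + 1)) ∧ IsThin (E - 1) x y x' y' := by
  obtain ⟨x', y', hz', hB'⟩ := D.exists_branch_of_notMem hf hz (D.Ioo_subset n.le_succ ht) hfirst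
  obtain ⟨x, y, hx, hxy, hy, hB, hcross, hmem⟩ := hB'.exists_restrict hf (D.lt_left n) (D.lt _)
    (D.lt_right n)
  exact ⟨x', y', x, y, hmem z hz' ht, hz', hB', hB, .of_crossRatio_le hx hxy hy (hcross.trans hE)⟩

/-- The orbit lands in the intermediate intervals of the nest one after the other, and at each
landing the branch shrinks by a definite factor. -/
lemma exists_landing (D : NestData f a b c J l u r) (hf : IsQuasiQuadratic f a b c) {E : ℝ}
    (hE : ∀ n, crossRatio (l n) (l (n + 1)) (u (n + 1)) (u n) ≤ E) {z : ℝ}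
    (hz : z ∈ Ioo (l N) (u N)) (d : ℕ) (ht : f^[t] z ∈ Ioo (l (N + d + 1)) (u (N + d + 1)))
    (hfirst : ∀ i < t, f^[i] z ∉ Ioo (l (N + d + 1)) (u (N + d + 1))) :
    ∃ x y, z ∈ Ioo x y ∧ IsBranch f a b c t x y (l (N + d + 1)) (u (N + d + 1)) ∧
      IsThin ((E / (1 + E)) ^ d * (E - 1)) x y (l N) (u N) := by
  have hE_one : 1 ≤ E := (one_le_crossRatio _ _ _ _).trans (hE 0)
  have hE_nonneg : 0 ≤ E - 1 := sub_nonneg.2 hE_one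
  induction d generalizing t with
  | zero =>
    obtain ⟨x', y', x, y, hzx, hz', hB', hB, hthin⟩ := D.exists_thin_branch hf (hE _)
      (D.mem_Icc_of_mem (Ioo_subset_Icc_self hz)) ht hfirst
    have hsub := hB'.ends_mem_Icc hf hz' hz ((D.isNice N).nice_ends t (mem_insert _ _))
      ((D.isNice N).nice_ends t (mem_insert_of_mem _ rfl))
    refine ⟨x, y, hzx, hB, ?_⟩
    rw [pow_zero, one_mul]
    exact hthin.mono hE_nonneg hsub.1 hsub.2
  | succ d ih =>
    obtain ⟨x', y', x, y, hzx, hz', hB', hB, hthin⟩ := D.exists_thin_branch hf (hE _)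
      (D.mem_Icc_of_mem (Ioo_subset_Icc_self hz)) ht hfirst
    classical
    have hland : ∃ i, f^[i] z ∈ Ioo (l (N + d + 1)) (u (N + d + 1)) :=
      ⟨t, hB'.mapsTo hf hz'⟩
    obtain ⟨x₁, y₁, hz₁, hB₁, hthin₁⟩ := ih (Nat.find_spec hland) fun i => Nat.find_min hland
    have hends : ∀ e ∈ ({x₁, y₁} : Set ℝ), f^[t] e ∉ Ioo (l (N + d + 1)) (u (N + d + 1)) :=
      fun e => (D.isNice _).branch_ends_notMem hf hB₁ hz₁ (i₀ := 0)
        (fun i _ => Nat.find_min hland) t.zero_le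
    have hsub := hB'.ends_mem_Icc hf hz' hz₁ (hends _ (mem_insert _ _))
      (hends _ (mem_insert_of_mem _ rfl))
    refine ⟨x, y, hzx, hB, ?_⟩
    rw [pow_succ', mul_assoc]
    exact (hthin.mono hE_nonneg hsub.1 hsub.2).trans hE_one hB.lt hthin₁ (by positivity)

lemma exists_last_visit (D : NestData f a b c J l u r) {M : ℕ} (hM : r M ≤ t) :
    ∃ s m, t = m + s ∧ 1 ≤ s ∧ f^[s] c ∈ Ioo (l M) (u M) ∧
      ∀ i, 1 ≤ i → i ≤ m → f^[i] (f^[s] c) ∉ Ioo (l M) (u M) := by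
  classical
  have hfirst := (D.first M).2.1
  set s := Nat.findGreatest (fun i => f^[i] c ∈ Ioo (l M) (u M)) t
  have hst : s ≤ t := Nat.findGreatest_le t
  have hsM : f^[s] c ∈ Ioo (l M) (u M) :=
    Nat.findGreatest_spec (P := fun i => f^[i] c ∈ Ioo (l M) (u M)) hM hfirst
  refine ⟨s, t - s, by omega, (D.one_le_r M).trans (Nat.le_findGreatest hM hfirst), hsM,
    fun i hi him => ?_⟩
  rw [← Function.iterate_add_apply]
  exact Nat.findGreatest_is_greatest (P := fun i => f^[i] c ∈ Ioo (l M) (u M))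
    (by omega : s < i + s) (by omega)

lemma exists_pullback_branch (D : NestData f a b c J l u r) (hf : IsQuasiQuadratic f a b c)
    (hK : IsReturnBranch f a b c l u N τ k₁ k₂) {s m d : ℕ} (hs : 1 ≤ s)
    (ht : IsFirstPassage f c (Ioo k₁ k₂) (m + s)) (hsr : s < r (N + d + 1))
    (hsM : f^[s] c ∈ Ioo (l (N + d)) (u (N + d))) :
    ∃ x y, f^[s] c ∈ Ioo x y ∧ IsBranch f a b c m x y k₁ k₂ ∧ l (N + d) ≤ x ∧ y ≤ u (N + d) ∧
      Disjoint (Ioo x y) (Ioo (l (N + d + 1)) (u (N + d + 1))) := by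
  have hcI : c ∈ Icc a b := Ioo_subset_Icc_self hf.crit_mem
  have hfirst : ∀ i < m + s, f^[i] c ∉ Ioo k₁ k₂ := fun i hi => by
    rcases i.eq_zero_or_pos with rfl | hpos
    · exact fun hmem => disjoint_left.1 hK.disjoint hmem (D.crit_mem _)
    · exact ht.2.2 i hpos hi
  have hends : ∀ j, ∀ e ∈ ({l (N + j), u (N + j)} : Set ℝ), f^[m] e ∉ Ioo k₁ k₂ := fun j e he =>
    D.iterate_ends_notMem hf hK hfirst j (by omega) he
  have hsm : f^[m] (f^[s] c) ∈ Ioo k₁ k₂ := by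
    rw [← Function.iterate_add_apply]
    exact ht.2.1
  obtain ⟨x, y, hsx, hB⟩ := exists_isBranch hf hK.isBranch.subset (hf.iterate_mem s hcI) hsm
    fun i hi => ⟨c, left_mem_uIcc, hfirst _ (by omega)⟩
  have hsub := hB.ends_mem_Icc hf hsx hsM (hends d _ (mem_insert _ _))
    (hends d _ (mem_insert_of_mem _ rfl))
  refine ⟨x, y, hsx, hB, hsub.1, hsub.2, disjoint_left.2 fun w hw => ?_⟩
  exact hB.iterate_notMem_Ioo hf m.zero_le hsx (D.notMem_of_lt hs hsr)
    (hends (d + 1) _ (mem_insert _ _)) (hends (d + 1) _ (mem_insert_of_mem _ rfl))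
    (Ioo_subset_Icc_self hw)

/-- The orbit of `z` passes through `(k₁, k₂)`, returns to `I^N` and then lands in `I^M`,
`M = N + d + 1`; the landing branch is thin in `I^N`, hence its pull-back is thin in the pull-back
`(x', y')` of `(k₁, k₂)`. -/
lemma exists_thin_component (D : NestData f a b c J l u r) (hf : IsQuasiQuadratic f a b c)
    {E : ℝ} (hE : ∀ n, crossRatio (l n) (l (n + 1)) (u (n + 1)) (u n) ≤ E)
    (hK : IsReturnBranch f a b c l u N τ k₁ k₂) {m d : ℕ} {x' y' z : ℝ}
    (hB' : IsBranch f a b c m x' y' k₁ k₂) (hz' : z ∈ Ioo x' y')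
    (hzM : z ∈ Ioo (l (N + d + 1)) (u (N + d + 1)))
    (hm : ∀ i, 1 ≤ i → i ≤ m → f^[i] z ∉ Ioo (l (N + d + 1)) (u (N + d + 1)))
    (hland : ∃ i, f^[i] (f^[m + τ] z) ∈ Ioo (l (N + d + 1)) (u (N + d + 1))) :
    ∃ x y, z ∈ returnDomain f (Ioo (l (N + d + 1)) (u (N + d + 1))) ∧
      connectedComponentIn (returnDomain f (Ioo (l (N + d + 1)) (u (N + d + 1)))) z = Ioo x y ∧
      (∀ e ∈ ({x, y} : Set ℝ), ∀ i, 1 ≤ i → f^[i] e ∉ Ioo (l (N + d + 1)) (u (N + d + 1))) ∧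
      x' < x ∧ x < y ∧ y < y' ∧
      crossRatio x' x y y' ≤ (1 + (E / (1 + E)) ^ d * (E - 1)) ^ 2 := by
  classical
  have hE_one : 1 ≤ E := (one_le_crossRatio _ _ _ _).trans (hE 0)
  have hδ : 0 ≤ (E / (1 + E)) ^ d * (E - 1) :=
    mul_nonneg (by positivity) (sub_nonneg.2 hE_one)
  have hBτ := hB'.comp hK.isBranch hf
  obtain ⟨x₁, y₁, hz₁, hB₁, hthin⟩ := D.exists_landing hf hE (hBτ.mapsTo hf hz') d
    (Nat.find_spec hland) fun i => Nat.find_min hland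
  obtain ⟨hx₁, hy₁⟩ := hthin.lt hδ hB₁.lt
  obtain ⟨x, y, hx, hxy, hy, hBx, hcross, hmem⟩ := hBτ.exists_restrict hf hx₁ hB₁.lt hy₁
  have hzx : z ∈ Ioo x y := hmem z hz' hz₁
  have hB := hBx.comp hB₁ hf
  have hone : 1 ≤ m + τ + Nat.find hland := by linarith [hK.one_le, Nat.zero_le m]
  have hret : ∀ i, 1 ≤ i → i < m + τ + Nat.find hland →
      f^[i] z ∉ Ioo (l (N + d + 1)) (u (N + d + 1)) := by
    intro i hi hi'
    rcases le_or_gt i m with him | hmi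
    · exact hm i hi him
    rcases lt_or_ge i (m + τ) with hiτ | hτi
    · have hpass := hK.iterate_notMem _ (hB'.mapsTo hf hz') (i - m) (by omega) (by omega)
      rw [← Function.iterate_add_apply, Nat.sub_add_cancel hmi.le] at hpass
      exact fun hmem => hpass (D.Ioo_subset (by omega) hmem)
    · have hnot := Nat.find_min hland (m := i - (m + τ)) (by omega)
      rwa [← Function.iterate_add_apply, Nat.sub_add_cancel hτi] at hnot
  exact ⟨x, y, ⟨hzM, _, hone, hB.mapsTo hf hzx⟩,
    (D.isNice _).connectedComponentIn_eq hf hB hzx hone hzM hret,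
    fun e he i hi => (D.isNice _).branch_ends_notMem hf hB hzx hret hi he, hx, hxy, hy,
    hcross.trans (hthin.crossRatio_le hδ hB₁.lt)⟩

/-- The component `(x, y)` is pulled back to the critical value along the orbit from `f(c)` to
`f^s(c)`. -/
lemma sq_radius_le_of_component (D : NestData f a b c J l u r) (hf : IsQuasiQuadratic f a b c)
    {M s : ℕ} {x y : ℝ} (hs : 1 ≤ s) (hsr : s < r (M + 1)) (hsx : f^[s] c ∈ Ioo x y)
    (hx : l M < x) (hy : y < u M)
    (hends : ∀ e ∈ ({x, y} : Set ℝ), ∀ i, 1 ≤ i → f^[i] e ∉ Ioo (l M) (u M)) :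
    radius f c l (M + 1) ^ 2 ≤ (radius f c l (M + 1) ^ 2 - radius f c l (M + 2) ^ 2) *
      crossRatio (l M) x y (u M) := by
  have hsc : f^[s - 1] (f c) ∈ Ioo x y := by rwa [iterate_pred_apply hs]
  obtain ⟨ξ₁, ξ₂, hcξ, hξ⟩ := D.exists_branch_of_notMem hf (n := M) (t := s - 1)
    (hf.mapsTo (Ioo_subset_Icc_self hf.crit_mem))
    ⟨hx.trans hsc.1, hsc.2.trans hy⟩ fun i hi => by
      rw [← Function.iterate_succ_apply]
      exact D.notMem_of_lt (by omega) (by omega)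
  obtain ⟨η₁, η₂, hη₁, -, hη₂, hη, hcross, hmem⟩ := hξ.exists_restrict hf hx
    (hsx.1.trans hsx.2) hy
  refine (D.sq_radius_le hf hη₁ (hmem _ hcξ hsc) hη₂ (fun e he hmem => ?_) hξ).trans
    (mul_le_mul_of_nonneg_left hcross (sub_nonneg.2 (D.sq_radius_lt hf (M + 1)).le))
  have hse : f^[s - 1] e ∈ ({x, y} : Set ℝ) := by
    simp only [mem_insert_iff, mem_singleton_iff] at he ⊢
    rcases hη.ends with ⟨e₁, e₂⟩ | ⟨e₁, e₂⟩ <;> rcases he with rfl | rfl <;> tauto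
  have hnot := hends _ hse (r (M + 1) - s) (by omega)
  rw [← Function.iterate_add_apply, show r (M + 1) - s + (s - 1) = r (M + 1) - 1 by omega] at hnot
  exact hnot (D.Ioo_subset M.le_succ hmem)

/-- A non-central interval `(k₁, k₂)` of level `N + 1` and rank `d + 2` is pulled back along the
last stretch of the critical orbit outside `I^{N+d+1}` before the first passage through it. -/
lemma exists_deep_interval (D : NestData f a b c J l u r) (hf : IsQuasiQuadratic f a b c)
    (hrec : IsRecurrent f c) {E : ℝ}
    (hE : ∀ n, crossRatio (l n) (l (n + 1)) (u (n + 1)) (u n) ≤ E) {d : ℕ}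
    (hK : IsReturnBranch f a b c l u N τ k₁ k₂) (ht : IsFirstPassage f c (Ioo k₁ k₂) t)
    (hrt : r (N + d + 1) ≤ t) (htr : t < r (N + d + 2)) :
    ∃ m x' y' x y, IsBranch f a b c m x' y' k₁ k₂ ∧
      l (N + d + 1) ≤ x' ∧ y' ≤ u (N + d + 1) ∧
      Disjoint (Ioo x' y') (Ioo (l (N + d + 2)) (u (N + d + 2))) ∧
      Ioo x y ∈ levelIntervals f c J (N + d + 2) ∧ x' < x ∧ x < y ∧ y < y' ∧
      crossRatio x' x y y' ≤ (1 + (E / (1 + E)) ^ d * (E - 1)) ^ 2 ∧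
      radius f c l (N + d + 2) ^ 2 ≤ (radius f c l (N + d + 2) ^ 2 - radius f c l (N + d + 3) ^ 2) *
        (1 + (E / (1 + E)) ^ d * (E - 1)) ^ 2 := by
  obtain ⟨s, m, rfl, hs, hsM, hlast⟩ := D.exists_last_visit hrt
  have hsr : s < r (N + d + 2) := by omega
  obtain ⟨x', y', hs', hB', hx', hy', hdisj⟩ :=
    D.exists_pullback_branch hf hK (d := d + 1) hs ht hsr hsM
  have hland : ∃ i, f^[i] (f^[m + τ] (f^[s] c)) ∈ Ioo (l (N + d + 1)) (u (N + d + 1)) := by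
    obtain ⟨T, hT, hTM⟩ := hrec.exists_ge isOpen_Ioo (D.crit_mem (N + d + 1)) (m + τ + s)
    refine ⟨T - (m + τ + s), ?_⟩
    rwa [← Function.iterate_add_apply, ← Function.iterate_add_apply,
      show T - (m + τ + s) + (m + τ) + s = T by omega]
  obtain ⟨x, y, hsdom, hcomp, hends, hx, hxy, hy, hcross⟩ :=
    D.exists_thin_component hf hE hK hB' hs' hsM hlast hland
  have hrad := D.sq_radius_le_of_component hf hs hsr (hcomp ▸ mem_connectedComponentIn hsdom)
    (hx'.trans_lt hx) (hy.trans_le hy') hends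
  refine ⟨m, x', y', x, y, hB', hx', hy', hdisj, ⟨s, ?_, ?_⟩, hx, hxy, hy, hcross,
    hrad.trans (mul_le_mul_of_nonneg_left
      ((crossRatio_le_crossRatio_of_le hx' hx hy hy').trans hcross)
      (sub_nonneg.2 (D.sq_radius_lt hf _).le))⟩ <;>
    rw [show N + d + 2 - 1 = N + d + 1 by omega, D.nest_eq]
  exacts [hsdom, hcomp.symm]

end NestData

end DeepPullbacks

section Ranks

variable {f : ℝ → ℝ} {a b c A lam : ℝ} {J K : Set ℝ} {l u : ℕ → ℝ} {r : ℕ → ℕ}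

lemma IsFirstPassage.unique {S : Set ℝ} {t t' : ℕ} (h : IsFirstPassage f c S t)
    (h' : IsFirstPassage f c S t') : t = t' := by
  rcases lt_trichotomy t t' with hlt | heq | hgt
  exacts [absurd h.2.1 (h'.2.2 t h.1 hlt), heq, absurd h'.2.1 (h.2.2 t' h'.1 hgt)]

lemma rpow_half_eq_sqrt {σ : ℝ} (hσ : 0 ≤ σ) {k : ℕ} (hk : 1 ≤ k) :
    σ ^ (((k : ℝ) - 1) / 2) = √(σ ^ (k - 1)) := by
  rw [Real.sqrt_eq_rpow, ← Real.rpow_natCast_mul hσ, Nat.cast_sub hk, Nat.cast_one,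
    div_eq_mul_one_div]

lemma log_sq_one_add_le {δ : ℝ} (hδ : 0 ≤ δ) : Real.log ((1 + δ) ^ 2) ≤ 2 * δ := by
  rw [Real.log_pow, Nat.cast_ofNat]
  linarith [Real.log_le_sub_one_of_pos (show 0 < 1 + δ by linarith)]

lemma sq_one_add_pow_mul_sub_one_le {σ : ℝ} (hσ_pos : 0 < σ) (hσ_le : σ ≤ 1) (E : ℝ) (d : ℕ) :
    (1 + σ ^ d * (E - 1)) ^ 2 - 1 ≤ (E ^ 2 - 1) / σ * σ ^ (d + 1) := by
  have hpow : σ ^ d * (E - 1) ^ 2 * σ ^ d ≤ σ ^ d * (E - 1) ^ 2 :=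
    mul_le_of_le_one_right (by positivity) (pow_le_one₀ hσ_pos.le hσ_le)
  calc (1 + σ ^ d * (E - 1)) ^ 2 - 1
      = 2 * (σ ^ d * (E - 1)) + σ ^ d * (E - 1) ^ 2 * σ ^ d := by ring
    _ ≤ 2 * (σ ^ d * (E - 1)) + σ ^ d * (E - 1) ^ 2 := by gcongr
    _ = (E ^ 2 - 1) / σ * σ ^ (d + 1) := by
      field_simp
      ring

lemma sigmaBar_pos (lam : ℝ) : 0 < sigmaBar lam := by
  rw [sigmaBar]
  positivity

lemma sigmaBar_lt_one (lam : ℝ) : sigmaBar lam < 1 := by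
  rw [sigmaBar, div_lt_one (by positivity)]
  exact lt_one_add _

namespace NestData

lemma scalingFactor_le (D : NestData f a b c J l u r) (hA : Comparable f c l u A) (n : ℕ) :
    scalingFactor f c J (n + 1) ≤ A ^ 2 * (radius f c l (n + 1) / radius f c l n) := by
  have hA_pos : 0 < A := one_pos.trans_le hA.one_le
  have hlen : ∀ n, 0 < u n - l n := fun n => sub_pos.2 (D.lt n)
  have hrad : 0 < radius f c l n :=
    pos_of_mul_pos_right ((sub_pos.2 (D.crit_mem n).1).trans_le (hA.left.le n)) hA_pos.le
  have hlen_le : u (n + 1) - l (n + 1) ≤ 2 * A * radius f c l (n + 1) := by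
    linarith [hA.left.le (n + 1), hA.right.le (n + 1)]
  have hle_len : 2 * radius f c l n ≤ A * (u n - l n) := by
    linarith [hA.left.ge n, hA.right.ge n]
  rw [scalingFactor, Nat.add_sub_cancel, D.nest_eq, D.nest_eq, len_Ioo (D.lt _), len_Ioo (D.lt _),
    mul_div_assoc', div_le_div_iff₀ (hlen n) hrad]
  have hrad_nonneg : 0 ≤ A * radius f c l (n + 1) := by
    have := (hlen (n + 1)).trans_le hlen_le
    linarith
  calc (u (n + 1) - l (n + 1)) * radius f c l n
      ≤ 2 * A * radius f c l (n + 1) * radius f c l n := by gcongr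
    _ = A * radius f c l (n + 1) * (2 * radius f c l n) := by ring
    _ ≤ A * radius f c l (n + 1) * (A * (u n - l n)) := by gcongr
    _ = A ^ 2 * radius f c l (n + 1) * (u n - l n) := by ring

lemma scalingFactor_le_sqrt (D : NestData f a b c J l u r) (hf : IsQuasiQuadratic f a b c)
    (hA : Comparable f c l u A) {n : ℕ} {Q : ℝ} (hQ : 1 ≤ Q)
    (h : radius f c l n ^ 2 ≤ (radius f c l n ^ 2 - radius f c l (n + 1) ^ 2) * Q) :
    scalingFactor f c J (n + 1) ≤ A ^ 2 * √(Q - 1) := by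
  refine (D.scalingFactor_le hA n).trans (mul_le_mul_of_nonneg_left ?_ (sq_nonneg A))
  apply Real.le_sqrt_of_sq_le
  rw [div_pow, div_le_iff₀ (pow_pos (D.radius_pos hf n) 2)]
  linarith [mul_le_mul_of_nonneg_left hQ (sq_nonneg (radius f c l (n + 1)))]

lemma exists_hasRank (D : NestData f a b c J l u r) {N : ℕ}
    (hK : K ∈ levelIntervals f c J (N + 1)) : ∃ k, HasRank f c J (N + 1) K k := by
  by_cases hc : c ∈ K
  · exact ⟨0, Or.inl ⟨hc, rfl⟩⟩
  obtain ⟨t₀, hdom, hcomp⟩ := hK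
  have hmem : f^[t₀] c ∈ K := hcomp ▸ mem_connectedComponentIn hdom
  have hsub : K ⊆ Ioo (l N) (u N) := by
    rw [hcomp, Nat.add_sub_cancel, D.nest_eq]
    exact fun w hw => (connectedComponentIn_subset _ _ hw).1
  have ht₀ : 1 ≤ t₀ := Nat.one_le_iff_ne_zero.2 fun h => hc (by rwa [h] at hmem)
  obtain ⟨t, ht⟩ := exists_isFirstPassage ⟨t₀, ht₀, hmem⟩
  have hrN : r N ≤ t := not_lt.1 fun h => D.notMem_of_lt ht.1 h (hsub ht.2.1)
  have hpass : ∃ j, t < r (N + j) := ⟨t + 1, by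
    have := D.strictMono_r.id_le (N + (t + 1))
    simp only [id] at this
    omega⟩
  classical
  obtain ⟨d, hd⟩ := Nat.exists_eq_add_one.2 (Nat.pos_of_ne_zero (n := Nat.find hpass) fun h =>
    hrN.not_gt (by simpa [h] using Nat.find_spec hpass))
  have hle : r (N + d) ≤ t := not_lt.1 (Nat.find_min hpass (by omega))
  have hlt : t < r (N + d + 1) := by
    have := Nat.find_spec hpass
    rwa [hd] at this
  refine ⟨d + 1, Or.inr ⟨hc, d.succ_pos, t, r (N + d), r (N + d + 1), ht, ?_, ?_, hle, hlt⟩⟩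
  · rw [show N + 1 + (d + 1) - 2 = N + d by omega, D.nest_eq]
    exact D.first _
  · rw [show N + 1 + (d + 1) - 1 = N + d + 1 by omega, D.nest_eq]
    exact D.first _

lemma exists_passage_of_hasRank (D : NestData f a b c J l u r) {N d : ℕ}
    (hrank : HasRank f c J (N + 1) K (d + 2)) :
    c ∉ K ∧ ∃ t, IsFirstPassage f c K t ∧ r (N + d + 1) ≤ t ∧ t < r (N + d + 2) := by
  obtain ⟨hc, -, t, r₁, r₂, ht, hr₁, hr₂, hle, hlt⟩ :=
    hrank.resolve_left fun h => absurd h.2 (Nat.succ_ne_zero _)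
  rw [show N + 1 + (d + 2) - 2 = N + d + 1 by omega, D.nest_eq] at hr₁
  rw [show N + 1 + (d + 2) - 1 = N + d + 2 by omega, D.nest_eq] at hr₂
  exact ⟨hc, t, ht, hr₁.unique (D.first _) ▸ hle, hr₂.unique (D.first _) ▸ hlt⟩

lemma exists_pullback_of_hasRank (D : NestData f a b c J l u r) (hf : IsQuasiQuadratic f a b c)
    (hrec : IsRecurrent f c) {E : ℝ}
    (hE : ∀ n, crossRatio (l n) (l (n + 1)) (u (n + 1)) (u n) ≤ E) {N d : ℕ}
    (hK : K ∈ levelIntervals f c J (N + 1)) (hrank : HasRank f c J (N + 1) K (d + 2)) :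
    (∃ m K', IsMonotonePullback f m K' K ∧
      K' ⊆ nest f c J (N + d + 1) \ nest f c J (N + d + 2) ∧
      ∃ L ∈ levelIntervals f c J (N + d + 2), closure L ⊆ K' ∧
        poincareLength L (nest f c J (N + d + 1)) ≤ poincareLength L K' ∧
        poincareLength L K' ≤ 2 * ((E / (1 + E)) ^ d * (E - 1))) ∧
    radius f c l (N + d + 2) ^ 2 ≤ (radius f c l (N + d + 2) ^ 2 - radius f c l (N + d + 3) ^ 2) *
      (1 + (E / (1 + E)) ^ d * (E - 1)) ^ 2 := by
  have hE_one : 1 ≤ E := (one_le_crossRatio _ _ _ _).trans (hE 0)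
  have hδ : 0 ≤ (E / (1 + E)) ^ d * (E - 1) := mul_nonneg (by positivity) (sub_nonneg.2 hE_one)
  obtain ⟨hc, t, ht, hrt, htr⟩ := D.exists_passage_of_hasRank hrank
  obtain ⟨k₁, k₂, τ, rfl, hret⟩ := D.exists_isReturnBranch hf hK hc
  obtain ⟨m, x', y', x, y, hB, hx', hy', hdisj, hL, hx, hxy, hy, hcross, hrad⟩ :=
    D.exists_deep_interval hf hrec hE hret ht hrt htr
  refine ⟨⟨m, Ioo x' y', ⟨isOpen_Ioo, ordConnected_Ioo, hB.bijOn hf,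
    fun w hw => hB.deriv_ne_zero hf hw hret.isBranch.subset⟩, ?_, Ioo x y, hL, ?_, ?_, ?_⟩, hrad⟩
  · rw [D.nest_eq, D.nest_eq]
    exact subset_sdiff.2 ⟨Ioo_subset_Ioo hx' hy', hdisj⟩
  · rw [closure_Ioo hxy.ne]
    exact Icc_subset_Ioo hx hy
  · rw [D.nest_eq, poincareLength_Ioo (hx'.trans_lt hx) hxy (hy.trans_le hy'),
      poincareLength_Ioo hx hxy hy]
    exact Real.log_le_log (crossRatio_pos _ _ _ _)
      (crossRatio_le_crossRatio_of_le hx' hx hy hy')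
  · rw [poincareLength_Ioo hx hxy hy]
    exact (Real.log_le_log (crossRatio_pos _ _ _ _) hcross).trans (log_sq_one_add_le hδ)

lemma exists_rank_bound (D : NestData f a b c J l u r) (hf : IsQuasiQuadratic f a b c)
    (hrec : IsRecurrent f c)
    (hE : ∀ n, crossRatio (l n) (l (n + 1)) (u (n + 1)) (u n) ≤ Real.exp lam) :
    ∃ C : ℝ, ∀ n : ℕ, 1 ≤ n → ∀ K ∈ levelIntervals f c J n,
      ∀ k : ℕ, 2 ≤ k → HasRank f c J n K k →
        (∃ (m : ℕ) (K' : Set ℝ), IsMonotonePullback f m K' K ∧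
          K' ⊆ nest f c J (n + k - 2) \ nest f c J (n + k - 1) ∧
          ∃ L ∈ levelIntervals f c J (n + k - 1), closure L ⊆ K' ∧
            poincareLength L (nest f c J (n + k - 2)) ≤ poincareLength L K' ∧
            poincareLength L K' ≤ C * sigmaBar lam ^ (k - 1)) ∧
        scalingFactor f c J (n + k) ≤ C * sigmaBar lam ^ (((k : ℝ) - 1) / 2) := by
  obtain ⟨A, hA⟩ := D.exists_comparable hf
  set E := Real.exp lam
  set σ := sigmaBar lam
  have hσ_pos : 0 < σ := sigmaBar_pos lam
  have hE_one : 0 ≤ E - 1 := sub_nonneg.2 ((one_le_crossRatio _ _ _ _).trans (hE 0))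
  refine ⟨max (2 * (E - 1) / σ) (A ^ 2 * √((E ^ 2 - 1) / σ)), fun n hn K hK k hk hrank => ?_⟩
  obtain ⟨N, rfl⟩ := Nat.exists_eq_add_of_le' hn
  obtain ⟨d, rfl⟩ := Nat.exists_eq_add_of_le' hk
  obtain ⟨⟨m, K', hpull, hK', L, hL, hLK, hle, hlen⟩, hrad⟩ :=
    D.exists_pullback_of_hasRank hf hrec hE hK hrank
  rw [show N + 1 + (d + 2) - 2 = N + d + 1 by omega, show N + 1 + (d + 2) - 1 = N + d + 2 by omega,
    show N + 1 + (d + 2) = N + d + 2 + 1 by omega, rpow_half_eq_sqrt hσ_pos.le (by omega),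
    show d + 2 - 1 = d + 1 by omega]
  change _ ≤ 2 * (σ ^ d * (E - 1)) at hlen
  refine ⟨⟨m, K', hpull, hK', L, hL, hLK, hle, hlen.trans ?_⟩,
    (D.scalingFactor_le_sqrt hf hA (one_le_pow₀ (le_add_of_nonneg_right (by positivity)))
      hrad).trans ?_⟩
  · calc 2 * (σ ^ d * (E - 1)) = 2 * (E - 1) / σ * σ ^ (d + 1) := by field_simp; ring
      _ ≤ _ := mul_le_mul_of_nonneg_right (le_max_left _ _) (by positivity)
  · have hσ_le : σ ≤ 1 := (sigmaBar_lt_one lam).le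
    calc A ^ 2 * √((1 + σ ^ d * (E - 1)) ^ 2 - 1)
        ≤ A ^ 2 * √((E ^ 2 - 1) / σ * σ ^ (d + 1)) := by
          gcongr
          exact sq_one_add_pow_mul_sub_one_le hσ_pos hσ_le E d
      _ = A ^ 2 * √((E ^ 2 - 1) / σ) * √(σ ^ (d + 1)) := by
        rw [Real.sqrt_mul' _ (by positivity), mul_assoc]
      _ ≤ _ := mul_le_mul_of_nonneg_right (le_max_right _ _) (Real.sqrt_nonneg _)

lemma crossRatio_le_exp (D : NestData f a b c J l u r) {n : ℕ}
    (h : poincareLength (nest f c J (n + 1)) (nest f c J n) ≤ lam) :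
    crossRatio (l n) (l (n + 1)) (u (n + 1)) (u n) ≤ Real.exp lam := by
  rw [D.nest_eq, D.nest_eq, poincareLength_Ioo (D.lt_left n) (D.lt _) (D.lt_right n)] at h
  exact (Real.log_le_iff_le_exp (crossRatio_pos _ _ _ _)).1 h

lemma exists_rank_le (D : NestData f a b c J l u r) (hf : IsQuasiQuadratic f a b c)
    (hrec : IsRecurrent f c) {δ : ℝ} (hδ : 0 < δ) (hμ : ∀ n, 1 ≤ n → δ ≤ scalingFactor f c J n) :
    ∃ N : ℕ, ∀ n : ℕ, 1 ≤ n → ∀ K ∈ levelIntervals f c J n,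
      ∃ k : ℕ, k ≤ N ∧ HasRank f c J n K k := by
  obtain ⟨B, hB⟩ := D.exists_crossRatio_le hf
  have hB_pos : 0 < B := (crossRatio_pos _ _ _ _).trans_le (hB 0)
  obtain ⟨C, hC⟩ := D.exists_rank_bound hf hrec (lam := Real.log B) (by rwa [Real.exp_log hB_pos])
  set σ := sigmaBar (Real.log B)
  have hσ_pos : 0 < σ := sigmaBar_pos _
  have hlim : Tendsto (fun j : ℕ => C * √(σ ^ j)) atTop (nhds 0) := by
    simpa using ((tendsto_pow_atTop_nhds_zero_of_lt_one hσ_pos.le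
      (sigmaBar_lt_one _)).sqrt.const_mul C)
  obtain ⟨j₀, hj₀⟩ := eventually_atTop.1 (hlim.eventually (gt_mem_nhds hδ))
  refine ⟨j₀ + 1, fun n hn K hK => ?_⟩
  obtain ⟨N, rfl⟩ := Nat.exists_eq_add_of_le' hn
  obtain ⟨k, hk⟩ := D.exists_hasRank hK
  refine ⟨k, ?_, hk⟩
  by_contra! hlarge
  have hbound := (hC (N + 1) hn K hK k (by omega) hk).2
  rw [rpow_half_eq_sqrt hσ_pos.le (by omega)] at hbound
  exact ((hμ _ (by omega)).trans hbound).not_gt (hj₀ (k - 1) (by omega))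

end NestData

end Ranks

end PrincipalNest

open PrincipalNest in
theorem lemma4p6 (f : ℝ → ℝ) (a b c p q : ℝ)
    (hf : IsQuasiQuadratic f a b c)
    (hI : IsInitialInterval f a b c p q)
    (hrec : IsRecurrent f c)
    (hnc : NoCentralReturns f c (Set.Ioo p q)) :
    ((∃ δ : ℝ, 0 < δ ∧ ∀ n : ℕ, 1 ≤ n → δ ≤ scalingFactor f c (Set.Ioo p q) n) →
      ∃ N : ℕ, ∀ n : ℕ, 1 ≤ n → ∀ K ∈ levelIntervals f c (Set.Ioo p q) n,
        ∃ k : ℕ, k ≤ N ∧ HasRank f c (Set.Ioo p q) n K k) ∧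
    (∀ lam : ℝ,
      (∀ n : ℕ, 1 ≤ n →
        poincareLength (nest f c (Set.Ioo p q) n) (nest f c (Set.Ioo p q) (n - 1)) ≤ lam) →
      ∃ C : ℝ, ∀ n : ℕ, 1 ≤ n → ∀ K ∈ levelIntervals f c (Set.Ioo p q) n,
        ∀ k : ℕ, 2 ≤ k → HasRank f c (Set.Ioo p q) n K k →
          (∃ (m : ℕ) (K' : Set ℝ), IsMonotonePullback f m K' K ∧
            K' ⊆ nest f c (Set.Ioo p q) (n + k - 2) \ nest f c (Set.Ioo p q) (n + k - 1) ∧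
            ∃ L ∈ levelIntervals f c (Set.Ioo p q) (n + k - 1), closure L ⊆ K' ∧
              poincareLength L (nest f c (Set.Ioo p q) (n + k - 2)) ≤ poincareLength L K' ∧
              poincareLength L K' ≤ C * sigmaBar lam ^ (k - 1)) ∧
          scalingFactor f c (Set.Ioo p q) (n + k) ≤ C * sigmaBar lam ^ (((k : ℝ) - 1) / 2)) := by
  obtain ⟨l, u, r, D⟩ := exists_nestData hf hI hrec hnc
  refine ⟨fun ⟨δ, hδ, hμ⟩ => D.exists_rank_le hf hrec hδ hμ, fun lam hlam => ?_⟩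
  exact D.exists_rank_bound hf hrec fun n => D.crossRatio_le_exp (hlam (n + 1) n.succ_pos)
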